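/- \textbf{Setting.} Let $N\in\mathbb N$ and let $\gamma\subset\mathbb C$ be a non self-intersecting smooth curve (a regular $C^1$ curve, parametrised by $[0,\infty)$ and oriented from its end point $0$ to its end point $\infty$) which meets each circle $|z|=R$, $R>0$, exactly once. At $\infty$ the curve is assumed to be tame in the following weak sense: there are constants $K,A\ge 0$ such that, for $z,w\in\gamma$ with $|w|\le |z|$, the arc of $\gamma$ between $w$ and $z$ has length at most $K(1+|z|)^A|z-w|$. (This holds for every chord-arc curve, in particular if $\gamma$ is a smooth arc of the Riemann sphere up to both end points.) Let $W:\gamma\setminus\{0\}\to\mathbb C^{N\times N}$ be of Laguerre type: each entry is a finite sum $$W^{(j,k)}(z)=\sum_{m\in I_{j,k}}h_m(z)\,z^{\alpha_m}\log^{p_m}z,\qquad z\in\gamma\setminus\{0\},$$ with $\alpha_m\in\mathbb R$, $\alpha_m>-1$, $p_m\in\{0,1,2,\dots\}$, and $h_m$ Hölder continuous, bounded and non-vanishing on $\gamma$; powers and logarithms are taken with one continuous determination of the logarithm along $\gamma$. Let $W$ be regular: all moments $W_n=\frac1{2\pi i}\int_\gamma z^nW(z)\,dz$ ($n\ge 0$)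 exist as absolutely convergent integrals, and $\det[W_{j+k}]_{j,k=0,\dots,n}\neq0$ for all $n\ge0$. \textbf{Theorem.} There are unique sequences of monic matrix polynomials $P_n^{\mathsf L},P_n^{\mathsf R}$ of degree $n$ and of nonsingular matrices $C_n\in\mathbb C^{N\times N}$, $n\ge0$, such that for $0\le k\le n$ $$\frac1{2\pi i}\int_\gamma P_n^{\mathsf L}(z)W(z)z^k\,dz=\delta_{n,k}C_n^{-1}=\frac1{2\pi i}\int_\gamma z^kW(z)P_n^{\mathsf R}(z)\,dz .$$ For $z\in\mathbb C\setminus\gamma$ put $$Q_n^{\mathsf L}(z)=\frac1{2\pi i}\int_\gamma\frac{P_n^{\mathsf L}(w)W(w)}{w-z}\,dw,\qquad Q_n^{\mathsf R}(z)=\frac1{2\pi i}\int_\gamma\frac{W(w)P_n^{\mathsf R}(w)}{w-z}\,dw,$$ $$Y_n^{\mathsf L}=\begin{bmatrix}P_n^{\mathsf L}&Q_n^{\mathsf L}\\-C_{n-1}P_{n-1}^{\mathsf L}&-C_{n-1}Q_{n-1}^{\mathsf L}\end{bmatrix},\qquad Y_n^{\mathsf R}=\begin{bmatrix}P_n^{\mathsf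 R}&-P_{n-1}^{\mathsf R}C_{n-1}\\Q_n^{\mathsf R}&-Q_{n-1}^{\mathsf R}C_{n-1}\end{bmatrix},$$ where for $n=0$ one reads $C_{-1}P_{-1}^{\mathsf L}=P_{-1}^{\mathsf R}C_{-1}=0_N$ and $C_{-1}Q_{-1}^{\mathsf L}=Q_{-1}^{\mathsf R}C_{-1}=-I_N$. Let $Y_\pm$ denote the limits of $Y$ at a point of $\gamma\setminus\{0\}$ as $z$ approaches it arbitrarily from the left ($+$) or the right ($-$) side of $\gamma$. Then, for every $n\ge0$: (i) $Y_n^{\mathsf L}$ is the unique function $Y:\mathbb C\setminus\gamma\to\mathbb C^{2N\times2N}$ such that: $Y$ is holomorphic in $\mathbb C\setminus\gamma$; there are constant matrices $Y^j$ with $Y(z)=\big(I_{2N}+\sum_{j\ge1}z^{-j}Y^j\big)\begin{bmatrix}z^nI_N&0\\0&z^{-n}I_N\end{bmatrix}$, where the series is a Poincaré asymptotic expansion as $z\to\infty$ in $\mathbb C\setminus\gamma$; at every $z\in\gamma\setminus\{0\}$ the limits $Y_\pm(z)$ exist and $Y_+(z)=Y_-(z)\begin{bmatrix}I_N&W(z)\\0&I_N\end{bmatrix}$;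 and, as $z\to0$ in $\mathbb C\setminus\gamma$, $Y(z)=\begin{bmatrix}O(1)&s_1(z)\\O(1)&s_2(z)\end{bmatrix}$ entrywise, with $\lim_{z\to0}z\,s_j(z)=0_N$, $j=1,2$. (ii) $Y_n^{\mathsf R}$ is the unique function $Y:\mathbb C\setminus\gamma\to\mathbb C^{2N\times2N}$ such that: $Y$ is holomorphic in $\mathbb C\setminus\gamma$; there are constant matrices $Y^j$ with $Y(z)=\begin{bmatrix}z^nI_N&0\\0&z^{-n}I_N\end{bmatrix}\big(I_{2N}+\sum_{j\ge1}z^{-j}Y^j\big)$, in the same asymptotic sense; at every $z\in\gamma\setminus\{0\}$ the limits $Y_\pm(z)$ exist and $Y_+(z)=\begin{bmatrix}I_N&0\\W(z)&I_N\end{bmatrix}Y_-(z)$; and, as $z\to0$ in $\mathbb C\setminus\gamma$, $Y(z)=\begin{bmatrix}O(1)&O(1)\\s_1(z)&s_2(z)\end{bmatrix}$ entrywise, with $\lim_{z\to0}z\,s_j(z)=0_N$, $j=1,2$. (iii) $\det Y_n^{\mathsf L}(z)=\det Y_n^{\mathsf R}(z)=1$ for every $z\in\mathbb C\setminus\gamma$,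 and the boundary values on both sides of $\gamma\setminus\{0\}$ have determinant $1$ as well. -/

import Mathlib

open Set Filter Topology Complex Polynomial

/-- A non self-intersecting smooth (`C¹`, regular) curve from `0` to `∞`, parametrised by `[0, ∞)`,
which meets every circle `|z| = R`, `R > 0`, exactly once.  The field `tame` expresses smoothness at
the end point `∞` in a weak form: the arc length between two points of the curve is at most
polynomially larger than their distance.  Every chord-arc curve (`A = 0`) satisfies it, in particular
every arc which is smooth on the Riemann sphere up to both of its end points. -/
structure LaguerreCurve where
  toFun : ℝ → ℂ
  contDiffOn : ContDiffOn ℝ 1 toFun (Ici 0)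
  derivWithin_ne_zero : ∀ t ∈ Ici (0 : ℝ), derivWithin toFun (Ici 0) t ≠ 0
  injOn : InjOn toFun (Ici 0)
  map_zero : toFun 0 = 0
  tendsto_infty : Tendsto (fun t => ‖toFun t‖) atTop atTop
  circle : ∀ R : ℝ, 0 < R → ∃! t : ℝ, 0 ≤ t ∧ ‖toFun t‖ = R
  tame : ∃ (K : ℝ) (A : ℕ), ∀ s t : ℝ, 0 ≤ s → s ≤ t →
    ∫ u in s..t, ‖deriv toFun u‖ ≤ K * (1 + ‖toFun t‖) ^ A * ‖toFun t - toFun s‖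

namespace LaguerreCurve

/-- The curve as a closed subset of the plane, the end point `0` included. -/
def support (γ : LaguerreCurve) : Set ℂ := γ.toFun '' Ici 0

/-- Entrywise integral `∫_γ F(z) dz` of a matrix valued function, `γ` being oriented
from `0` to `∞`. -/
noncomputable def integral {N : ℕ} (γ : LaguerreCurve) (F : ℂ → Matrix (Fin N) (Fin N) ℂ) :
    Matrix (Fin N) (Fin N) ℂ :=
  Matrix.of fun i j => ∫ t in Ioi (0 : ℝ), F (γ.toFun t) i j * deriv γ.toFun t

/-- The filter of points approaching `γ(t)`, `t > 0`, from the left (`+`) side of `γ`.  As `γ` meets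
every circle centred at `0` once and `|γ|` increases, the left side near `γ(t)` consists of the points
`γ(s) e^{iφ}` with `s` near `t` and `φ` small and positive. -/
noncomputable def leftNhds (γ : LaguerreCurve) (t : ℝ) : Filter ℂ :=
  map (fun p : ℝ × ℝ => γ.toFun p.1 * exp (p.2 * I)) (𝓝 t ×ˢ 𝓝[>] 0)

/-- The filter of points approaching `γ(t)`, `t > 0`, from the right (`-`) side of `γ`. -/
noncomputable def rightNhds (γ : LaguerreCurve) (t : ℝ) : Filter ℂ :=
  map (fun p : ℝ × ℝ => γ.toFun p.1 * exp (p.2 * I)) (𝓝 t ×ˢ 𝓝[<] 0)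

/-- The filter `z → ∞` in `ℂ \ γ` (with no restriction on how `z` may approach `γ`). -/
noncomputable def atInfty (γ : LaguerreCurve) : Filter ℂ := Bornology.cobounded ℂ ⊓ 𝓟 γ.supportᶜ

/-- The filter `z → 0` in `ℂ \ γ`. -/
noncomputable def atOrigin (γ : LaguerreCurve) : Filter ℂ := 𝓝[γ.supportᶜ] 0

/-- `ℓ` is a determination of the logarithm along `γ`. -/
def IsLogAlong (γ : LaguerreCurve) (ℓ : ℂ → ℂ) : Prop :=
  ContinuousOn ℓ (γ.support \ {0}) ∧ ∀ z ∈ γ.support \ {0}, exp (ℓ z) = z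

end LaguerreCurve

/-- The entries of `W` are finite sums `∑ h_m(z) z^{α_m} log^{p_m} z` on `γ`, with `α_m > -1`,
`p_m ∈ {0, 1, …}` and `h_m` Hölder continuous, bounded and non-vanishing on `γ`; powers and logarithms
are taken with a determination along `γ`. -/
def IsLaguerreType {N : ℕ} (γ : LaguerreCurve) (W : ℂ → Matrix (Fin N) (Fin N) ℂ) : Prop :=
  ∃ ℓ : ℂ → ℂ, γ.IsLogAlong ℓ ∧ ∀ j k : Fin N,
    ∃ (M : ℕ) (h : Fin M → ℂ → ℂ) (α : Fin M → ℝ) (p : Fin M → ℕ),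
      (∀ m, -1 < α m) ∧
      (∀ m, ∃ K β : NNReal, 0 < β ∧ β ≤ 1 ∧ HolderOnWith K β (h m) γ.support) ∧
      (∀ m, ∃ B : ℝ, ∀ z ∈ γ.support, ‖h m z‖ ≤ B) ∧
      (∀ m, ∀ z ∈ γ.support, h m z ≠ 0) ∧
      ∀ z ∈ γ.support \ {0}, W z j k = ∑ m, h m z * exp (α m * ℓ z) * ℓ z ^ p m

/-- The moment `W_n = (1 / 2πi) ∫_γ z^n W(z) dz`. -/
noncomputable def weightMoment {N : ℕ} (γ : LaguerreCurve) (W : ℂ → Matrix (Fin N) (Fin N) ℂ)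
    (n : ℕ) : Matrix (Fin N) (Fin N) ℂ :=
  (2 * Real.pi * I)⁻¹ • γ.integral (fun z => z ^ n • W z)

/-- The block Hankel matrix `[W_{j+k}]_{j,k=0,…,n}`. -/
noncomputable def blockHankel {N : ℕ} (γ : LaguerreCurve) (W : ℂ → Matrix (Fin N) (Fin N) ℂ)
    (n : ℕ) : Matrix (Fin (n + 1) × Fin N) (Fin (n + 1) × Fin N) ℂ :=
  Matrix.of fun a b => weightMoment γ W ((a.1 : ℕ) + (b.1 : ℕ)) a.2 b.2

/-- Regularity: all moments exist and all block Hankel determinants are nonzero. -/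
structure IsRegularWeight {N : ℕ} (γ : LaguerreCurve) (W : ℂ → Matrix (Fin N) (Fin N) ℂ) :
    Prop where
  integrable : ∀ (n : ℕ) (i j : Fin N), MeasureTheory.IntegrableOn
    (fun t : ℝ => γ.toFun t ^ n * W (γ.toFun t) i j * deriv γ.toFun t) (Ioi 0)
  det_ne_zero : ∀ n : ℕ, (blockHankel γ W n).det ≠ 0

/-- Value of a matrix polynomial at a complex number `z`, i.e. at `z I_N`. -/
noncomputable def evalAt {N : ℕ} (P : (Matrix (Fin N) (Fin N) ℂ)[X]) (z : ℂ) :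
    Matrix (Fin N) (Fin N) ℂ :=
  P.eval (Matrix.scalar (Fin N) z)

/-- `P^L`, `P^R` are the sequences of left and right monic matrix orthogonal polynomials for `W`,
with nonsingular normalising matrices `C_n`. -/
structure IsBiorthogonalSystem {N : ℕ} (γ : LaguerreCurve) (W : ℂ → Matrix (Fin N) (Fin N) ℂ)
    (PL PR : ℕ → (Matrix (Fin N) (Fin N) ℂ)[X]) (C : ℕ → Matrix (Fin N) (Fin N) ℂ) : Prop where
  monic_left : ∀ n, (PL n).natDegree ≤ n ∧ (PL n).coeff n = 1
  monic_right : ∀ n, (PR n).natDegree ≤ n ∧ (PR n).coeff n = 1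
  nonsingular : ∀ n, IsUnit (C n).det
  orthogonal_left : ∀ n, ∀ k ≤ n,
    (2 * Real.pi * I)⁻¹ • γ.integral (fun z => z ^ k • (evalAt (PL n) z * W z))
      = if n = k then (C n)⁻¹ else 0
  orthogonal_right : ∀ n, ∀ k ≤ n,
    (2 * Real.pi * I)⁻¹ • γ.integral (fun z => z ^ k • (W z * evalAt (PR n) z))
      = if n = k then (C n)⁻¹ else 0

/-- Second kind function `(1 / 2πi) ∫_γ P(w) W(w) / (w - z) dw`. -/
noncomputable def secondKindL {N : ℕ} (γ : LaguerreCurve) (W : ℂ → Matrix (Fin N) (Fin N) ℂ)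
    (P : (Matrix (Fin N) (Fin N) ℂ)[X]) (z : ℂ) : Matrix (Fin N) (Fin N) ℂ :=
  (2 * Real.pi * I)⁻¹ • γ.integral (fun w => (w - z)⁻¹ • (evalAt P w * W w))

/-- Second kind function `(1 / 2πi) ∫_γ W(w) P(w) / (w - z) dw`. -/
noncomputable def secondKindR {N : ℕ} (γ : LaguerreCurve) (W : ℂ → Matrix (Fin N) (Fin N) ℂ)
    (P : (Matrix (Fin N) (Fin N) ℂ)[X]) (z : ℂ) : Matrix (Fin N) (Fin N) ℂ :=
  (2 * Real.pi * I)⁻¹ • γ.integral (fun w => (w - z)⁻¹ • (W w * evalAt P w))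

/-- The matrix `Y_n^L`.  For `n = 0` the conventions `C_{-1} P_{-1}^L = 0`, `C_{-1} Q_{-1}^L = -I`
are used. -/
noncomputable def YL {N : ℕ} (γ : LaguerreCurve) (W : ℂ → Matrix (Fin N) (Fin N) ℂ)
    (PL : ℕ → (Matrix (Fin N) (Fin N) ℂ)[X]) (C : ℕ → Matrix (Fin N) (Fin N) ℂ) :
    ℕ → ℂ → Matrix (Fin N ⊕ Fin N) (Fin N ⊕ Fin N) ℂ
  | 0, z => Matrix.fromBlocks (evalAt (PL 0) z) (secondKindL γ W (PL 0) z) 0 1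
  | n + 1, z => Matrix.fromBlocks
      (evalAt (PL (n + 1)) z) (secondKindL γ W (PL (n + 1)) z)
      (-(C n * evalAt (PL n) z)) (-(C n * secondKindL γ W (PL n) z))

/-- The matrix `Y_n^R`.  For `n = 0` the conventions `P_{-1}^R C_{-1} = 0`, `Q_{-1}^R C_{-1} = -I`
are used. -/
noncomputable def YR {N : ℕ} (γ : LaguerreCurve) (W : ℂ → Matrix (Fin N) (Fin N) ℂ)
    (PR : ℕ → (Matrix (Fin N) (Fin N) ℂ)[X]) (C : ℕ → Matrix (Fin N) (Fin N) ℂ) :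
    ℕ → ℂ → Matrix (Fin N ⊕ Fin N) (Fin N ⊕ Fin N) ℂ
  | 0, z => Matrix.fromBlocks (evalAt (PR 0) z) 0 (secondKindR γ W (PR 0) z) 1
  | n + 1, z => Matrix.fromBlocks
      (evalAt (PR (n + 1)) z) (-(evalAt (PR n) z * C n))
      (secondKindR γ W (PR (n + 1)) z) (-(secondKindR γ W (PR n) z * C n))

/-- The matrix `diag(I_N z^n, I_N z^{-n})`. -/
noncomputable def powDiag (N n : ℕ) (z : ℂ) : Matrix (Fin N ⊕ Fin N) (Fin N ⊕ Fin N) ℂ :=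
  Matrix.fromBlocks (z ^ n • 1) 0 0 ((z ^ n)⁻¹ • 1)

/-- `F(z) ~ I + ∑_{j ≥ 1} z^{-j} Y^j` as `z → ∞` in `ℂ \ γ`, in the sense of Poincaré, for some
constant matrices `Y^j`. -/
def HasUnitExpansion {N : ℕ} (γ : LaguerreCurve)
    (F : ℂ → Matrix (Fin N ⊕ Fin N) (Fin N ⊕ Fin N) ℂ) : Prop :=
  ∃ Yc : ℕ → Matrix (Fin N ⊕ Fin N) (Fin N ⊕ Fin N) ℂ, ∀ (m : ℕ) (a b : Fin N ⊕ Fin N),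
    (fun z => (F z - (1 + ∑ j ∈ Finset.Icc 1 m, (z ^ j)⁻¹ • Yc j)) a b)
      =O[γ.atInfty] (fun z => (z ^ (m + 1))⁻¹)

/-- `Y` solves the left Riemann–Hilbert problem. -/
structure IsSolutionRHL {N : ℕ} (γ : LaguerreCurve) (W : ℂ → Matrix (Fin N) (Fin N) ℂ) (n : ℕ)
    (Y : ℂ → Matrix (Fin N ⊕ Fin N) (Fin N ⊕ Fin N) ℂ) : Prop where
  holomorphic : ∀ a b, DifferentiableOn ℂ (fun z => Y z a b) γ.supportᶜ
  infinity : ∃ F : ℂ → Matrix (Fin N ⊕ Fin N) (Fin N ⊕ Fin N) ℂ,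
    HasUnitExpansion γ F ∧ ∀ z ∈ γ.supportᶜ, Y z = F z * powDiag N n z
  jump : ∀ t : ℝ, 0 < t → ∃ Yp Ym : Matrix (Fin N ⊕ Fin N) (Fin N ⊕ Fin N) ℂ,
    Tendsto Y (γ.leftNhds t) (𝓝 Yp) ∧ Tendsto Y (γ.rightNhds t) (𝓝 Ym) ∧
      Yp = Ym * Matrix.fromBlocks 1 (W (γ.toFun t)) 0 1
  origin_bounded : ∀ (a : Fin N ⊕ Fin N) (j : Fin N),
    (fun z => Y z a (Sum.inl j)) =O[γ.atOrigin] (fun _ => (1 : ℂ))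
  origin_small : ∀ (a : Fin N ⊕ Fin N) (j : Fin N),
    Tendsto (fun z => z * Y z a (Sum.inr j)) γ.atOrigin (𝓝 0)

/-- `Y` solves the right Riemann–Hilbert problem. -/
structure IsSolutionRHR {N : ℕ} (γ : LaguerreCurve) (W : ℂ → Matrix (Fin N) (Fin N) ℂ) (n : ℕ)
    (Y : ℂ → Matrix (Fin N ⊕ Fin N) (Fin N ⊕ Fin N) ℂ) : Prop where
  holomorphic : ∀ a b, DifferentiableOn ℂ (fun z => Y z a b) γ.supportᶜ
  infinity : ∃ F : ℂ → Matrix (Fin N ⊕ Fin N) (Fin N ⊕ Fin N) ℂ,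
    HasUnitExpansion γ F ∧ ∀ z ∈ γ.supportᶜ, Y z = powDiag N n z * F z
  jump : ∀ t : ℝ, 0 < t → ∃ Yp Ym : Matrix (Fin N ⊕ Fin N) (Fin N ⊕ Fin N) ℂ,
    Tendsto Y (γ.leftNhds t) (𝓝 Yp) ∧ Tendsto Y (γ.rightNhds t) (𝓝 Ym) ∧
      Yp = Matrix.fromBlocks 1 0 (W (γ.toFun t)) 1 * Ym
  origin_bounded : ∀ (j : Fin N) (b : Fin N ⊕ Fin N),
    (fun z => Y z (Sum.inl j) b) =O[γ.atOrigin] (fun _ => (1 : ℂ))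
  origin_small : ∀ (j : Fin N) (b : Fin N ⊕ Fin N),
    Tendsto (fun z => z * Y z (Sum.inr j) b) γ.atOrigin (𝓝 0)

/-- `det Y = 1` on `ℂ \ γ`, and also for the boundary values of `Y` on both sides of `γ`. -/
def HasDetOne {N : ℕ} (γ : LaguerreCurve)
    (Y : ℂ → Matrix (Fin N ⊕ Fin N) (Fin N ⊕ Fin N) ℂ) : Prop :=
  (∀ z ∈ γ.supportᶜ, (Y z).det = 1) ∧
  ∀ t : ℝ, 0 < t → ∀ A : Matrix (Fin N ⊕ Fin N) (Fin N ⊕ Fin N) ℂ,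
    (Tendsto Y (γ.leftNhds t) (𝓝 A) ∨ Tendsto Y (γ.rightNhds t) (𝓝 A)) → A.det = 1

namespace LaguerreCurve

variable (γ : LaguerreCurve)

/-! ### The radial parameter -/

/-! The algebraic half is linear algebra over the block Hankel matrices `H n`. Orthogonality of a
left polynomial says that its coefficient row times `H n` is `C⁻¹ [0 ⋯ 0 I]`. Being monic then
forces `C n` to be the last diagonal block of `(H n)⁻¹`, and this block is invertible because the
Hankel matrix one size smaller is nonsingular (`isUnit_det_hankelCorner`,
`isBiorthogonalSystem_iff`).

Existence for the Riemann–Hilbert problem is a study of Cauchy integrals. The jump is the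
Sokhotski–Plemelj formula (`exists_tendsto_cauchy`). The expansion at infinity follows from repeated
use of `z / (w - z) = w / (w - z) - 1` once Cauchy integrals are bounded near infinity right up to
the curve, and the normalisation comes from the vanishing moments. Such uniform bounds need
pointwise decay of the weight, whereas only integrability of the moments is given. The decay is
recovered from the Hölder estimates, which grow at most polynomially: a large value would persist on
an arc that is not too short and make some moment integral too large (`IsModerate.exists_bound`,
`IsModerate.goodDensity`).

A function holomorphic off the curve, with equal boundary values on both sides and size `o(1/z)` at
the origin, satisfies Liouville's theorem (`NoJump.eq_of_tendsto`). To remove the curve, an arc is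
rotated about the origin. It leaves the curve at once and meets it again only after a full turn,
because every circle contains one point of the curve. The derivative in the angle of the integral
over the rotated arc involves only the two end points, so integrals over concentric circles agree
(`circleIntegral_eq`).

For uniqueness, a left solution `Y` is paired with a right solution `Z`: with `J = [0 I; -I 0]`, the
product `Y J Z` has no jump, is `o(1/z)` at the origin and tends to `J`, hence equals `J`
(`IsSolutionRHL.mul_symplecticUnit_mul`). So `Z` determines the inverse of every left solution,
without prior knowledge of the determinant. The right problem is the left one for the transposed
weight.

For the determinant, the condition at the origin by itself allows `det Y` a high-order singularity.
Multiplication by the unipotent matrix `[I -q; 0 I]`, with `q` the Cauchy integral of `W` itself,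
removes the jump of the whole matrix and keeps the determinant. The entries are then bounded at the
origin and Liouville's theorem applies (`IsSolutionRHL.det_eq_one`). -/

theorem continuousOn_toFun : ContinuousOn γ.toFun (Ici 0) := γ.contDiffOn.continuousOn

/-- The circle condition makes the modulus injective, the radius `0` being covered by injectivity of
the curve. A continuous injective function on an interval is monotone, and the value `0` at the
start decides the direction. -/
theorem strictMonoOn_norm : StrictMonoOn (fun t => ‖γ.toFun t‖) (Ici 0) := by
  have hinj : InjOn (fun t => ‖γ.toFun t‖) (Ici 0) := by
    intro s hs t ht h
    simp only at h
    rcases eq_or_lt_of_le (norm_nonneg (γ.toFun s)) with h0 | h0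
    · rw [← h0] at h
      exact γ.injOn hs ht ((norm_eq_zero.1 h0.symm).trans (norm_eq_zero.1 h.symm).symm)
    · exact (γ.circle _ h0).unique ⟨hs, rfl⟩ ⟨ht, h.symm⟩
  intro s hs t ht hst
  have := ContinuousOn.strictMonoOn_of_injOn_Icc (a := 0) (b := t) (f := fun t => ‖γ.toFun t‖) ht
    (by simp [γ.map_zero]) (γ.continuousOn_toFun.norm.mono Icc_subset_Ici_self)
    (hinj.mono Icc_subset_Ici_self)
  exact this ⟨hs, hst.le⟩ ⟨ht, le_rfl⟩ hst

/-- The modulus along the curve, extended to an increasing bijection of the line. -/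
noncomputable def radius (t : ℝ) : ℝ := if 0 ≤ t then ‖γ.toFun t‖ else t

theorem radius_of_nonneg {t : ℝ} (ht : 0 ≤ t) : γ.radius t = ‖γ.toFun t‖ := if_pos ht

theorem strictMono_radius : StrictMono γ.radius := by
  intro s t hst
  unfold radius
  split_ifs with h1 h2 h2
  · exact γ.strictMonoOn_norm h1 h2 hst
  · linarith
  · exact (not_le.1 h1).trans_le (norm_nonneg _)
  · exact hst

theorem surjective_radius : Function.Surjective γ.radius := by
  intro R
  rcases lt_trichotomy R 0 with h | h | h
  · exact ⟨R, if_neg (not_le.2 h)⟩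
  · exact ⟨0, by simp [radius, γ.map_zero, h]⟩
  · obtain ⟨t, ht, -⟩ := γ.circle R h
    exact ⟨t, by rw [radius_of_nonneg _ ht.1, ht.2]⟩

/-- The parameter of the point of the curve of modulus `R`. -/
noncomputable def param (R : ℝ) : ℝ :=
  (StrictMono.orderIsoOfSurjective γ.radius γ.strictMono_radius γ.surjective_radius).symm R

theorem radius_param (R : ℝ) : γ.radius (γ.param R) = R :=
  (StrictMono.orderIsoOfSurjective γ.radius γ.strictMono_radius
    γ.surjective_radius).apply_symm_apply R

theorem param_radius (t : ℝ) : γ.param (γ.radius t) = t :=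
  (StrictMono.orderIsoOfSurjective γ.radius γ.strictMono_radius
    γ.surjective_radius).symm_apply_apply t

theorem strictMono_param : StrictMono γ.param := OrderIso.strictMono _

theorem continuous_param : Continuous γ.param := OrderIso.continuous _

theorem param_norm {t : ℝ} (ht : 0 ≤ t) : γ.param ‖γ.toFun t‖ = t := by
  rw [← γ.radius_of_nonneg ht, param_radius]

theorem param_zero : γ.param 0 = 0 := by
  have := γ.param_norm le_rfl
  rwa [γ.map_zero, norm_zero] at this

theorem param_nonneg {R : ℝ} (hR : 0 ≤ R) : 0 ≤ γ.param R := by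
  rw [← γ.param_zero]; exact γ.strictMono_param.monotone hR

theorem param_pos {R : ℝ} (hR : 0 < R) : 0 < γ.param R := by
  rw [← γ.param_zero]; exact γ.strictMono_param hR

theorem norm_param {R : ℝ} (hR : 0 ≤ R) : ‖γ.toFun (γ.param R)‖ = R := by
  rw [← γ.radius_of_nonneg (γ.param_nonneg hR), radius_param]

theorem norm_pos {t : ℝ} (ht : 0 < t) : 0 < ‖γ.toFun t‖ := by
  simpa [γ.map_zero] using γ.strictMonoOn_norm (a := 0) self_mem_Ici ht.le ht

theorem toFun_ne_zero {t : ℝ} (ht : 0 < t) : γ.toFun t ≠ 0 := norm_pos_iff.1 (γ.norm_pos ht)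

theorem norm_le_norm {s t : ℝ} (hs : 0 ≤ s) (hst : s ≤ t) : ‖γ.toFun s‖ ≤ ‖γ.toFun t‖ :=
  γ.strictMonoOn_norm.monotoneOn hs (mem_Ici.2 (hs.trans hst)) hst

/-- The point of the curve with the same modulus as `z`. -/
noncomputable def foot (z : ℂ) : ℂ := γ.toFun (γ.param ‖z‖)

theorem continuous_foot : Continuous γ.foot := by
  have : Continuous fun z : ℂ => γ.param ‖z‖ := γ.continuous_param.comp continuous_norm
  exact γ.continuousOn_toFun.comp_continuous this fun z => γ.param_nonneg (norm_nonneg z)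

theorem norm_foot (z : ℂ) : ‖γ.foot z‖ = ‖z‖ := γ.norm_param (norm_nonneg z)

theorem foot_toFun {t : ℝ} (ht : 0 ≤ t) : γ.foot (γ.toFun t) = γ.toFun t := by
  rw [foot, γ.param_norm ht]

theorem mem_support_iff {z : ℂ} : z ∈ γ.support ↔ γ.foot z = z := by
  constructor
  · rintro ⟨t, ht, rfl⟩
    exact γ.foot_toFun ht
  · intro h
    exact ⟨_, γ.param_nonneg (norm_nonneg z), h⟩

theorem toFun_mem_support {t : ℝ} (ht : 0 ≤ t) : γ.toFun t ∈ γ.support := ⟨t, ht, rfl⟩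

theorem zero_mem_support : (0 : ℂ) ∈ γ.support := ⟨0, self_mem_Ici, γ.map_zero⟩

theorem isClosed_support : IsClosed γ.support := by
  have : γ.support = {z | γ.foot z = z} := by ext z; exact γ.mem_support_iff
  rw [this]
  exact isClosed_eq γ.continuous_foot continuous_id

theorem isOpen_compl_support : IsOpen γ.supportᶜ := γ.isClosed_support.isOpen_compl

theorem ne_zero_of_notMem {z : ℂ} (hz : z ∈ γ.supportᶜ) : z ≠ 0 := by
  rintro rfl; exact hz γ.zero_mem_support

theorem support_diff_zero {w : ℂ} (hw : w ∈ γ.support \ {0}) : ∃ t, 0 < t ∧ γ.toFun t = w := by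
  obtain ⟨⟨t, ht, rfl⟩, h0⟩ := hw
  refine ⟨t, lt_of_le_of_ne ht ?_, rfl⟩
  rintro rfl
  exact h0 γ.map_zero

theorem toFun_mem_diff {t : ℝ} (ht : 0 < t) : γ.toFun t ∈ γ.support \ {0} :=
  ⟨γ.toFun_mem_support ht.le, γ.toFun_ne_zero ht⟩

/-! ### The polar chart and the two sides of the curve -/

theorem norm_rot (s φ : ℝ) : ‖γ.toFun s * exp (φ * I)‖ = ‖γ.toFun s‖ := by
  rw [norm_mul, norm_exp_ofReal_mul_I, mul_one]

/-- A rotation keeps the modulus, and the curve has only one point of each modulus. -/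
theorem rot_mem_support_iff {s φ : ℝ} (hs : 0 < s) :
    γ.toFun s * exp (φ * I) ∈ γ.support ↔ exp (φ * I) = 1 := by
  rw [mem_support_iff, foot, norm_rot, γ.param_norm hs.le]
  constructor
  · intro h
    have := mul_left_cancel₀ (γ.toFun_ne_zero hs) ((mul_one _).trans h)
    exact this.symm
  · intro h; rw [h, mul_one]

theorem exp_mul_I_ne_one {φ : ℝ} (h0 : φ ≠ 0) (h1 : -(2 * Real.pi) < φ) (h2 : φ < 2 * Real.pi) :
    exp (φ * I) ≠ 1 := by
  intro h
  obtain ⟨n, hn⟩ := Complex.exp_eq_one_iff.1 h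
  have h3 : (φ : ℂ) = ((n * (2 * Real.pi) : ℝ) : ℂ) := by
    apply mul_right_cancel₀ I_ne_zero
    rw [hn]; push_cast; ring
  have h4 : φ = n * (2 * Real.pi) := by exact_mod_cast h3
  have hpi := Real.pi_pos
  have h5 : (n : ℝ) < 1 := by nlinarith
  have h6 : (-1 : ℝ) < n := by nlinarith
  have h7 : n < 1 := by exact_mod_cast h5
  have h8 : -1 < n := by exact_mod_cast h6
  have : n = 0 := by omega
  apply h0; rw [h4, this]; simp

theorem rot_notMem {s φ : ℝ} (hs : 0 < s) (h0 : φ ≠ 0) (h1 : -(2 * Real.pi) < φ)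
    (h2 : φ < 2 * Real.pi) : γ.toFun s * exp (φ * I) ∈ γ.supportᶜ := fun h =>
  exp_mul_I_ne_one h0 h1 h2 ((γ.rot_mem_support_iff hs).1 h)

/-- With `tendsto_chart`, this makes `(s, φ) ↦ γ(s) e^{iφ}` a chart near each point of the curve
other than the origin, in which the side is read off from the sign of `φ`. -/
theorem foot_mul_exp (z : ℂ) : γ.foot z * exp ((arg (z / γ.foot z) : ℝ) * I) = z := by
  rcases eq_or_ne z 0 with rfl | hz
  · have : γ.foot 0 = 0 := by
      have := γ.norm_foot 0
      rwa [norm_zero, norm_eq_zero] at this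
    rw [this, zero_mul]
  · have h0 : γ.foot z ≠ 0 := by rw [← norm_pos_iff, norm_foot]; exact norm_pos_iff.2 hz
    have h1 : ‖z / γ.foot z‖ = 1 := by
      rw [norm_div, norm_foot, div_self (norm_ne_zero_iff.2 hz)]
    have := norm_mul_exp_arg_mul_I (z / γ.foot z)
    rw [h1, ofReal_one, one_mul] at this
    rw [this, mul_div_cancel₀ _ h0]

theorem continuousAt_toFun {t : ℝ} (ht : 0 < t) : ContinuousAt γ.toFun t :=
  γ.continuousOn_toFun.continuousAt (Ici_mem_nhds ht)

theorem tendsto_rot {t : ℝ} (ht : 0 < t) :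
    Tendsto (fun p : ℝ × ℝ => γ.toFun p.1 * exp (p.2 * I)) (𝓝 t ×ˢ 𝓝 0) (𝓝 (γ.toFun t)) := by
  rw [← nhds_prod_eq]
  have h : ContinuousAt (fun p : ℝ × ℝ => γ.toFun p.1 * exp (p.2 * I)) (t, 0) := by
    apply ContinuousAt.mul
    · exact ContinuousAt.comp (x := (t, (0 : ℝ))) (f := Prod.fst) (g := γ.toFun)
        (γ.continuousAt_toFun ht) continuousAt_fst
    · fun_prop
  have h2 := h.tendsto
  simpa using h2

theorem tendsto_chart {t : ℝ} (ht : 0 < t) :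
    Tendsto (fun z => (γ.param ‖z‖, arg (z / γ.foot z))) (𝓝 (γ.toFun t)) (𝓝 t ×ˢ 𝓝 0) := by
  apply Tendsto.prodMk
  · have := (γ.continuous_param.comp continuous_norm).tendsto (γ.toFun t)
    simpa [γ.param_norm ht.le, Function.comp_def] using this
  · have h1 : Tendsto (fun z => z / γ.foot z) (𝓝 (γ.toFun t)) (𝓝 1) := by
      have h0 : γ.foot (γ.toFun t) ≠ 0 := by
        rw [γ.foot_toFun ht.le]; exact γ.toFun_ne_zero ht
      have := (continuousAt_id (x := γ.toFun t)).div γ.continuous_foot.continuousAt h0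
      have h2 := this.tendsto
      simpa [γ.foot_toFun ht.le, γ.toFun_ne_zero ht, Pi.div_def] using h2
    have h2 : ContinuousAt arg 1 := continuousAt_arg (by simp)
    have := h2.tendsto.comp h1
    simpa [arg_one, Function.comp_def] using this

theorem leftNhds_le {t : ℝ} (ht : 0 < t) : γ.leftNhds t ≤ 𝓝 (γ.toFun t) :=
  (γ.tendsto_rot ht).mono_left (prod_mono le_rfl nhdsWithin_le_nhds)

theorem rightNhds_le {t : ℝ} (ht : 0 < t) : γ.rightNhds t ≤ 𝓝 (γ.toFun t) :=
  (γ.tendsto_rot ht).mono_left (prod_mono le_rfl nhdsWithin_le_nhds)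

instance leftNhds_neBot (t : ℝ) : (γ.leftNhds t).NeBot := by
  unfold leftNhds; infer_instance

instance rightNhds_neBot (t : ℝ) : (γ.rightNhds t).NeBot := by
  unfold rightNhds; infer_instance

theorem compl_support_mem_leftNhds {t : ℝ} (ht : 0 < t) : γ.supportᶜ ∈ γ.leftNhds t := by
  rw [leftNhds, mem_map]
  filter_upwards [prod_mem_prod (Ioi_mem_nhds ht)
    (Ioo_mem_nhdsGT (show (0 : ℝ) < 2 * Real.pi by positivity))] with p hp
  exact γ.rot_notMem hp.1 hp.2.1.ne' (by linarith [hp.2.1, Real.pi_pos]) hp.2.2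

theorem compl_support_mem_rightNhds {t : ℝ} (ht : 0 < t) : γ.supportᶜ ∈ γ.rightNhds t := by
  rw [rightNhds, mem_map]
  filter_upwards [prod_mem_prod (Ioi_mem_nhds ht)
    (Ioo_mem_nhdsLT (show -(2 * Real.pi) < 0 by linarith [Real.pi_pos]))] with p hp
  exact γ.rot_notMem hp.1 hp.2.2.ne hp.2.1 (by linarith [hp.2.2, Real.pi_pos])

/-! ### Arc length -/

theorem hasDerivAt {t : ℝ} (ht : 0 < t) : HasDerivAt γ.toFun (deriv γ.toFun t) t :=
  ((γ.contDiffOn.differentiableOn one_ne_zero).differentiableAt (Ici_mem_nhds ht)).hasDerivAt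

theorem continuousOn_derivWithin : ContinuousOn (derivWithin γ.toFun (Ici 0)) (Ici 0) :=
  γ.contDiffOn.continuousOn_derivWithin (uniqueDiffOn_Ici 0) le_rfl

theorem derivWithin_eq {t : ℝ} (ht : 0 < t) : derivWithin γ.toFun (Ici 0) t = deriv γ.toFun t :=
  derivWithin_of_mem_nhds (Ici_mem_nhds ht)

theorem continuousOn_deriv : ContinuousOn (deriv γ.toFun) (Ioi 0) :=
  (γ.continuousOn_derivWithin.mono Ioi_subset_Ici_self).congr fun _ ht => (γ.derivWithin_eq ht).symm

theorem intervalIntegrable_deriv {a b : ℝ} (ha : 0 ≤ a) (hb : 0 ≤ b) :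
    IntervalIntegrable (deriv γ.toFun) MeasureTheory.volume a b := by
  have h : IntervalIntegrable (derivWithin γ.toFun (Ici 0)) MeasureTheory.volume a b :=
    (γ.continuousOn_derivWithin.mono fun x hx =>
      (le_min ha hb).trans hx.1).intervalIntegrable
  refine h.congr ?_
  intro t ht
  exact γ.derivWithin_eq ((le_min ha hb).trans_lt ht.1)

/-- The arc length from the origin. -/
noncomputable def arc (t : ℝ) : ℝ := ∫ u in (0 : ℝ)..t, ‖deriv γ.toFun u‖

theorem arc_sub {s t : ℝ} (hs : 0 ≤ s) (ht : 0 ≤ t) :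
    γ.arc t - γ.arc s = ∫ u in s..t, ‖deriv γ.toFun u‖ :=
  intervalIntegral.integral_interval_sub_left (γ.intervalIntegrable_deriv le_rfl ht).norm
    (γ.intervalIntegrable_deriv le_rfl hs).norm

theorem arc_zero : γ.arc 0 = 0 := intervalIntegral.integral_same

theorem norm_sub_le_arc {s t : ℝ} (hs : 0 ≤ s) (hst : s ≤ t) :
    ‖γ.toFun t - γ.toFun s‖ ≤ γ.arc t - γ.arc s := by
  rw [γ.arc_sub hs (hs.trans hst), ← intervalIntegral.integral_eq_sub_of_hasDerivAt_of_le hst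
    (γ.continuousOn_toFun.mono fun x hx => hs.trans hx.1)
    (fun x hx => γ.hasDerivAt (hs.trans_lt hx.1))
    (γ.intervalIntegrable_deriv hs (hs.trans hst))]
  exact intervalIntegral.norm_integral_le_integral_norm hst

theorem arc_lt {s t : ℝ} (hs : 0 ≤ s) (hst : s < t) : γ.arc s < γ.arc t := by
  have h1 := γ.norm_sub_le_arc hs hst.le
  have h2 : 0 < ‖γ.toFun t - γ.toFun s‖ := by
    rw [norm_pos_iff, sub_ne_zero]
    exact fun h => hst.ne' (γ.injOn (hs.trans hst.le) hs h)
  linarith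

theorem arc_le {s t : ℝ} (hs : 0 ≤ s) (hst : s ≤ t) : γ.arc s ≤ γ.arc t := by
  rcases hst.eq_or_lt with rfl | h
  · exact le_rfl
  · exact (γ.arc_lt hs h).le

theorem norm_le_arc {t : ℝ} (ht : 0 ≤ t) : ‖γ.toFun t‖ ≤ γ.arc t := by
  simpa [γ.map_zero, γ.arc_zero] using γ.norm_sub_le_arc le_rfl ht

theorem continuousOn_arc : ContinuousOn γ.arc (Ici 0) := by
  intro t ht
  have h := intervalIntegral.continuousOn_primitive_interval'
    (γ.intervalIntegrable_deriv le_rfl (show (0 : ℝ) ≤ t + 1 by linarith [mem_Ici.1 ht])).norm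
    (left_mem_uIcc)
  have ht1 : (0 : ℝ) ≤ t + 1 := by linarith [mem_Ici.1 ht]
  rw [uIcc_of_le ht1] at h
  refine (h t ⟨ht, by linarith⟩).mono_of_mem_nhdsWithin ?_
  rw [← Ici_inter_Iic]
  exact inter_mem self_mem_nhdsWithin (mem_nhdsWithin_of_mem_nhds (Iic_mem_nhds (by linarith)))

theorem hasDerivAt_arc {t : ℝ} (ht : 0 < t) : HasDerivAt γ.arc ‖deriv γ.toFun t‖ t := by
  have hc : ContinuousAt (fun u => ‖deriv γ.toFun u‖) t :=
    (γ.continuousOn_deriv.continuousAt (Ioi_mem_nhds ht)).norm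
  refine intervalIntegral.integral_hasDerivAt_right
    (γ.intervalIntegrable_deriv le_rfl ht.le).norm ?_ hc
  exact γ.continuousOn_deriv.norm.stronglyMeasurableAtFilter isOpen_Ioi t ht

/-- The tameness hypothesis, with constants normalised to be at least one. -/
theorem exists_arc_le : ∃ (K : ℝ) (A : ℕ), 1 ≤ K ∧ ∀ s t : ℝ, 0 ≤ s → s ≤ t →
    γ.arc t - γ.arc s ≤ K * (1 + ‖γ.toFun t‖) ^ A * ‖γ.toFun t - γ.toFun s‖ := by
  obtain ⟨K, A, h⟩ := γ.tame
  refine ⟨max K 1, A, le_max_right _ _, fun s t hs hst => ?_⟩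
  rw [γ.arc_sub hs (hs.trans hst)]
  refine (h s t hs hst).trans ?_
  gcongr
  exact le_max_left _ _

end LaguerreCurve

/-! ### Rotating a radial arc -/

/-- Put `w = Γ(t) e^{iφ}`. The `φ`-derivative of the integrand is `i` times the `t`-derivative of `w
g(w)`, so differentiation under the integral leaves only end point terms. -/
theorem hasDerivAt_rotate_integral {Γ D : ℝ → ℂ} {g : ℂ → ℂ} {Ω : Set ℂ} {a b φ₀ : ℝ} {J : Set ℝ}
    (hab : a ≤ b) (hΓ : Continuous Γ) (hD : Continuous D)
    (hder : ∀ t ∈ Ioo a b, HasDerivAt Γ (D t) t) (hΩ : IsOpen Ω) (hg : DifferentiableOn ℂ g Ω)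
    (hJ : J ∈ 𝓝 φ₀) (hmem : ∀ φ ∈ J, ∀ t, Γ t * exp (φ * I) ∈ Ω) :
    HasDerivAt (fun φ : ℝ => ∫ t in a..b, g (Γ t * exp (φ * I)) * (D t * exp (φ * I)))
      (I * (Γ b * exp (φ₀ * I) * g (Γ b * exp (φ₀ * I)))
        - I * (Γ a * exp (φ₀ * I) * g (Γ a * exp (φ₀ * I)))) φ₀ := by
  have hg' : ContinuousOn (deriv g) Ω := (hg.analyticOnNhd hΩ).deriv.continuousOn
  obtain ⟨δ, hδ, hball⟩ := Metric.nhds_basis_closedBall.mem_iff.1 hJ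
  rw [Real.closedBall_eq_Icc] at hball
  set S : Set ℝ := Icc (φ₀ - δ) (φ₀ + δ) with hS
  have hSn : S ∈ 𝓝 φ₀ := Icc_mem_nhds (by linarith) (by linarith)
  have hrot : Continuous fun p : ℝ × ℝ => Γ p.2 * exp (p.1 * I) := by fun_prop
  have hmaps : MapsTo (fun p : ℝ × ℝ => Γ p.2 * exp (p.1 * I)) (S ×ˢ univ) Ω :=
    fun p hp => hmem _ (hball hp.1) _
  have hF : ContinuousOn (fun p : ℝ × ℝ => g (Γ p.2 * exp (p.1 * I)) * (D p.2 * exp (p.1 * I)))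
      (S ×ˢ univ) := by
    refine (hg.continuousOn.comp hrot.continuousOn hmaps).mul ?_
    fun_prop
  set F' : ℝ → ℝ → ℂ := fun φ t =>
    deriv g (Γ t * exp (φ * I)) * (Γ t * (exp (φ * I) * I)) * (D t * exp (φ * I)) +
      g (Γ t * exp (φ * I)) * (D t * (exp (φ * I) * I)) with hF'def
  have hF' : ContinuousOn (fun p : ℝ × ℝ => F' p.1 p.2) (S ×ˢ univ) := by
    refine ContinuousOn.add (((hg'.comp hrot.continuousOn hmaps).mul ?_).mul ?_)
      ((hg.continuousOn.comp hrot.continuousOn hmaps).mul ?_)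
    all_goals fun_prop
  have hslice : ∀ (G : ℝ × ℝ → ℂ), ContinuousOn G (S ×ˢ univ) → ∀ φ ∈ S,
      Continuous fun t => G (φ, t) := by
    intro G hG φ hφ
    exact hG.comp_continuous (by fun_prop) fun t => ⟨hφ, mem_univ _⟩
  obtain ⟨C, hC⟩ := (isCompact_Icc.prod (isCompact_Icc (a := a) (b := b))).exists_bound_of_continuousOn
    (hF'.mono (prod_mono (Subset.refl S) (subset_univ (Icc a b))))
  have hexp : ∀ φ : ℝ, HasDerivAt (fun φ : ℝ => exp (φ * I)) (exp (φ * I) * I) φ := by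
    intro φ
    have := ((hasDerivAt_id (φ : ℂ)).mul_const I).cexp.comp_ofReal
    simpa using this
  have hφ₀ : φ₀ ∈ S := mem_of_mem_nhds hSn
  have key := intervalIntegral.hasDerivAt_integral_of_dominated_loc_of_deriv_le (𝕜 := ℝ)
    (F := fun (φ : ℝ) t => g (Γ t * exp (φ * I)) * (D t * exp (φ * I))) (F' := F') (x₀ := φ₀) (a := a)
    (b := b) (μ := MeasureTheory.volume) (bound := fun _ => C) hSn
    (by filter_upwards [hSn] with φ hφ
        exact (hslice _ hF φ hφ).aestronglyMeasurable)
    ((hslice _ hF φ₀ hφ₀).intervalIntegrable _ _)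
    (hslice _ hF' φ₀ hφ₀).aestronglyMeasurable
    (by refine Eventually.of_forall fun t ht φ hφ => ?_
        rw [uIoc_of_le hab] at ht
        exact hC (φ, t) ⟨hφ, Ioc_subset_Icc_self ht⟩)
    intervalIntegrable_const
    (by refine Eventually.of_forall fun t ht φ hφ => ?_
        have h1 : HasDerivAt g (deriv g (Γ t * exp (φ * I))) (Γ t * exp (φ * I)) :=
          (hg.differentiableAt (hΩ.mem_nhds (hmem φ (hball hφ) t))).hasDerivAt
        have h2 := h1.comp φ ((hexp φ).const_mul (Γ t))
        exact h2.mul ((hexp φ).const_mul (D t)))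
  have hval : ∫ t in a..b, F' φ₀ t = I * (Γ b * exp (φ₀ * I) * g (Γ b * exp (φ₀ * I)))
        - I * (Γ a * exp (φ₀ * I) * g (Γ a * exp (φ₀ * I))) := by
    rw [intervalIntegral.integral_eq_sub_of_hasDerivAt_of_le hab
      (f := fun t => I * (Γ t * exp (φ₀ * I) * g (Γ t * exp (φ₀ * I))))]
    · have h1 : Continuous fun t => Γ t * exp (φ₀ * I) := by fun_prop
      have h2 : Continuous fun t => g (Γ t * exp (φ₀ * I)) :=
        hg.continuousOn.comp_continuous h1 fun t => hmem φ₀ (hball hφ₀) t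
      exact (continuous_const.mul (h1.mul h2)).continuousOn
    · intro t ht
      have h1 : HasDerivAt g (deriv g (Γ t * exp (φ₀ * I))) (Γ t * exp (φ₀ * I)) :=
        (hg.differentiableAt (hΩ.mem_nhds (hmem φ₀ (hball hφ₀) t))).hasDerivAt
      have h3 := (hder t ht).mul_const (exp (φ₀ * I))
      have h2 := h1.comp t h3
      refine ((h3.mul h2).const_mul I).congr_deriv ?_
      simp only [hF'def, Function.comp]
      ring
    · exact (hslice _ hF' φ₀ hφ₀).intervalIntegrable _ _
  rw [hval] at key
  exact key.2

/-- By periodicity the circle may be traversed from `w` on. This matches the end point terms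
produced by rotating an arc. -/
theorem circleIntegral_zero_eq_rotate {g : ℂ → ℂ} {w : ℂ} :
    ∮ z in C(0, ‖w‖), g z =
      ∫ φ in (0 : ℝ)..2 * Real.pi, I * (w * exp (φ * I) * g (w * exp (φ * I))) := by
  have hw : ∀ φ : ℝ, circleMap 0 ‖w‖ (φ + arg w) = w * exp (φ * I) := by
    intro φ
    conv_rhs => rw [← norm_mul_exp_arg_mul_I w]
    rw [circleMap, zero_add, mul_assoc, ← exp_add]
    congr 2
    push_cast
    ring
  rw [circleIntegral]
  have hper : Function.Periodic
      (fun θ => deriv (circleMap 0 ‖w‖) θ • g (circleMap 0 ‖w‖ θ)) (2 * Real.pi) := by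
    intro θ
    simp only [deriv_circleMap, periodic_circleMap 0 ‖w‖ θ]
  have h1 := hper.intervalIntegral_add_eq 0 (arg w)
  rw [zero_add] at h1
  rw [h1, add_comm (arg w)]
  have h2 := intervalIntegral.integral_comp_add_right (a := 0) (b := 2 * Real.pi)
    (fun θ => deriv (circleMap 0 ‖w‖) θ • g (circleMap 0 ‖w‖ θ)) (arg w)
  rw [zero_add] at h2
  rw [← h2]
  congr 1
  ext φ
  rw [deriv_circleMap, hw, smul_eq_mul]
  ring

/-! ### Cauchy's formula and Liouville's theorem across the curve -/

namespace LaguerreCurve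

variable (γ : LaguerreCurve)

/-- Let `F φ` be the integral of `g` over the arc between the two radii, rotated by `φ`. For `0 < φ
< 2π` this arc avoids the curve, and `F'` is the difference of the integrands of the two circle
integrals. Continuity of `g` across the curve makes `F` continuous on the closed interval, and `F
(2π) = F 0`. -/
theorem circleIntegral_eq {g : ℂ → ℂ} (hc : ContinuousOn g {0}ᶜ)
    (hd : DifferentiableOn ℂ g γ.supportᶜ) {r R : ℝ} (hr : 0 < r) (hrR : r ≤ R) :
    ∮ z in C(0, R), g z = ∮ z in C(0, r), g z := by
  have hR : 0 < R := hr.trans_le hrR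
  set a := γ.param r
  set b := γ.param R
  have ha : 0 < a := γ.param_pos hr
  have hab : a ≤ b := γ.strictMono_param.monotone hrR
  -- Clamping the parameter to `[a, b]` gives functions continuous on the whole line whose values
  -- stay away from the origin.
  have hclip : Continuous fun t : ℝ => max a (min b t) := by fun_prop
  have hclip0 : ∀ t : ℝ, 0 < max a (min b t) := fun t => ha.trans_le (le_max_left _ _)
  have hclipeq : ∀ t ∈ Icc a b, max a (min b t) = t := fun t ht => by
    rw [min_eq_right ht.2, max_eq_right ht.1]
  set Γ : ℝ → ℂ := fun t => γ.toFun (max a (min b t)) with hΓdef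
  set D : ℝ → ℂ := fun t => deriv γ.toFun (max a (min b t)) with hDdef
  have hΓ : Continuous Γ := γ.continuousOn_toFun.comp_continuous hclip fun t => (hclip0 t).le
  have hD : Continuous D := γ.continuousOn_deriv.comp_continuous hclip hclip0
  have hΓ0 : ∀ t, Γ t ≠ 0 := fun t => γ.toFun_ne_zero (hclip0 t)
  have hder : ∀ t ∈ Ioo a b, HasDerivAt Γ (D t) t := by
    intro t ht
    have h1 : D t = deriv γ.toFun t := by
      rw [hDdef]; simp only [hclipeq t (Ioo_subset_Icc_self ht)]
    rw [h1]
    refine (γ.hasDerivAt (ha.trans ht.1)).congr_of_eventuallyEq ?_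
    filter_upwards [Ioo_mem_nhds ht.1 ht.2] with u hu
    rw [hΓdef]
    simp only [hclipeq u (Ioo_subset_Icc_self hu)]
  set F : ℝ → ℂ := fun φ => ∫ t in a..b, g (Γ t * exp (φ * I)) * (D t * exp (φ * I)) with hFdef
  have hFc : Continuous F := by
    apply intervalIntegral.continuous_parametric_intervalIntegral_of_continuous'
    have h1 : Continuous fun p : ℝ × ℝ => Γ p.2 * exp (p.1 * I) := by fun_prop
    have h2 : Continuous fun p : ℝ × ℝ => g (Γ p.2 * exp (p.1 * I)) :=
      hc.comp_continuous h1 fun p => mul_ne_zero (hΓ0 _) (exp_ne_zero _)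
    have h3 : Continuous fun p : ℝ × ℝ => D p.2 * exp (p.1 * I) := by fun_prop
    exact h2.mul h3
  have hb0 : ∀ w : ℂ, w ≠ 0 →
      Continuous fun φ : ℝ => I * (w * exp (φ * I) * g (w * exp (φ * I))) := by
    intro w hw
    have h1 : Continuous fun φ : ℝ => w * exp (φ * I) := by fun_prop
    exact continuous_const.mul (h1.mul
      (hc.comp_continuous h1 fun φ => mul_ne_zero hw (exp_ne_zero _)))
  have hΓa : Γ a = γ.toFun a := by
    rw [hΓdef]; simp only [hclipeq a (left_mem_Icc.2 hab)]
  have hΓb : Γ b = γ.toFun b := by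
    rw [hΓdef]; simp only [hclipeq b (right_mem_Icc.2 hab)]
  have hFTC := intervalIntegral.integral_eq_sub_of_hasDerivAt_of_le
    (show (0 : ℝ) ≤ 2 * Real.pi by positivity) hFc.continuousOn
    (f' := fun φ : ℝ => I * (Γ b * exp (φ * I) * g (Γ b * exp (φ * I)))
        - I * (Γ a * exp (φ * I) * g (Γ a * exp (φ * I))))
    (fun φ hφ => hasDerivAt_rotate_integral hab hΓ hD hder γ.isOpen_compl_support hd
      (Ioo_mem_nhds hφ.1 hφ.2) fun ψ hψ t => γ.rot_notMem (hclip0 t) hψ.1.ne'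
        (by linarith [hψ.1, Real.pi_pos]) hψ.2)
    (((hb0 _ (hΓ0 b)).sub (hb0 _ (hΓ0 a))).intervalIntegrable _ _)
  have hF2 : F (2 * Real.pi) - F 0 = 0 := by
    have : exp (((2 * Real.pi : ℝ) : ℂ) * I) = exp (((0 : ℝ) : ℂ) * I) := by
      push_cast; rw [exp_two_pi_mul_I]; simp
    simp only [hFdef, this, sub_self]
  rw [hF2, intervalIntegral.integral_sub ((hb0 _ (hΓ0 b)).intervalIntegrable _ _)
    ((hb0 _ (hΓ0 a)).intervalIntegrable _ _), ← circleIntegral_zero_eq_rotate,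
    ← circleIntegral_zero_eq_rotate, hΓa, hΓb, γ.norm_param hr.le, γ.norm_param hR.le,
    sub_eq_zero] at hFTC
  exact hFTC

/-- Cauchy's formula in an annulus for functions which are continuous across the curve. -/
theorem two_pi_I_mul_eq {g : ℂ → ℂ} (hc : ContinuousOn g {0}ᶜ)
    (hd : DifferentiableOn ℂ g γ.supportᶜ) {r R : ℝ} {z : ℂ} (hz : z ∈ γ.supportᶜ) (hr : 0 < r)
    (hrz : r < ‖z‖) (hzR : ‖z‖ < R) :
    2 * Real.pi * I * g z =
      (∮ ζ in C(0, R), (ζ - z)⁻¹ * g ζ) - ∮ ζ in C(0, r), (ζ - z)⁻¹ * g ζ := by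
  have hz0 : z ≠ 0 := γ.ne_zero_of_notMem hz
  -- Cauchy's formula results from equality of circle integrals applied to the difference quotient
  -- of `g` at `z`, which is again continuous across the curve and holomorphic off it.
  have hkc : ContinuousOn (dslope g z) {0}ᶜ :=
    (continuousOn_dslope (isOpen_compl_singleton.mem_nhds hz0)).2
      ⟨hc, hd.differentiableAt (γ.isOpen_compl_support.mem_nhds hz)⟩
  have hkd : DifferentiableOn ℂ (dslope g z) γ.supportᶜ :=
    (Complex.differentiableOn_dslope (γ.isOpen_compl_support.mem_nhds hz)).2 hd
  have hkey := γ.circleIntegral_eq hkc hkd hr (hrz.trans hzR).le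
  have hsplit : ∀ ρ : ℝ, 0 < ρ → ρ ≠ ‖z‖ → (∮ ζ in C(0, ρ), dslope g z ζ) =
      (∮ ζ in C(0, ρ), (ζ - z)⁻¹ * g ζ) - (∮ ζ in C(0, ρ), (ζ - z)⁻¹) * g z := by
    intro ρ hρ hρz
    have hne : ∀ ζ ∈ Metric.sphere (0 : ℂ) ρ, ζ - z ≠ 0 := by
      intro ζ hζ h
      rw [sub_eq_zero] at h
      rw [h, mem_sphere_zero_iff_norm] at hζ
      exact hρz hζ.symm
    have hinv : ContinuousOn (fun ζ : ℂ => (ζ - z)⁻¹) (Metric.sphere 0 ρ) :=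
      ContinuousOn.inv₀ (by fun_prop) hne
    have hgs : ContinuousOn g (Metric.sphere 0 ρ) := hc.mono fun ζ hζ h => by
      rw [mem_singleton_iff.1 h, mem_sphere_zero_iff_norm, norm_zero] at hζ
      exact hρ.ne hζ
    have h1 : (∮ ζ in C(0, ρ), dslope g z ζ) =
        ∮ ζ in C(0, ρ), ((ζ - z)⁻¹ * g ζ - g z * (ζ - z)⁻¹) := by
      refine circleIntegral.integral_congr hρ.le fun ζ hζ => ?_
      have : ζ ≠ z := sub_ne_zero.1 (hne ζ hζ)
      rw [dslope_of_ne _ this, slope_def_field]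
      have := hne ζ hζ
      field_simp
    have h2 : CircleIntegrable (fun ζ => (ζ - z)⁻¹ * g ζ) 0 ρ :=
      (hinv.mul hgs).circleIntegrable hρ.le
    have h3 : CircleIntegrable (fun ζ => g z * (ζ - z)⁻¹) 0 ρ :=
      (continuousOn_const.mul hinv).circleIntegrable hρ.le
    rw [h1, circleIntegral.integral_sub h2 h3, circleIntegral.integral_const_mul, mul_comm (g z)]
  rw [hsplit R (hr.trans (hrz.trans hzR)) hzR.ne', hsplit r hr hrz.ne,
    circleIntegral.integral_sub_inv_of_mem_ball (by simpa using hzR)] at hkey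
  have h0 : (∮ ζ in C(0, r), (ζ - z)⁻¹) = 0 := by
    refine circleIntegral_eq_zero_of_differentiable_on_off_countable hr.le countable_empty ?_ ?_
    · refine ContinuousOn.inv₀ (by fun_prop) fun ζ hζ h => ?_
      rw [sub_eq_zero] at h
      rw [h, mem_closedBall_zero_iff] at hζ
      linarith
    · intro ζ hζ
      refine DifferentiableAt.inv (by fun_prop) fun h => ?_
      rw [sub_eq_zero] at h
      have := hζ.1
      rw [h, mem_ball_zero_iff] at this
      linarith
  rw [h0] at hkey
  linear_combination -hkey

/-- `g` is holomorphic off the curve and has equal boundary values from both sides. -/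
structure NoJump (g : ℂ → ℂ) : Prop where
  differentiableOn : DifferentiableOn ℂ g γ.supportᶜ
  limit : ∀ t : ℝ, 0 < t → ∃ c, Tendsto g (γ.leftNhds t) (𝓝 c) ∧ Tendsto g (γ.rightNhds t) (𝓝 c)

variable {γ}

theorem NoJump.exists_extension {g : ℂ → ℂ} (hg : γ.NoJump g) :
    ∃ G : ℂ → ℂ, ContinuousOn G {0}ᶜ ∧ EqOn G g γ.supportᶜ := by
  classical
  choose! c hl hr using hg.limit
  refine ⟨fun z => if z ∈ γ.support then c (γ.param ‖z‖) else g z, ?_, fun z hz => if_neg hz⟩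
  set G : ℂ → ℂ := fun z => if z ∈ γ.support then c (γ.param ‖z‖) else g z with hG
  have hGg : ∀ z ∈ γ.supportᶜ, G z = g z := fun z hz => if_neg hz
  have hGγ : ∀ t, 0 < t → G (γ.toFun t) = c t := by
    intro t ht
    rw [hG]
    simp only [if_pos (γ.toFun_mem_support ht.le), γ.param_norm ht.le]
  intro z hz
  apply ContinuousAt.continuousWithinAt
  by_cases hzs : z ∈ γ.support
  · obtain ⟨t, ht, rfl⟩ := γ.support_diff_zero ⟨hzs, hz⟩
    rw [ContinuousAt, hGγ t ht]
    -- Closed neighbourhoods are used because the values of `G` at nearby points of the curve are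
    -- only limits of values of `g` lying in `V`.
    refine (closed_nhds_basis (c t)).ge_iff.2 fun V hV => ?_
    obtain ⟨hV, hVc⟩ := hV
    have h1 := hl t ht hV
    have h2 := hr t ht hV
    rw [leftNhds, mem_map, mem_map, mem_prod_iff] at h1
    rw [rightNhds, mem_map, mem_map, mem_prod_iff] at h2
    obtain ⟨U₁, hU₁, T₁, hT₁, hsub₁⟩ := h1
    obtain ⟨U₂, hU₂, T₂, hT₂, hsub₂⟩ := h2
    rw [mem_nhdsGT_iff_exists_Ioo_subset] at hT₁
    rw [mem_nhdsLT_iff_exists_Ioo_subset] at hT₂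
    obtain ⟨δ₁, hδ₁, hT₁⟩ := hT₁
    obtain ⟨δ₂, hδ₂, hT₂⟩ := hT₂
    rw [mem_Ioi] at hδ₁
    rw [mem_Iio] at hδ₂
    have hpi := Real.pi_pos
    -- The interior makes `U₁` a neighbourhood of every nearby parameter `s`, so that the left limit
    -- can be taken at `s` and not only at `t`.
    have hU : interior U₁ ∩ U₂ ∩ Ioi 0 ∈ 𝓝 t :=
      inter_mem (inter_mem (interior_mem_nhds.2 hU₁) hU₂) (Ioi_mem_nhds ht)
    have hT : Ioo (max δ₂ (-(2 * Real.pi))) (min δ₁ (2 * Real.pi)) ∈ 𝓝 (0 : ℝ) :=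
      Ioo_mem_nhds (max_lt hδ₂ (by linarith)) (lt_min hδ₁ (by linarith))
    have := γ.tendsto_chart ht (prod_mem_prod hU hT)
    rw [mem_map] at this ⊢
    filter_upwards [this] with w hw
    rw [← γ.foot_mul_exp w, foot]
    rw [mem_preimage, mem_prod] at hw
    obtain ⟨⟨⟨hw1, hw2⟩, hw0⟩, hw3, hw4⟩ := hw
    simp only at hw1 hw2 hw0 hw3 hw4
    set s := γ.param ‖w‖
    change γ.toFun s * exp ((arg (w / γ.toFun s) : ℝ) * I) ∈ G ⁻¹' V
    change max δ₂ _ < arg (w / γ.toFun s) at hw3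
    change arg (w / γ.toFun s) < min δ₁ _ at hw4
    set φ := arg (w / γ.toFun s)
    rw [mem_preimage]
    rcases lt_trichotomy φ 0 with h | h | h
    · rw [hGg _ (γ.rot_notMem hw0 h.ne ((le_max_right _ _).trans_lt hw3) (by linarith))]
      exact hsub₂ (show (s, φ) ∈ U₂ ×ˢ T₂ from ⟨hw2, hT₂ ⟨(le_max_left _ _).trans_lt hw3, h⟩⟩)
    · rw [h, ofReal_zero, zero_mul, exp_zero, mul_one, hGγ s hw0]
      refine hVc.mem_of_tendsto (hl s hw0) ?_
      rw [leftNhds, eventually_map]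
      filter_upwards [prod_mem_prod (mem_interior_iff_mem_nhds.1 hw1) (Ioo_mem_nhdsGT hδ₁)]
        with p hp
      exact hsub₁ (show p ∈ U₁ ×ˢ T₁ from ⟨hp.1, hT₁ hp.2⟩)
    · rw [hGg _ (γ.rot_notMem hw0 h.ne' (by linarith) (hw4.trans_le (min_le_right _ _)))]
      exact hsub₁ (show (s, φ) ∈ U₁ ×ˢ T₁ from
        ⟨interior_subset hw1, hT₁ ⟨h, hw4.trans_le (min_le_left _ _)⟩⟩)
  · have hn := γ.isOpen_compl_support.mem_nhds hzs
    have : G =ᶠ[𝓝 z] g := by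
      filter_upwards [hn] with w hw using hGg w hw
    exact (hg.differentiableOn.continuousOn.continuousAt hn).congr this.symm

/-- Each point of the curve other than the origin is a limit of points off the curve, so closed
conditions on the graph of `g` pass to the extension. This carries norm estimates over to full
circles. -/
theorem extension_mem_of_isClosed {g G : ℂ → ℂ} (hc : ContinuousOn G {0}ᶜ)
    (hGg : EqOn G g γ.supportᶜ) {S : Set (ℂ × ℂ)} (hS : IsClosed S) {U : Set ℂ} (hU : IsOpen U)
    (h : ∀ z ∈ γ.supportᶜ, z ∈ U → (z, g z) ∈ S) : ∀ z, z ≠ 0 → z ∈ U → (z, G z) ∈ S := by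
  intro z hz hzU
  by_cases hzs : z ∈ γ.support
  · obtain ⟨t, ht, rfl⟩ := γ.support_diff_zero ⟨hzs, hz⟩
    have h1 : Tendsto (fun z => (z, G z)) (γ.leftNhds t) (𝓝 (γ.toFun t, G (γ.toFun t))) :=
      (tendsto_id.prodMk_nhds (hc.continuousAt (isOpen_compl_singleton.mem_nhds hz))).mono_left
        (γ.leftNhds_le ht)
    refine hS.mem_of_tendsto h1 ?_
    filter_upwards [γ.compl_support_mem_leftNhds ht, γ.leftNhds_le ht (hU.mem_nhds hzU)] with w hw hwU
    rw [hGg hw]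
    exact h w hw hwU
  · rw [hGg hzs]
    exact h z hzs hzU

/-- A function without jump and with a removable singularity at the origin satisfies Cauchy's
formula on discs about the origin. -/
theorem NoJump.exists_extension_cauchy {g : ℂ → ℂ} (hg : γ.NoJump g)
    (h0 : Tendsto (fun z => z * g z) γ.atOrigin (𝓝 0)) :
    ∃ G : ℂ → ℂ, ContinuousOn G {0}ᶜ ∧ EqOn G g γ.supportᶜ ∧ ∀ R : ℝ, ∀ z ∈ γ.supportᶜ, ‖z‖ < R →
      2 * Real.pi * I * g z = ∮ ζ in C(0, R), (ζ - z)⁻¹ * G ζ := by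
  obtain ⟨G, hc, hGg⟩ := hg.exists_extension
  refine ⟨G, hc, hGg, fun R z hz hzR => ?_⟩
  have hd : DifferentiableOn ℂ G γ.supportᶜ := hg.differentiableOn.congr hGg
  have hz0 : 0 < ‖z‖ := norm_pos_iff.2 (γ.ne_zero_of_notMem hz)
  rw [← sub_eq_zero, ← norm_le_zero_iff]
  refine le_of_forall_pos_le_add fun ε hε => ?_
  rw [zero_add]
  -- The small circle contributes at most `2πr · (2/‖z‖) · (η/r)`, where `η` bounds `‖ζ G(ζ)‖`; the
  -- radius cancels.
  obtain ⟨η, hη, hηε⟩ : ∃ η : ℝ, 0 < η ∧ 4 * Real.pi / ‖z‖ * η ≤ ε := by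
    refine ⟨ε / (4 * Real.pi / ‖z‖), by positivity, ?_⟩
    rw [mul_div_cancel₀]
    positivity
  have h0' := h0 (Metric.closedBall_mem_nhds 0 hη)
  rw [atOrigin, mem_map, Metric.mem_nhdsWithin_iff] at h0'
  obtain ⟨δ, hδ, hsub⟩ := h0'
  have hbd := extension_mem_of_isClosed (γ := γ) hc hGg (S := {p | ‖p.1 * p.2‖ ≤ η})
    (isClosed_le (by fun_prop) continuous_const) (Metric.isOpen_ball (x := (0 : ℂ)) (ε := δ))
    (fun w hw hwU => by simpa using hsub ⟨hwU, hw⟩)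
  set r := min (δ / 2) (‖z‖ / 2)
  have hr : 0 < r := lt_min (by linarith) (by linarith)
  have hr1 : r ≤ δ / 2 := min_le_left _ _
  have hr2 : r ≤ ‖z‖ / 2 := min_le_right _ _
  have := γ.two_pi_I_mul_eq hc hd hz hr (by linarith) hzR
  rw [← hGg hz, this, sub_sub_cancel_left, norm_neg]
  have hest : ∀ ζ ∈ Metric.sphere (0 : ℂ) r, ‖(ζ - z)⁻¹ * G ζ‖ ≤ 2 / ‖z‖ * (η / r) := by
    intro ζ hζ
    rw [mem_sphere_zero_iff_norm] at hζ
    have hζ0 : ζ ≠ 0 := by rw [← norm_pos_iff, hζ]; exact hr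
    have h1 := hbd ζ hζ0 (by rw [mem_ball_zero_iff, hζ]; linarith)
    simp only [mem_ofPred_eq, norm_mul, hζ] at h1
    have h2 : ‖z‖ / 2 ≤ ‖ζ - z‖ := by
      have := norm_sub_norm_le z ζ
      rw [norm_sub_rev] at this
      linarith
    rw [norm_mul, norm_inv]
    have h3 : ‖G ζ‖ ≤ η / r := by rw [le_div_iff₀ hr]; linarith
    have h4 : ‖ζ - z‖⁻¹ ≤ 2 / ‖z‖ := by
      rw [inv_le_comm₀ (by linarith) (by positivity), inv_div]; exact h2
    gcongr
  refine (circleIntegral.norm_integral_le_of_norm_le_const hr.le hest).trans (le_trans ?_ hηε)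
  apply le_of_eq
  field_simp
  ring

/-- Liouville's theorem for functions without jump. -/
theorem NoJump.eq_of_tendsto {g : ℂ → ℂ} (hg : γ.NoJump g)
    (h0 : Tendsto (fun z => z * g z) γ.atOrigin (𝓝 0)) {c : ℂ}
    (hi : Tendsto g γ.atInfty (𝓝 c)) {z : ℂ} (hz : z ∈ γ.supportᶜ) : g z = c := by
  obtain ⟨G, hc, hGg, hG⟩ := hg.exists_extension_cauchy h0
  have hz0 : 0 < ‖z‖ := norm_pos_iff.2 (γ.ne_zero_of_notMem hz)
  have h2pi : (2 * Real.pi * I : ℂ) ≠ 0 := by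
    simp [Real.pi_ne_zero]
  apply mul_left_cancel₀ h2pi
  rw [← sub_eq_zero, ← norm_le_zero_iff]
  refine le_of_forall_pos_le_add fun ε hε => ?_
  rw [zero_add]
  -- For `R ≥ 2‖z‖` the kernel is at most `2/R`, so replacing `G` by `c` costs at most `2πR · (2/R)
  -- · η`.
  obtain ⟨η, hη, hηε⟩ : ∃ η : ℝ, 0 < η ∧ 4 * Real.pi * η ≤ ε := by
    refine ⟨ε / (4 * Real.pi), by positivity, ?_⟩
    rw [mul_div_cancel₀]
    positivity
  have hi' := hi (Metric.closedBall_mem_nhds c hη)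
  rw [atInfty, mem_map, mem_inf_principal] at hi'
  obtain ⟨M, hM⟩ : ∃ M : ℝ, ∀ w ∈ γ.supportᶜ, M < ‖w‖ → ‖g w - c‖ ≤ η := by
    obtain ⟨M, -, hM⟩ := (Metric.hasBasis_cobounded_compl_closedBall (0 : ℂ)).mem_iff.1 hi'
    refine ⟨M, fun w hw hwM => ?_⟩
    have := hM (show w ∈ (Metric.closedBall 0 M)ᶜ by simpa using hwM) hw
    simpa [dist_eq_norm] using this
  have hbd := extension_mem_of_isClosed (γ := γ) hc hGg (S := {p | ‖p.2 - c‖ ≤ η})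
    (isClosed_le (by fun_prop) continuous_const) (U := {w | M < ‖w‖})
    (isOpen_lt continuous_const continuous_norm) hM
  set R := max (M + 1) (2 * ‖z‖)
  have hR1 : M + 1 ≤ R := le_max_left _ _
  have hR2 : 2 * ‖z‖ ≤ R := le_max_right _ _
  have hzR : ‖z‖ < R := by linarith
  have hR0 : 0 < R := by linarith
  have hne : ∀ ζ ∈ Metric.sphere (0 : ℂ) R, ζ - z ≠ 0 := by
    intro ζ hζ h
    rw [sub_eq_zero] at h
    rw [h, mem_sphere_zero_iff_norm] at hζ
    linarith
  have hinv : ContinuousOn (fun ζ : ℂ => (ζ - z)⁻¹) (Metric.sphere 0 R) :=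
    ContinuousOn.inv₀ (by fun_prop) hne
  have hGs : ContinuousOn G (Metric.sphere 0 R) := hc.mono fun ζ hζ h => by
    rw [mem_singleton_iff.1 h, mem_sphere_zero_iff_norm, norm_zero] at hζ
    exact hR0.ne hζ
  have hcst : (∮ ζ in C(0, R), (ζ - z)⁻¹ * c) = 2 * Real.pi * I * c := by
    have := circleIntegral.integral_smul_const (fun ζ : ℂ => (ζ - z)⁻¹) c 0 R
    simp only [smul_eq_mul] at this
    rw [this, circleIntegral.integral_sub_inv_of_mem_ball (by simpa using hzR)]
  have hi1 : CircleIntegrable (fun ζ => (ζ - z)⁻¹ * G ζ) 0 R :=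
    (hinv.mul hGs).circleIntegrable hR0.le
  have hi2 : CircleIntegrable (fun ζ => (ζ - z)⁻¹ * c) 0 R :=
    (hinv.mul continuousOn_const).circleIntegrable hR0.le
  rw [hG R z hz hzR, ← hcst, ← circleIntegral.integral_sub hi1 hi2]
  have hest : ∀ ζ ∈ Metric.sphere (0 : ℂ) R, ‖(ζ - z)⁻¹ * G ζ - (ζ - z)⁻¹ * c‖ ≤ 2 / R * η := by
    intro ζ hζ
    rw [mem_sphere_zero_iff_norm] at hζ
    have hζ0 : ζ ≠ 0 := by rw [← norm_pos_iff, hζ]; exact hR0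
    have h1 := hbd ζ hζ0 (by rw [mem_ofPred_eq, hζ]; linarith)
    simp only [mem_ofPred_eq] at h1
    have h2 : R / 2 ≤ ‖ζ - z‖ := by
      have := norm_sub_norm_le ζ z
      linarith
    rw [← mul_sub, norm_mul, norm_inv]
    have h4 : ‖ζ - z‖⁻¹ ≤ 2 / R := by
      rw [inv_le_comm₀ (by linarith) (by positivity), inv_div]; exact h2
    gcongr
  refine (circleIntegral.norm_integral_le_of_norm_le_const hR0.le hest).trans (le_trans ?_ hηε)
  apply le_of_eq
  field_simp
  ring

/-- Boundedness at a removable singularity for functions without jump. -/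
theorem NoJump.isBigO_one {g : ℂ → ℂ} (hg : γ.NoJump g)
    (h0 : Tendsto (fun z => z * g z) γ.atOrigin (𝓝 0)) :
    g =O[γ.atOrigin] (fun _ => (1 : ℂ)) := by
  obtain ⟨G, hc, hGg, hG⟩ := hg.exists_extension_cauchy h0
  have hGs : ContinuousOn G (Metric.sphere 0 1) := hc.mono fun ζ hζ h => by
    rw [mem_singleton_iff.1 h, mem_sphere_zero_iff_norm, norm_zero] at hζ
    exact zero_ne_one hζ
  obtain ⟨B, hB⟩ := (isCompact_sphere (0 : ℂ) 1).exists_bound_of_continuousOn hGs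
  refine Asymptotics.IsBigO.of_bound (‖(2 * Real.pi * I : ℂ)‖⁻¹ * (2 * Real.pi * 1 * (2 * B))) ?_
  have hball : Metric.ball (0 : ℂ) (1 / 2) ∩ γ.supportᶜ ∈ γ.atOrigin :=
    inter_mem (mem_nhdsWithin_of_mem_nhds (Metric.ball_mem_nhds 0 (by norm_num)))
      self_mem_nhdsWithin
  filter_upwards [hball] with z hz
  have hz1 : ‖z‖ < 1 / 2 := by simpa using hz.1
  have h2pi : (2 * Real.pi * I : ℂ) ≠ 0 := by simp [Real.pi_ne_zero]
  have h1 := hG 1 z hz.2 (by linarith)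
  have h2 : g z = (2 * Real.pi * I : ℂ)⁻¹ * ∮ ζ in C(0, 1), (ζ - z)⁻¹ * G ζ := by
    rw [← h1, inv_mul_cancel_left₀ h2pi]
  rw [h2, norm_mul, norm_inv, norm_one, mul_one]
  gcongr
  refine circleIntegral.norm_integral_le_of_norm_le_const zero_le_one fun ζ hζ => ?_
  have hB' := hB ζ hζ
  rw [mem_sphere_zero_iff_norm] at hζ
  have h3 : 1 / 2 ≤ ‖ζ - z‖ := by
    have := norm_sub_norm_le ζ z
    linarith
  rw [norm_mul, norm_inv]
  have h4 : ‖ζ - z‖⁻¹ ≤ 2 := by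
    rw [inv_le_comm₀ (by linarith) (by positivity)]; linarith
  have hB0 : 0 ≤ B := (norm_nonneg _).trans hB'
  gcongr

end LaguerreCurve

/-! ### Principal logarithms and holomorphy of Cauchy integrals -/

theorem one_sub_mem_slitPlane {u : ℂ} (hu : ‖u‖ ≤ 1) (h1 : u ≠ 1) : 0 < (1 - u).re := by
  rw [sub_re, one_re, sub_pos]
  refine lt_of_le_of_ne ((re_le_norm u).trans hu) fun h => h1 ?_
  have h2 : ‖u‖ ^ 2 ≤ 1 := by nlinarith [norm_nonneg u]
  rw [← normSq_eq_norm_sq, normSq_apply, h] at h2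
  have h3 : u.im = 0 := by nlinarith
  exact Complex.ext h h3

/-- On the unit circle `1 - u⁻¹` is the conjugate of `1 - u`, so the left side is `2i arg (1 - u)`.
Since `1 - u` lies in the right half-plane, this is within the principal strip, and its exponential
is `-u`. -/
theorem log_one_sub_sub_log_one_sub_inv {u : ℂ} (hu : ‖u‖ = 1) (h1 : u ≠ 1) :
    log (1 - u) - log (1 - u⁻¹) = log (-u) := by
  have h0 : u ≠ 0 := by rw [← norm_pos_iff, hu]; exact one_pos
  have hinv : u⁻¹ = (starRingEnd ℂ) u := inv_eq_conj hu
  have hre := one_sub_mem_slitPlane hu.le h1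
  have hsub : (1 : ℂ) - u ≠ 0 := sub_ne_zero.2 (Ne.symm h1)
  have harg : arg (1 - u) ≠ Real.pi := by
    intro h
    rw [arg_eq_pi_iff] at h
    linarith [h.1]
  have hconj : 1 - u⁻¹ = (starRingEnd ℂ) (1 - u) := by rw [hinv, map_sub, map_one]
  have hsub' : 1 - u⁻¹ ≠ 0 := by
    rw [hconj]; exact (_root_.map_ne_zero _).2 hsub
  have hlog : log (1 - u⁻¹) = (starRingEnd ℂ) (log (1 - u)) := by rw [hconj, log_conj _ harg]
  have harg2 : |arg (1 - u)| < Real.pi / 2 := abs_arg_lt_pi_div_two_iff.2 (Or.inl hre)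
  have him : (log (1 - u) - log (1 - u⁻¹)).im = 2 * arg (1 - u) := by
    rw [hlog, sub_im, conj_im, log_im]; ring
  have hexp : exp (log (1 - u) - log (1 - u⁻¹)) = -u := by
    rw [exp_sub, exp_log hsub, exp_log hsub']
    rw [div_eq_iff hsub']
    field_simp
    ring
  rw [← hexp, log_exp]
  · rw [him]; linarith [(abs_lt.1 harg2).1]
  · rw [him]; linarith [(abs_lt.1 harg2).2]

/-- Together with `log_neg_exp'` this is the source of the jump: the logarithm of `-e^{-iφ}` tends
to `πi` or `-πi` according to the side from which `φ` tends to `0`. -/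
theorem log_neg_exp {φ : ℝ} (h0 : 0 < φ) (h1 : φ < 2 * Real.pi) :
    log (-(exp (φ * I))⁻¹) = (Real.pi - φ) * I := by
  have : -(exp (φ * I))⁻¹ = exp ((Real.pi - φ) * I) := by
    rw [sub_mul, exp_sub, exp_pi_mul_I]; field_simp
  rw [this, log_exp] <;> simp <;> linarith

theorem log_neg_exp' {φ : ℝ} (h0 : φ < 0) (h1 : -(2 * Real.pi) < φ) :
    log (-(exp (φ * I))⁻¹) = (-Real.pi - φ) * I := by
  have : -(exp (φ * I))⁻¹ = exp ((-Real.pi - φ) * I) := by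
    rw [sub_mul, neg_mul, exp_sub, exp_neg, exp_pi_mul_I]; field_simp
  rw [this, log_exp] <;> simp <;> linarith

/-- The parameter set is arbitrary because two cases are needed: the whole curve, for points off it,
and the curve without a short arc, for points of that arc. -/
theorem differentiableAt_cauchy_integral {Γ h : ℝ → ℂ} {S : Set ℝ} (hS : MeasurableSet S)
    (hΓ : MeasureTheory.AEStronglyMeasurable Γ (MeasureTheory.volume.restrict S))
    (hh : MeasureTheory.IntegrableOn h S) {z₀ : ℂ} {d : ℝ} (hd : 0 < d)
    (hdist : ∀ t ∈ S, d ≤ ‖Γ t - z₀‖) :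
    DifferentiableAt ℂ (fun z => ∫ t in S, (Γ t - z)⁻¹ * h t) z₀ := by
  have hlow : ∀ t ∈ S, ∀ z ∈ Metric.ball z₀ (d / 2), d / 2 ≤ ‖Γ t - z‖ := by
    intro t ht z hz
    have h1 := hdist t ht
    rw [mem_ball_iff_norm] at hz
    have h2 := norm_sub_norm_le (Γ t - z₀) (z - z₀)
    rw [sub_sub_sub_cancel_right] at h2
    linarith
  have hmeas : ∀ z : ℂ, MeasureTheory.AEStronglyMeasurable (fun t => (Γ t - z)⁻¹)
      (MeasureTheory.volume.restrict S) := fun z =>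
    (hΓ.sub MeasureTheory.aestronglyMeasurable_const).aemeasurable.inv.aestronglyMeasurable
  have key := hasDerivAt_integral_of_dominated_loc_of_deriv_le
    (μ := MeasureTheory.volume.restrict S) (F := fun z t => (Γ t - z)⁻¹ * h t)
    (F' := fun z t => ((Γ t - z) ^ 2)⁻¹ * h t) (x₀ := z₀) (s := Metric.ball z₀ (d / 2))
    (bound := fun t => ((d / 2) ^ 2)⁻¹ * ‖h t‖) (Metric.ball_mem_nhds z₀ (by positivity))
    (Eventually.of_forall fun z => (hmeas z).mul hh.aestronglyMeasurable)
    (by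
      refine (hh.norm.const_mul (d / 2)⁻¹).mono' ((hmeas z₀).mul hh.aestronglyMeasurable) ?_
      refine (MeasureTheory.ae_restrict_iff' hS).2 (Eventually.of_forall fun t ht => ?_)
      rw [norm_mul, norm_inv]
      gcongr
      exact hlow t ht z₀ (Metric.mem_ball_self (by positivity)))
    (by
      have := ((hΓ.sub (MeasureTheory.aestronglyMeasurable_const (b := z₀))).pow 2)
      exact this.aemeasurable.inv.aestronglyMeasurable.mul hh.aestronglyMeasurable)
    (by
      refine (MeasureTheory.ae_restrict_iff' hS).2 (Eventually.of_forall fun t ht z hz => ?_)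
      rw [norm_mul, norm_inv, norm_pow]
      gcongr
      exact hlow t ht z hz)
    (hh.norm.const_mul _)
    (by
      refine (MeasureTheory.ae_restrict_iff' hS).2 (Eventually.of_forall fun t ht z hz => ?_)
      have hne : Γ t - z ≠ 0 := by
        rw [← norm_pos_iff]
        have := hlow t ht z hz
        linarith
      have h1 := (((hasDerivAt_id z).const_sub (Γ t)).inv hne).mul_const (h t)
      refine h1.congr_deriv ?_
      simp [div_eq_inv_mul])
  exact key.2.differentiableAt

namespace LaguerreCurve

variable (γ : LaguerreCurve)

/-! ### Integrals over short arcs -/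

theorem exists_nearest (z : ℂ) :
    ∃ τ : ℝ, 0 ≤ τ ∧ ∀ t, 0 ≤ t → ‖z - γ.toFun τ‖ ≤ ‖z - γ.toFun t‖ := by
  obtain ⟨w, ⟨τ, hτ, rfl⟩, hw⟩ := γ.isClosed_support.exists_infDist_eq_dist
    ⟨0, γ.zero_mem_support⟩ z
  refine ⟨τ, hτ, fun t ht => ?_⟩
  rw [← dist_eq_norm, ← dist_eq_norm, ← hw]
  exact Metric.infDist_le_dist_of_mem (γ.toFun_mem_support ht)

/-- A parameter of a point of the curve nearest to `z`. -/
noncomputable def nearest (z : ℂ) : ℝ := (γ.exists_nearest z).choose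

theorem nearest_nonneg (z : ℂ) : 0 ≤ γ.nearest z := (γ.exists_nearest z).choose_spec.1

theorem norm_sub_nearest_le (z : ℂ) {t : ℝ} (ht : 0 ≤ t) :
    ‖z - γ.toFun (γ.nearest z)‖ ≤ ‖z - γ.toFun t‖ := (γ.exists_nearest z).choose_spec.2 t ht

/-- This replaces the kernel at `z` by the singularity at the nearest point of the curve, uniformly
in `z`. Hence no restriction on the approach to the curve arises later. -/
theorem norm_sub_nearest_le_two_mul (z : ℂ) {t : ℝ} (ht : 0 ≤ t) :
    ‖γ.toFun t - γ.toFun (γ.nearest z)‖ ≤ 2 * ‖γ.toFun t - z‖ := by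
  have h1 := γ.norm_sub_nearest_le z ht
  have h2 := norm_sub_le_norm_sub_add_norm_sub (γ.toFun t) z (γ.toFun (γ.nearest z))
  rw [norm_sub_rev z (γ.toFun t)] at h1
  linarith

theorem tendsto_nearest {t : ℝ} (ht : 0 < t) : Tendsto γ.nearest (𝓝 (γ.toFun t)) (𝓝 t) := by
  have h1 : Tendsto (fun z => γ.toFun (γ.nearest z)) (𝓝 (γ.toFun t)) (𝓝 (γ.toFun t)) := by
    rw [tendsto_iff_norm_sub_tendsto_zero]
    have h2 : Tendsto (fun z => 2 * ‖γ.toFun t - z‖) (𝓝 (γ.toFun t)) (𝓝 0) := by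
      have : Continuous fun z => 2 * ‖γ.toFun t - z‖ := by fun_prop
      simpa using this.tendsto (γ.toFun t)
    refine squeeze_zero (fun _ => norm_nonneg _) (fun z => ?_) h2
    rw [norm_sub_rev]
    exact γ.norm_sub_nearest_le_two_mul z ht.le
  have h2 := ((γ.continuous_param.comp continuous_norm).tendsto (γ.toFun t)).comp h1
  simp only [Function.comp_def, γ.param_norm ht.le, γ.param_norm (γ.nearest_nonneg _)] at h2
  exact h2

/-- Arc length is the substitution variable. The integrand is a nonnegative derivative of a
continuous function, which already yields integrability at the singular end point. -/
theorem integral_arc_rpow_right {τ b β : ℝ} (hτ : 0 ≤ τ) (hτb : τ ≤ b) (hβ : 0 < β) :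
    IntervalIntegrable (fun t => (γ.arc t - γ.arc τ) ^ (β - 1) * ‖deriv γ.toFun t‖)
      MeasureTheory.volume τ b ∧
    ∫ t in τ..b, (γ.arc t - γ.arc τ) ^ (β - 1) * ‖deriv γ.toFun t‖
      = β⁻¹ * (γ.arc b - γ.arc τ) ^ β := by
  have hc : ContinuousOn (fun t => β⁻¹ * (γ.arc t - γ.arc τ) ^ β) (Icc τ b) := by
    refine continuousOn_const.mul (ContinuousOn.rpow_const ?_ fun _ _ => Or.inr hβ.le)
    exact (γ.continuousOn_arc.mono fun x hx => hτ.trans hx.1).sub continuousOn_const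
  have hd : ∀ t ∈ Ioo τ b, HasDerivAt (fun t => β⁻¹ * (γ.arc t - γ.arc τ) ^ β)
      ((γ.arc t - γ.arc τ) ^ (β - 1) * ‖deriv γ.toFun t‖) t := by
    intro t ht
    have h1 := ((γ.hasDerivAt_arc (hτ.trans_lt ht.1)).sub_const (γ.arc τ)).rpow_const (p := β)
      (Or.inl (sub_pos.2 (γ.arc_lt hτ ht.1)).ne')
    refine (h1.const_mul β⁻¹).congr_deriv ?_
    field_simp
  have hpos : ∀ t ∈ Ioo τ b, 0 ≤ (γ.arc t - γ.arc τ) ^ (β - 1) * ‖deriv γ.toFun t‖ := fun t ht =>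
    mul_nonneg (Real.rpow_nonneg (sub_nonneg.2 (γ.arc_le hτ ht.1.le)) _) (norm_nonneg _)
  have hi : IntervalIntegrable (fun t => (γ.arc t - γ.arc τ) ^ (β - 1) * ‖deriv γ.toFun t‖)
      MeasureTheory.volume τ b := by
    rw [intervalIntegrable_iff_integrableOn_Ioc_of_le hτb]
    exact intervalIntegral.integrableOn_deriv_of_nonneg hc hd hpos
  refine ⟨hi, ?_⟩
  rw [intervalIntegral.integral_eq_sub_of_hasDerivAt_of_le hτb hc hd hi, sub_self,
    Real.zero_rpow hβ.ne']
  ring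

theorem integral_arc_rpow_left {a τ β : ℝ} (ha : 0 ≤ a) (haτ : a ≤ τ) (hβ : 0 < β) :
    IntervalIntegrable (fun t => (γ.arc τ - γ.arc t) ^ (β - 1) * ‖deriv γ.toFun t‖)
      MeasureTheory.volume a τ ∧
    ∫ t in a..τ, (γ.arc τ - γ.arc t) ^ (β - 1) * ‖deriv γ.toFun t‖
      = β⁻¹ * (γ.arc τ - γ.arc a) ^ β := by
  have hc : ContinuousOn (fun t => -(β⁻¹ * (γ.arc τ - γ.arc t) ^ β)) (Icc a τ) := by
    refine (continuousOn_const.mul (ContinuousOn.rpow_const ?_ fun _ _ => Or.inr hβ.le)).neg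
    exact continuousOn_const.sub (γ.continuousOn_arc.mono fun x hx => ha.trans hx.1)
  have hd : ∀ t ∈ Ioo a τ, HasDerivAt (fun t => -(β⁻¹ * (γ.arc τ - γ.arc t) ^ β))
      ((γ.arc τ - γ.arc t) ^ (β - 1) * ‖deriv γ.toFun t‖) t := by
    intro t ht
    have h1 := ((γ.hasDerivAt_arc (ha.trans_lt ht.1)).const_sub (γ.arc τ)).rpow_const (p := β)
      (Or.inl (sub_pos.2 (γ.arc_lt (ha.trans ht.1.le) ht.2)).ne')
    refine (h1.const_mul β⁻¹).neg.congr_deriv ?_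
    field_simp
  have hpos : ∀ t ∈ Ioo a τ, 0 ≤ (γ.arc τ - γ.arc t) ^ (β - 1) * ‖deriv γ.toFun t‖ := fun t ht =>
    mul_nonneg (Real.rpow_nonneg (sub_nonneg.2 (γ.arc_le (ha.trans ht.1.le) ht.2.le)) _)
      (norm_nonneg _)
  have hi : IntervalIntegrable (fun t => (γ.arc τ - γ.arc t) ^ (β - 1) * ‖deriv γ.toFun t‖)
      MeasureTheory.volume a τ := by
    rw [intervalIntegrable_iff_integrableOn_Ioc_of_le haτ]
    exact intervalIntegral.integrableOn_deriv_of_nonneg hc hd hpos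
  refine ⟨hi, ?_⟩
  rw [intervalIntegral.integral_eq_sub_of_hasDerivAt_of_le haτ hc hd hi, sub_self,
    Real.zero_rpow hβ.ne']
  ring

/-- A weakly singular integral over an arc on which the curve is chord-arc with constant `κ`. -/
theorem norm_integral_le_of_le_rpow {a b τ β κ H : ℝ} {F : ℝ → ℂ} (ha : 0 ≤ a) (haτ : a ≤ τ)
    (hτb : τ ≤ b) (hβ : 0 < β) (hβ1 : β ≤ 1) (hκ : 1 ≤ κ) (hH : 0 ≤ H)
    (hchord : ∀ s t, a ≤ s → s ≤ t → t ≤ b →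
      γ.arc t - γ.arc s ≤ κ * ‖γ.toFun t - γ.toFun s‖)
    (hF : IntervalIntegrable F MeasureTheory.volume a b)
    (hbound : ∀ t ∈ Ioc a b, t ≠ τ →
      ‖F t‖ ≤ H * ‖γ.toFun t - γ.toFun τ‖ ^ (β - 1) * ‖deriv γ.toFun t‖) :
    ‖∫ t in a..b, F t‖ ≤ 2 * H * κ / β * ‖γ.toFun b - γ.toFun a‖ ^ β := by
  have hτ : 0 ≤ τ := ha.trans haτ
  have hκ0 : 0 < κ := by linarith
  -- The exponent `β - 1` is nonpositive, so the lower bound on the chord by the arc becomes an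
  -- upper bound. The factor `κ ^ (1 - β)` is completed to `κ` by the `κ ^ β` in `hend`.
  have hrp : ∀ x y : ℝ, 0 < x → x ≤ κ * y → y ^ (β - 1) ≤ κ ^ (1 - β) * x ^ (β - 1) := by
    intro x y hx hxy
    have h1 : (κ * y) ^ (β - 1) ≤ x ^ (β - 1) :=
      Real.rpow_le_rpow_of_nonpos hx hxy (by linarith)
    have hy : 0 ≤ y := by
      by_contra h
      have := mul_neg_of_pos_of_neg hκ0 (not_le.1 h)
      linarith
    rw [Real.mul_rpow hκ0.le hy] at h1
    calc y ^ (β - 1) = κ ^ (1 - β) * (κ ^ (β - 1) * y ^ (β - 1)) := by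
          rw [← mul_assoc, ← Real.rpow_add hκ0]; simp
      _ ≤ _ := by gcongr
  have hend : ∀ x : ℝ, 0 ≤ x → x ≤ κ * ‖γ.toFun b - γ.toFun a‖ →
      H * κ ^ (1 - β) * (β⁻¹ * x ^ β) ≤ H * κ / β * ‖γ.toFun b - γ.toFun a‖ ^ β := by
    intro x hx hxy
    have h1 : x ^ β ≤ κ ^ β * ‖γ.toFun b - γ.toFun a‖ ^ β := by
      rw [← Real.mul_rpow hκ0.le (norm_nonneg _)]
      exact Real.rpow_le_rpow hx hxy hβ.le
    calc H * κ ^ (1 - β) * (β⁻¹ * x ^ β)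
        ≤ H * κ ^ (1 - β) * (β⁻¹ * (κ ^ β * ‖γ.toFun b - γ.toFun a‖ ^ β)) := by gcongr
      _ = H * (κ ^ (1 - β) * κ ^ β) / β * ‖γ.toFun b - γ.toFun a‖ ^ β := by ring
      _ = _ := by rw [← Real.rpow_add hκ0]; simp
  have hab := hchord a b le_rfl (haτ.trans hτb) le_rfl
  have hr := γ.integral_arc_rpow_right hτ hτb hβ
  have hl := γ.integral_arc_rpow_left ha haτ hβ
  have hFl : IntervalIntegrable F MeasureTheory.volume a τ :=
    hF.mono_set (by rw [uIcc_of_le haτ, uIcc_of_le (haτ.trans hτb)]; exact Icc_subset_Icc_right hτb)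
  have hFr : IntervalIntegrable F MeasureTheory.volume τ b :=
    hF.mono_set (by rw [uIcc_of_le hτb, uIcc_of_le (haτ.trans hτb)]; exact Icc_subset_Icc_left haτ)
  have hL : ‖∫ t in a..τ, F t‖ ≤ H * κ / β * ‖γ.toFun b - γ.toFun a‖ ^ β := by
    refine le_trans ?_ (hend (γ.arc τ - γ.arc a) (sub_nonneg.2 (γ.arc_le ha haτ))
      (by linarith [γ.arc_le hτ hτb]))
    rw [← hl.2, ← intervalIntegral.integral_const_mul]
    refine intervalIntegral.norm_integral_le_of_norm_le haτ ?_ (hl.1.const_mul _)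
    have hne : ∀ᵐ t : ℝ, t ≠ τ := by
      simp [MeasureTheory.ae_iff]
    filter_upwards [hne] with t htτ ht
    have ht' : t < τ := lt_of_le_of_ne ht.2 htτ
    refine (hbound t ⟨ht.1, ht.2.trans hτb⟩ htτ).trans ?_
    have := hrp (γ.arc τ - γ.arc t) ‖γ.toFun t - γ.toFun τ‖
      (sub_pos.2 (γ.arc_lt (ha.trans ht.1.le) ht'))
      (by rw [norm_sub_rev]; exact hchord t τ ht.1.le ht.2 hτb)
    calc _ ≤ H * (κ ^ (1 - β) * (γ.arc τ - γ.arc t) ^ (β - 1)) * ‖deriv γ.toFun t‖ := by gcongr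
      _ = _ := by ring
  have hR : ‖∫ t in τ..b, F t‖ ≤ H * κ / β * ‖γ.toFun b - γ.toFun a‖ ^ β := by
    refine le_trans ?_ (hend (γ.arc b - γ.arc τ) (sub_nonneg.2 (γ.arc_le hτ hτb))
      (by linarith [γ.arc_le ha haτ]))
    rw [← hr.2, ← intervalIntegral.integral_const_mul]
    refine intervalIntegral.norm_integral_le_of_norm_le hτb ?_ (hr.1.const_mul _)
    refine Eventually.of_forall fun t ht => ?_
    refine (hbound t ⟨haτ.trans_lt ht.1, ht.2⟩ ht.1.ne').trans ?_
    have := hrp (γ.arc t - γ.arc τ) ‖γ.toFun t - γ.toFun τ‖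
      (sub_pos.2 (γ.arc_lt hτ ht.1)) (hchord τ t haτ ht.1.le ht.2)
    calc _ ≤ H * (κ ^ (1 - β) * (γ.arc t - γ.arc τ) ^ (β - 1)) * ‖deriv γ.toFun t‖ := by gcongr
      _ = _ := by ring
  rw [← intervalIntegral.integral_add_adjacent_intervals hFl hFr]
  refine (norm_add_le _ _).trans ((add_le_add hL hR).trans (le_of_eq ?_))
  ring

theorem sub_ne_zero_of_notMem {z : ℂ} (hz : z ∈ γ.supportᶜ) {t : ℝ} (ht : 0 ≤ t) :
    γ.toFun t - z ≠ 0 := by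
  rw [sub_ne_zero]
  rintro rfl
  exact hz (γ.toFun_mem_support ht)

theorem intervalIntegrable_deriv_div {a b : ℝ} (ha : 0 < a) (hab : a ≤ b) {z : ℂ}
    (hz : ∀ t, 0 < t → γ.toFun t - z ≠ 0) :
    IntervalIntegrable (fun t => (γ.toFun t - z)⁻¹ * deriv γ.toFun t)
      MeasureTheory.volume a b := by
  apply ContinuousOn.intervalIntegrable
  rw [uIcc_of_le hab]
  refine ContinuousOn.mul (ContinuousOn.inv₀ ?_ fun t ht => hz t (ha.trans_le ht.1))
    (γ.continuousOn_deriv.mono fun t ht => ha.trans_le ht.1)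
  exact (γ.continuousOn_toFun.mono fun t ht => ha.le.trans ht.1).sub continuousOn_const

/-- The Cauchy integral of the constant function over an arc, in terms of principal logarithms. -/
theorem integral_deriv_div {a b s : ℝ} (ha : 0 < a) (has : a ≤ s) (hsb : s ≤ b) {z : ℂ}
    (hz : z ∈ γ.supportᶜ) (hzs : ‖z‖ = ‖γ.toFun s‖) :
    ∫ t in a..b, (γ.toFun t - z)⁻¹ * deriv γ.toFun t =
      log (-(γ.toFun s / z)) + log (1 - z / γ.toFun b) - log (1 - γ.toFun a / z)
        + ∫ t in s..b, (γ.toFun t)⁻¹ * deriv γ.toFun t := by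
  have hs : 0 < s := ha.trans_le has
  have hz0 := γ.ne_zero_of_notMem hz
  have hsub : ∀ t, 0 < t → γ.toFun t - z ≠ 0 := fun t ht => γ.sub_ne_zero_of_notMem hz ht.le
  have hi1 := γ.intervalIntegrable_deriv_div ha has hsub
  have hi2 := γ.intervalIntegrable_deriv_div hs hsb hsub
  have hi3 : IntervalIntegrable (fun t => (γ.toFun t)⁻¹ * deriv γ.toFun t)
      MeasureTheory.volume s b := by
    simpa using γ.intervalIntegrable_deriv_div (z := 0) hs hsb
      (fun t ht => by simpa using γ.toFun_ne_zero ht)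
  have hne : ∀ t, 0 < t → γ.toFun t ≠ z := fun t ht => sub_ne_zero.1 (hsub t ht)
  -- The arc is cut at the modulus of `z`. Below it, `log (1 - γ/z)` is a primitive of `γ'/(γ - z)`.
  -- Above it, `log (1 - z/γ)` is a primitive of `γ'/(γ - z) - γ'/γ`. Both arguments stay in the
  -- right half-plane, where the principal branch is smooth.
  have hre1 : ∀ t ∈ Icc a s, 0 < (1 - γ.toFun t / z).re := by
    intro t ht
    have ht0 := ha.trans_le ht.1
    refine one_sub_mem_slitPlane ?_ fun h => hne t ht0 ((div_eq_one_iff_eq hz0).1 h)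
    rw [norm_div, hzs]
    exact div_le_one_of_le₀ (γ.norm_le_norm ht0.le ht.2) (norm_nonneg _)
  have hre2 : ∀ t ∈ Icc s b, 0 < (1 - z / γ.toFun t).re := by
    intro t ht
    have ht0 := hs.trans_le ht.1
    refine one_sub_mem_slitPlane ?_ fun h =>
      hne t ht0 ((div_eq_one_iff_eq (γ.toFun_ne_zero ht0)).1 h).symm
    rw [norm_div, hzs]
    exact div_le_one_of_le₀ (γ.norm_le_norm hs.le ht.1) (norm_nonneg _)
  have hγc : ∀ {c d : ℝ}, 0 < c → ContinuousOn γ.toFun (Icc c d) := fun hc =>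
    γ.continuousOn_toFun.mono fun t ht => hc.le.trans ht.1
  have h1 : ∫ t in a..s, (γ.toFun t - z)⁻¹ * deriv γ.toFun t =
      log (1 - γ.toFun s / z) - log (1 - γ.toFun a / z) := by
    rw [intervalIntegral.integral_eq_sub_of_hasDerivAt_of_le has
      (f := fun t => log (1 - γ.toFun t / z)) _ _ hi1]
    · exact ContinuousOn.clog (continuousOn_const.sub ((hγc ha).div_const z))
        fun t ht => Or.inl (hre1 t ht)
    · intro t ht
      have ht0 := ha.trans ht.1
      have h := (((γ.hasDerivAt ht0).div_const z).const_sub 1).clog_real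
        (Or.inl (hre1 t (Ioo_subset_Icc_self ht)))
      refine h.congr_deriv ?_
      have h1 := hsub t ht0
      have h2 : z - γ.toFun t ≠ 0 := by rw [← neg_sub]; exact neg_ne_zero.2 h1
      rw [one_sub_div hz0, ← neg_sub z (γ.toFun t)]
      field_simp
  have h2 : ∫ t in s..b, ((γ.toFun t - z)⁻¹ * deriv γ.toFun t
      - (γ.toFun t)⁻¹ * deriv γ.toFun t) = log (1 - z / γ.toFun b) - log (1 - z / γ.toFun s) := by
    rw [intervalIntegral.integral_eq_sub_of_hasDerivAt_of_le hsb
      (f := fun t => log (1 - z / γ.toFun t)) _ _ (hi2.sub hi3)]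
    · exact ContinuousOn.clog (continuousOn_const.sub (continuousOn_const.div (hγc hs)
        fun t ht => γ.toFun_ne_zero (hs.trans_le ht.1))) fun t ht => Or.inl (hre2 t ht)
    · intro t ht
      have ht0 := hs.trans ht.1
      have h0 := γ.toFun_ne_zero ht0
      have h := ((((γ.hasDerivAt ht0).inv h0).const_mul z).const_sub 1).clog_real
        (Or.inl (hre2 t (Ioo_subset_Icc_self ht)))
      refine h.congr_deriv ?_
      have h1 := hsub t ht0
      simp only [← div_eq_mul_inv, Pi.inv_apply]
      rw [one_sub_div h0]
      field_simp
      ring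
  rw [intervalIntegral.integral_sub hi2 hi3] at h2
  -- At the cut the two primitives leave logarithms at a unimodular number and its inverse, which
  -- combine into the single term carrying the jump.
  have hu : ‖γ.toFun s / z‖ = 1 := by rw [norm_div, hzs, div_self (γ.norm_pos hs).ne']
  have hu1 : γ.toFun s / z ≠ 1 := fun h => hne s hs ((div_eq_one_iff_eq hz0).1 h)
  have h3 := log_one_sub_sub_log_one_sub_inv hu hu1
  rw [inv_div] at h3
  rw [← intervalIntegral.integral_add_adjacent_intervals hi1 hi2, h1, ← h3]
  linear_combination h2

end LaguerreCurve

/-- A family of approximations with prescribed gap between two filters forces convergence. -/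
theorem exists_tendsto_of_approx {l₁ l₂ : Filter ℂ} [l₁.NeBot] [l₂.NeBot] {F : ℂ → ℂ} {d : ℂ}
    (h : ∀ ε : ℝ, 0 < ε → ∃ c : ℂ, (∀ᶠ z in l₁, ‖F z - (c + d)‖ ≤ ε) ∧
      ∀ᶠ z in l₂, ‖F z - (c - d)‖ ≤ ε) :
    ∃ c : ℂ, Tendsto F l₁ (𝓝 (c + d)) ∧ Tendsto F l₂ (𝓝 (c - d)) := by
  -- Removing the prescribed offsets merges both sides into one Cauchy filter, so a common centre
  -- `c` exists.
  set m : Filter ℂ := map (fun z => F z - d) l₁ ⊔ map (fun z => F z + d) l₂ with hm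
  have hcauchy : Cauchy m := by
    rw [Metric.cauchy_iff]
    refine ⟨by rw [hm]; infer_instance, fun ε hε => ?_⟩
    obtain ⟨c, h1, h2⟩ := h (ε / 3) (by positivity)
    refine ⟨Metric.closedBall c (ε / 3), mem_sup.2 ⟨?_, ?_⟩, fun x hx y hy => ?_⟩
    · rw [mem_map]
      filter_upwards [h1] with z hz
      rw [mem_preimage, mem_closedBall_iff_norm]
      have : F z - d - c = F z - (c + d) := by ring
      rwa [this]
    · rw [mem_map]
      filter_upwards [h2] with z hz
      rw [mem_preimage, mem_closedBall_iff_norm]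
      have : F z + d - c = F z - (c - d) := by ring
      rwa [this]
    · rw [Metric.mem_closedBall] at hx hy
      have := dist_triangle_right x y c
      linarith
  obtain ⟨c, hc⟩ := CompleteSpace.complete hcauchy
  refine ⟨c, ?_, ?_⟩
  · have h1 : Tendsto (fun z => F z - d) l₁ (𝓝 c) := le_sup_left.trans hc
    simpa using h1.add_const d
  · have h1 : Tendsto (fun z => F z + d) l₂ (𝓝 c) := le_sup_right.trans hc
    simpa using h1.sub_const d

/-! ### Cauchy integrals and their boundary values -/

namespace LaguerreCurve

variable (γ : LaguerreCurve)

/-- The Cauchy integral `∫_γ f(w) / (w - z) dw`. -/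
noncomputable def cauchy (f : ℂ → ℂ) (z : ℂ) : ℂ :=
  ∫ t in Ioi (0 : ℝ), (γ.toFun t - z)⁻¹ * (f (γ.toFun t) * deriv γ.toFun t)

/-- The part of the Cauchy integral outside of the arc between the parameters `a` and `b`. -/
noncomputable def cauchyOff (f : ℂ → ℂ) (a b : ℝ) (z : ℂ) : ℂ :=
  ∫ t in Ioi (0 : ℝ) \ Ioc a b, (γ.toFun t - z)⁻¹ * (f (γ.toFun t) * deriv γ.toFun t)

variable {γ}

theorem aestronglyMeasurable_toFun {S : Set ℝ} (hS : S ⊆ Ioi 0) :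
    MeasureTheory.AEStronglyMeasurable γ.toFun (MeasureTheory.volume.restrict S) :=
  ((γ.continuousOn_toFun.mono Ioi_subset_Ici_self).aestronglyMeasurable
    measurableSet_Ioi).mono_set hS

theorem exists_dist_pos {z : ℂ} (hz : z ∈ γ.supportᶜ) :
    ∃ d : ℝ, 0 < d ∧ ∀ t : ℝ, 0 ≤ t → d ≤ ‖γ.toFun t - z‖ := by
  refine ⟨‖γ.toFun (γ.nearest z) - z‖,
    norm_pos_iff.2 (γ.sub_ne_zero_of_notMem hz (γ.nearest_nonneg z)), fun t ht => ?_⟩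
  rw [norm_sub_rev, norm_sub_rev _ z]
  exact γ.norm_sub_nearest_le z ht

variable {f : ℂ → ℂ}

theorem differentiableOn_cauchy
    (hint : MeasureTheory.IntegrableOn (fun t => f (γ.toFun t) * deriv γ.toFun t) (Ioi 0)) :
    DifferentiableOn ℂ (γ.cauchy f) γ.supportᶜ := by
  intro z hz
  obtain ⟨d, hd, hdist⟩ := exists_dist_pos hz
  exact (differentiableAt_cauchy_integral measurableSet_Ioi (aestronglyMeasurable_toFun Subset.rfl)
    hint hd fun t ht => hdist t (le_of_lt ht)).differentiableWithinAt

theorem integrableOn_cauchy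
    (hint : MeasureTheory.IntegrableOn (fun t => f (γ.toFun t) * deriv γ.toFun t) (Ioi 0))
    {z : ℂ} (hz : z ∈ γ.supportᶜ) : MeasureTheory.IntegrableOn
    (fun t => (γ.toFun t - z)⁻¹ * (f (γ.toFun t) * deriv γ.toFun t)) (Ioi 0) := by
  obtain ⟨d, hd, hdist⟩ := exists_dist_pos hz
  have hm : MeasureTheory.AEStronglyMeasurable (fun t => (γ.toFun t - z)⁻¹)
      (MeasureTheory.volume.restrict (Ioi 0)) :=
    ((aestronglyMeasurable_toFun Subset.rfl).sub
      MeasureTheory.aestronglyMeasurable_const).aemeasurable.inv.aestronglyMeasurable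
  refine (hint.norm.const_mul d⁻¹).mono' (hm.mul hint.aestronglyMeasurable) ?_
  refine (MeasureTheory.ae_restrict_iff' measurableSet_Ioi).2 (Eventually.of_forall fun t ht => ?_)
  rw [norm_mul, norm_inv]
  gcongr
  exact hdist t (le_of_lt ht)

theorem cauchy_eq_off_add
    (hint : MeasureTheory.IntegrableOn (fun t => f (γ.toFun t) * deriv γ.toFun t) (Ioi 0))
    {a b : ℝ} (ha : 0 ≤ a) (hab : a ≤ b) {z : ℂ} (hz : z ∈ γ.supportᶜ) :
    γ.cauchy f z = γ.cauchyOff f a b z +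
      ∫ t in a..b, (γ.toFun t - z)⁻¹ * (f (γ.toFun t) * deriv γ.toFun t) := by
  have h := MeasureTheory.integral_inter_add_sdiff (μ := MeasureTheory.volume)
    (measurableSet_Ioc (a := a) (b := b)) (integrableOn_cauchy hint hz)
  have hsub : Ioc a b ⊆ Ioi (0 : ℝ) := fun t ht => ha.trans_lt ht.1
  rw [inter_eq_self_of_subset_right hsub] at h
  rw [cauchy, ← h, cauchyOff, intervalIntegral.integral_of_le hab, add_comm]

/-- Splitting the Cauchy integral over an arc by means of the value at the nearest point. -/
theorem norm_arc_sub_le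
    (hint : MeasureTheory.IntegrableOn (fun t => f (γ.toFun t) * deriv γ.toFun t) (Ioi 0))
    {a b τ β κ H : ℝ} {z : ℂ} (ha : 0 < a) (haτ : a ≤ γ.nearest z)
    (hτb : γ.nearest z ≤ b) (hβ : 0 < β) (hβ1 : β ≤ 1) (hκ : 1 ≤ κ) (hH : 0 ≤ H)
    (hz : z ∈ γ.supportᶜ) (hτ : τ = γ.nearest z)
    (hchord : ∀ s t, a ≤ s → s ≤ t → t ≤ b →
      γ.arc t - γ.arc s ≤ κ * ‖γ.toFun t - γ.toFun s‖)
    (hf : ∀ t ∈ Icc a b, ‖f (γ.toFun t) - f (γ.toFun τ)‖ ≤ H * ‖γ.toFun t - γ.toFun τ‖ ^ β) :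
    ‖(∫ t in a..b, (γ.toFun t - z)⁻¹ * (f (γ.toFun t) * deriv γ.toFun t))
      - f (γ.toFun τ) * ∫ t in a..b, (γ.toFun t - z)⁻¹ * deriv γ.toFun t‖
      ≤ 4 * H * κ / β * ‖γ.toFun b - γ.toFun a‖ ^ β := by
  subst hτ
  set τ := γ.nearest z
  have hab : a ≤ b := haτ.trans hτb
  have hsub : ∀ t, 0 < t → γ.toFun t - z ≠ 0 := fun t ht => γ.sub_ne_zero_of_notMem hz ht.le
  have hi1 : IntervalIntegrable (fun t => (γ.toFun t - z)⁻¹ * (f (γ.toFun t) * deriv γ.toFun t))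
      MeasureTheory.volume a b := by
    rw [intervalIntegrable_iff_integrableOn_Ioc_of_le hab]
    exact (integrableOn_cauchy hint hz).mono_set fun t ht => ha.trans ht.1
  have hi2 := (γ.intervalIntegrable_deriv_div ha hab hsub).const_mul (f (γ.toFun τ))
  rw [← intervalIntegral.integral_const_mul, ← intervalIntegral.integral_sub hi1 hi2]
  -- The doubling of `H` is the loss in replacing `γ(t) - z` by `γ(t) - γ(τ)` in the kernel.
  have := γ.norm_integral_le_of_le_rpow (H := 2 * H) ha.le haτ hτb hβ hβ1 hκ (by positivity) hchord
    (hi1.sub hi2) ?_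
  · refine this.trans (le_of_eq ?_)
    ring
  · intro t ht htτ
    have ht0 : 0 < t := ha.trans ht.1
    have hpos : 0 < ‖γ.toFun t - γ.toFun τ‖ := by
      rw [norm_pos_iff, sub_ne_zero]
      exact fun h => htτ (γ.injOn ht0.le (γ.nearest_nonneg z) h)
    have h1 : ‖(γ.toFun t - z)⁻¹‖ ≤ 2 / ‖γ.toFun t - γ.toFun τ‖ := by
      rw [norm_inv, inv_le_comm₀ (norm_pos_iff.2 (hsub t ht0)) (by positivity), inv_div,
        div_le_iff₀ two_pos, mul_comm]
      exact γ.norm_sub_nearest_le_two_mul z ht0.le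
    have h2 := hf t (Ioc_subset_Icc_self ht)
    have h3 : (γ.toFun t - z)⁻¹ * (f (γ.toFun t) * deriv γ.toFun t) -
        f (γ.toFun τ) * ((γ.toFun t - z)⁻¹ * deriv γ.toFun t) =
        (γ.toFun t - z)⁻¹ * (f (γ.toFun t) - f (γ.toFun τ)) * deriv γ.toFun t := by ring
    rw [h3, norm_mul, norm_mul]
    calc _ ≤ 2 / ‖γ.toFun t - γ.toFun τ‖ * (H * ‖γ.toFun t - γ.toFun τ‖ ^ β)
            * ‖deriv γ.toFun t‖ := by gcongr
      _ = _ := by rw [Real.rpow_sub_one hpos.ne']; ring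

/-- The Sokhotski–Plemelj formula. -/
theorem exists_tendsto_cauchy
    (hint : MeasureTheory.IntegrableOn (fun t => f (γ.toFun t) * deriv γ.toFun t) (Ioi 0))
    {a₀ b₀ t₀ β H : ℝ} (ha₀ : 0 < a₀) (hat : a₀ < t₀) (htb : t₀ < b₀)
    (hβ : 0 < β) (hβ1 : β ≤ 1) (hH : 0 ≤ H)
    (hf : ∀ s ∈ Icc a₀ b₀, ∀ t ∈ Icc a₀ b₀,
      ‖f (γ.toFun s) - f (γ.toFun t)‖ ≤ H * ‖γ.toFun s - γ.toFun t‖ ^ β) :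
    ∃ c : ℂ, Tendsto (γ.cauchy f) (γ.leftNhds t₀) (𝓝 (c + Real.pi * I * f (γ.toFun t₀))) ∧
      Tendsto (γ.cauchy f) (γ.rightNhds t₀) (𝓝 (c - Real.pi * I * f (γ.toFun t₀))) := by
  have ht₀ : 0 < t₀ := ha₀.trans hat
  obtain ⟨K, A, hK, htame⟩ := γ.exists_arc_le
  set κ := K * (1 + ‖γ.toFun b₀‖) ^ A with hκdef
  have hκ : 1 ≤ κ := by
    have : (1 : ℝ) ≤ (1 + ‖γ.toFun b₀‖) ^ A := one_le_pow₀ (by linarith [norm_nonneg (γ.toFun b₀)])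
    nlinarith
  have hchord : ∀ s t, a₀ ≤ s → s ≤ t → t ≤ b₀ →
      γ.arc t - γ.arc s ≤ κ * ‖γ.toFun t - γ.toFun s‖ := by
    intro s t hs hst ht
    refine (htame s t (ha₀.le.trans hs) hst).trans ?_
    have := γ.norm_le_norm ((ha₀.le.trans hs).trans hst) ht
    rw [hκdef]
    gcongr
  have hτ := γ.tendsto_nearest ht₀
  have hcontγ := γ.continuousAt_toFun ht₀
  have hfτ : Tendsto (fun z => f (γ.toFun (γ.nearest z))) (𝓝 (γ.toFun t₀))
      (𝓝 (f (γ.toFun t₀))) := by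
    rw [tendsto_iff_norm_sub_tendsto_zero]
    have h1 : Tendsto (fun t => H * ‖γ.toFun t - γ.toFun t₀‖ ^ β) (𝓝 t₀) (𝓝 0) := by
      have : ContinuousAt (fun t => H * ‖γ.toFun t - γ.toFun t₀‖ ^ β) t₀ :=
        continuousAt_const.mul ((hcontγ.sub continuousAt_const).norm.rpow_const (Or.inr hβ.le))
      simpa [ContinuousAt, hβ.ne'] using this
    refine squeeze_zero' (Eventually.of_forall fun _ => norm_nonneg _) ?_ (h1.comp hτ)
    filter_upwards [hτ (Icc_mem_nhds hat htb)] with z hz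
    exact hf _ hz t₀ ⟨hat.le, htb.le⟩
  apply exists_tendsto_of_approx
  intro ε hε
  -- choice of a short arc
  obtain ⟨δ, hδ, hδa, hδb, hδε⟩ : ∃ δ : ℝ, 0 < δ ∧ a₀ ≤ t₀ - δ ∧ t₀ + δ ≤ b₀ ∧
      4 * H * κ / β * ‖γ.toFun (t₀ + δ) - γ.toFun (t₀ - δ)‖ ^ β ≤ ε / 2 := by
    have h1 : ContinuousAt (fun δ => 4 * H * κ / β *
        ‖γ.toFun (t₀ + δ) - γ.toFun (t₀ - δ)‖ ^ β) 0 := by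
      have hp : ContinuousAt (fun δ : ℝ => γ.toFun (t₀ + δ)) 0 :=
        ContinuousAt.comp (g := γ.toFun) (by simpa using hcontγ) (by fun_prop)
      have hm : ContinuousAt (fun δ : ℝ => γ.toFun (t₀ - δ)) 0 :=
        ContinuousAt.comp (g := γ.toFun) (by simpa using hcontγ) (by fun_prop)
      exact continuousAt_const.mul ((hp.sub hm).norm.rpow_const (Or.inr hβ.le))
    have h2 : Tendsto _ (𝓝[>] (0 : ℝ)) _ := h1.tendsto.mono_left nhdsWithin_le_nhds
    have h3 : 4 * H * κ / β * ‖γ.toFun (t₀ + 0) - γ.toFun (t₀ - 0)‖ ^ β < ε / 2 := by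
      simp only [add_zero, sub_zero, sub_self, norm_zero, Real.zero_rpow hβ.ne', mul_zero]
      positivity
    have h4 := h2.eventually (gt_mem_nhds h3)
    have h5 : ∀ᶠ δ in 𝓝[>] (0 : ℝ), δ ∈ Ioo 0 (min (t₀ - a₀) (b₀ - t₀)) :=
      Ioo_mem_nhdsGT (lt_min (by linarith) (by linarith))
    obtain ⟨δ, hδ1, hδ2⟩ := (h4.and h5).exists
    have := hδ2.2.trans_le (min_le_left _ _)
    have := hδ2.2.trans_le (min_le_right _ _)
    exact ⟨δ, hδ2.1, by linarith, by linarith, hδ1.le⟩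
  set a := t₀ - δ
  set b := t₀ + δ
  have hat' : a < t₀ := by simp only [a]; linarith
  have htb' : t₀ < b := by simp only [b]; linarith
  have ha : 0 < a := ha₀.trans_le hδa
  have hb : 0 < b := ht₀.trans htb'
  have hab : a ≤ b := (hat'.trans htb').le
  have hw0 := γ.toFun_ne_zero ht₀
  -- the continuous part
  have hoff : ContinuousAt (γ.cauchyOff f a b) (γ.toFun t₀) := by
    have hna := γ.strictMonoOn_norm (mem_Ici.2 ha.le) (mem_Ici.2 ht₀.le) hat'
    have hnb := γ.strictMonoOn_norm (mem_Ici.2 ht₀.le) (mem_Ici.2 hb.le) htb'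
    simp only at hna hnb
    refine (differentiableAt_cauchy_integral (measurableSet_Ioi.diff measurableSet_Ioc)
      (aestronglyMeasurable_toFun sdiff_subset) (hint.mono_set sdiff_subset)
      (d := min (‖γ.toFun t₀‖ - ‖γ.toFun a‖) (‖γ.toFun b‖ - ‖γ.toFun t₀‖))
      (lt_min (sub_pos.2 hna) (sub_pos.2 hnb)) ?_).continuousAt
    rintro t ⟨ht0, htn⟩
    rw [mem_Ioi] at ht0
    rcases le_or_gt t a with h | h
    · have h1 := γ.norm_le_norm ht0.le h
      have h2 := norm_sub_norm_le (γ.toFun t₀) (γ.toFun t)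
      rw [norm_sub_rev] at h2
      exact (min_le_left _ _).trans (by linarith)
    · have hbt : b ≤ t := by
        by_contra hc
        exact htn ⟨h, (not_le.1 hc).le⟩
      have h1 := γ.norm_le_norm hb.le hbt
      have h2 := norm_sub_norm_le (γ.toFun t) (γ.toFun t₀)
      exact (min_le_right _ _).trans (by linarith)
  -- `E` collects the terms of `integral_deriv_div` that are continuous across the curve. Only `log
  -- (-(γ.foot z / z))` sees the side.
  set E : ℂ → ℂ := fun z => log (1 - z / γ.toFun b) - log (1 - γ.toFun a / z)
        + ∫ t in γ.param ‖z‖..b, (γ.toFun t)⁻¹ * deriv γ.toFun t with hE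
  have hEc : ContinuousAt E (γ.toFun t₀) := by
    refine ContinuousAt.add (ContinuousAt.sub ?_ ?_) ?_
    · refine ContinuousAt.clog (by fun_prop) (Or.inl (one_sub_mem_slitPlane ?_ ?_))
      · rw [norm_div]
        exact div_le_one_of_le₀ (γ.norm_le_norm ht₀.le htb'.le) (norm_nonneg _)
      · rw [Ne, div_eq_one_iff_eq (γ.toFun_ne_zero hb)]
        exact fun h => htb'.ne (γ.injOn ht₀.le hb.le h)
    · refine ContinuousAt.clog (continuousAt_const.sub (continuousAt_const.div continuousAt_id hw0))
        (Or.inl (one_sub_mem_slitPlane ?_ ?_))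
      · rw [norm_div]
        exact div_le_one_of_le₀ (γ.norm_le_norm ha.le hat'.le) (norm_nonneg _)
      · rw [Ne, div_eq_one_iff_eq hw0]
        exact fun h => hat'.ne (γ.injOn ha.le ht₀.le h)
    · have hi : IntervalIntegrable (fun t => (γ.toFun t)⁻¹ * deriv γ.toFun t)
          MeasureTheory.volume a b := by
        simpa using γ.intervalIntegrable_deriv_div (z := 0) ha hab
          (fun t ht => by simpa using γ.toFun_ne_zero ht)
      have hcp := (intervalIntegral.continuousOn_primitive_interval' hi.symm left_mem_uIcc).neg
      rw [uIcc_of_ge hab] at hcp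
      have hcp' := hcp.continuousAt (Icc_mem_nhds hat' htb')
      have hpar : ContinuousAt (fun z : ℂ => γ.param ‖z‖) (γ.toFun t₀) :=
        (γ.continuous_param.comp continuous_norm).continuousAt
      have heq : γ.param ‖γ.toFun t₀‖ = t₀ := γ.param_norm ht₀.le
      rw [← heq] at hcp'
      have := ContinuousAt.comp (f := fun z : ℂ => γ.param ‖z‖) hcp' hpar
      refine this.congr (Eventually.of_forall fun z => ?_)
      simp only [Function.comp, Pi.neg_apply]
      rw [intervalIntegral.integral_symm, neg_neg]
  -- approximate formula
  have happrox : ∀ᶠ z in 𝓝 (γ.toFun t₀), z ∈ γ.supportᶜ →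
      ‖γ.cauchy f z - (γ.cauchyOff f a b z + f (γ.toFun (γ.nearest z)) *
        (log (-(γ.foot z / z)) + E z))‖ ≤ ε / 2 := by
    have hpar : Tendsto (fun z : ℂ => γ.param ‖z‖) (𝓝 (γ.toFun t₀)) (𝓝 t₀) := by
      have := (γ.continuous_param.comp continuous_norm).tendsto (γ.toFun t₀)
      simpa [Function.comp_def, γ.param_norm ht₀.le] using this
    filter_upwards [hτ (Icc_mem_nhds hat' htb'), hpar (Icc_mem_nhds hat' htb')] with z h1 h2 hz
    have hJ := γ.integral_deriv_div ha h2.1 h2.2 hz (γ.norm_param (norm_nonneg z)).symm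
    have h3 := norm_arc_sub_le hint ha h1.1 h1.2 hβ hβ1 hκ hH hz rfl
      (fun s t hs hst ht => hchord s t (hδa.trans hs) hst (ht.trans hδb))
      (fun t ht => hf t ⟨hδa.trans ht.1, ht.2.trans hδb⟩ _
        ⟨hδa.trans h1.1, h1.2.trans hδb⟩)
    rw [cauchy_eq_off_add hint ha.le hab hz]
    refine le_trans (le_of_eq ?_) (h3.trans hδε)
    rw [hJ, hE, foot]
    congr 1
    ring
  -- One argument serves both sides, with `d` the one-sided limit of that logarithm. Half of `ε`
  -- pays for the short arc, half for the convergence of the remaining terms.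
  have hside : ∀ (l : Filter ℂ) (d : ℂ), l ≤ 𝓝 (γ.toFun t₀) → γ.supportᶜ ∈ l →
      Tendsto (fun z => log (-(γ.foot z / z))) l (𝓝 d) →
      ∀ᶠ z in l, ‖γ.cauchy f z - (γ.cauchyOff f a b (γ.toFun t₀) +
        f (γ.toFun t₀) * E (γ.toFun t₀) + d * f (γ.toFun t₀))‖ ≤ ε := by
    intro l d hl hsupp hlog
    have h1 : Tendsto (fun z => γ.cauchyOff f a b z + f (γ.toFun (γ.nearest z)) *
        (log (-(γ.foot z / z)) + E z)) l (𝓝 (γ.cauchyOff f a b (γ.toFun t₀) +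
        f (γ.toFun t₀) * (d + E (γ.toFun t₀)))) :=
      (hoff.tendsto.mono_left hl).add ((hfτ.mono_left hl).mul (hlog.add (hEc.tendsto.mono_left hl)))
    have h2 := h1 (Metric.closedBall_mem_nhds _ (half_pos hε))
    filter_upwards [h2, hl happrox, hsupp] with z hz1 hz2 hz3
    rw [mem_preimage, mem_closedBall_iff_norm] at hz1
    have hz2' := hz2 hz3
    refine le_trans (le_of_eq ?_) ((norm_add_le _ _).trans
      ((add_le_add hz2' hz1).trans (add_halves ε).le))
    congr 1
    ring
  refine ⟨γ.cauchyOff f a b (γ.toFun t₀) + f (γ.toFun t₀) * E (γ.toFun t₀), ?_, ?_⟩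
  · refine hside _ (Real.pi * I) (γ.leftNhds_le ht₀) (γ.compl_support_mem_leftNhds ht₀) ?_
    rw [leftNhds, tendsto_map'_iff]
    have h1 : Tendsto (fun p : ℝ × ℝ => ((Real.pi : ℂ) - p.2) * I) (𝓝 t₀ ×ˢ 𝓝[>] 0)
        (𝓝 (Real.pi * I)) := by
      have : Tendsto (fun x : ℝ => ((Real.pi : ℂ) - x) * I) (𝓝[>] 0) (𝓝 (Real.pi * I)) := by
        have hc : Continuous fun x : ℝ => ((Real.pi : ℂ) - x) * I := by fun_prop
        have := hc.tendsto 0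
        simp only [ofReal_zero, sub_zero] at this
        exact this.mono_left nhdsWithin_le_nhds
      exact this.comp tendsto_snd
    refine h1.congr' ?_
    filter_upwards [prod_mem_prod (Ioi_mem_nhds ht₀)
      (Ioo_mem_nhdsGT (show (0 : ℝ) < 2 * Real.pi by positivity))] with p hp
    have hp1 : 0 < p.1 := hp.1
    simp only [Function.comp]
    rw [foot, norm_rot, γ.param_norm hp1.le, div_mul_cancel_left₀ (γ.toFun_ne_zero hp1),
      log_neg_exp hp.2.1 hp.2.2]
  · have hrw : γ.cauchyOff f a b (γ.toFun t₀) + f (γ.toFun t₀) * E (γ.toFun t₀)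
        - Real.pi * I * f (γ.toFun t₀) = γ.cauchyOff f a b (γ.toFun t₀)
        + f (γ.toFun t₀) * E (γ.toFun t₀) + (-Real.pi * I) * f (γ.toFun t₀) := by ring
    rw [hrw]
    refine hside _ (-Real.pi * I) (γ.rightNhds_le ht₀) (γ.compl_support_mem_rightNhds ht₀) ?_
    rw [rightNhds, tendsto_map'_iff]
    have h1 : Tendsto (fun p : ℝ × ℝ => (-(Real.pi : ℂ) - p.2) * I) (𝓝 t₀ ×ˢ 𝓝[<] 0)
        (𝓝 (-Real.pi * I)) := by
      have : Tendsto (fun x : ℝ => (-(Real.pi : ℂ) - x) * I) (𝓝[<] 0) (𝓝 (-Real.pi * I)) := by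
        have hc : Continuous fun x : ℝ => (-(Real.pi : ℂ) - x) * I := by fun_prop
        have := hc.tendsto 0
        simp only [ofReal_zero, sub_zero] at this
        exact this.mono_left nhdsWithin_le_nhds
      exact this.comp tendsto_snd
    refine h1.congr' ?_
    filter_upwards [prod_mem_prod (Ioi_mem_nhds ht₀)
      (Ioo_mem_nhdsLT (show -(2 * Real.pi) < 0 by linarith [Real.pi_pos]))] with p hp
    have hp1 : 0 < p.1 := hp.1
    simp only [Function.comp]
    rw [foot, norm_rot, γ.param_norm hp1.le, div_mul_cancel_left₀ (γ.toFun_ne_zero hp1),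
      log_neg_exp' hp.2.2 hp.2.1]

end LaguerreCurve

/-! ### Cauchy integrals near the origin and near infinity -/

theorem rpow_le_of_mem_annulus {c r x : ℝ} (hc : 0 < c) (hr : 0 < r) (h1 : r / c ≤ x)
    (h2 : x ≤ c * r) (e : ℝ) : x ^ e ≤ c ^ |e| * r ^ e := by
  have hx : 0 < x := (div_pos hr hc).trans_le h1
  have h : (x / r) ^ e ≤ c ^ |e| := by
    rcases le_or_gt 0 e with he | he
    · rw [abs_of_nonneg he]
      exact Real.rpow_le_rpow (by positivity) ((div_le_iff₀ hr).2 h2) he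
    · rw [abs_of_neg he, Real.rpow_neg hc.le, ← Real.inv_rpow hc.le]
      refine Real.rpow_le_rpow_of_nonpos (by positivity) ?_ he.le
      rwa [le_div_iff₀ hr, inv_mul_eq_div]
  calc x ^ e = (x / r) ^ e * r ^ e := by
        rw [← Real.mul_rpow (by positivity) hr.le, div_mul_cancel₀ _ hr.ne']
    _ ≤ _ := by gcongr

namespace LaguerreCurve

/-- Densities on the curve which are integrable, rapidly decreasing at infinity, of order larger
than `-1` at the origin, and correspondingly Hölder continuous. -/
structure GoodDensity (γ : LaguerreCurve) (f : ℂ → ℂ) : Prop where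
  integrable : MeasureTheory.IntegrableOn (fun t => f (γ.toFun t) * deriv γ.toFun t) (Ioi 0)
  bound : ∃ β ε : ℝ, 0 < β ∧ β ≤ 1 ∧ 0 < ε ∧ ∀ n : ℕ, ∃ C : ℝ, 0 ≤ C ∧ ∀ s t : ℝ, 0 < s → 0 < t →
    ‖γ.toFun s‖ ≤ 4 * ‖γ.toFun t‖ → ‖γ.toFun t‖ ≤ 4 * ‖γ.toFun s‖ →
    ‖f (γ.toFun t)‖ ≤ C * ‖γ.toFun t‖ ^ (ε - 1) * ((1 + ‖γ.toFun t‖) ^ n)⁻¹ ∧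
    ‖f (γ.toFun s) - f (γ.toFun t)‖ ≤ C * ‖γ.toFun t‖ ^ (ε - 1) * ((1 + ‖γ.toFun t‖) ^ n)⁻¹ *
      (‖γ.toFun s - γ.toFun t‖ / ‖γ.toFun t‖) ^ β

variable {γ : LaguerreCurve} {f : ℂ → ℂ}

theorem norm_mem_of_mem_Icc {r R t : ℝ} (hr : 0 ≤ r) (hR : 0 ≤ R)
    (ht : t ∈ Icc (γ.param r) (γ.param R)) : r ≤ ‖γ.toFun t‖ ∧ ‖γ.toFun t‖ ≤ R := by
  have h0 := γ.param_nonneg hr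
  constructor
  · have := γ.norm_le_norm h0 ht.1
    rwa [γ.norm_param hr] at this
  · have := γ.norm_le_norm (h0.trans ht.1) ht.2
    rwa [γ.norm_param hR] at this

theorem mem_Icc_of_norm_mem {r R t : ℝ} (ht : 0 ≤ t)
    (h1 : r ≤ ‖γ.toFun t‖) (h2 : ‖γ.toFun t‖ ≤ R) : t ∈ Icc (γ.param r) (γ.param R) := by
  rw [← γ.param_norm ht]
  exact ⟨γ.strictMono_param.monotone h1, γ.strictMono_param.monotone h2⟩

/-- Any two moduli in `[r/2, 2r]` differ by a factor of at most `4`, the range admitted in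
`GoodDensity`. There the relative Hölder estimate is an ordinary one, and Plemelj's formula applies.
-/
theorem GoodDensity.exists_tendsto (hf : γ.GoodDensity f) {t₀ : ℝ} (ht₀ : 0 < t₀) :
    ∃ c : ℂ, Tendsto (γ.cauchy f) (γ.leftNhds t₀) (𝓝 (c + Real.pi * I * f (γ.toFun t₀))) ∧
      Tendsto (γ.cauchy f) (γ.rightNhds t₀) (𝓝 (c - Real.pi * I * f (γ.toFun t₀))) := by
  obtain ⟨β, ε, hβ, hβ1, hε, hb⟩ := hf.bound
  obtain ⟨C, hC, hb⟩ := hb 0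
  set r := ‖γ.toFun t₀‖
  have hr : 0 < r := γ.norm_pos ht₀
  have hpar : γ.param r = t₀ := γ.param_norm ht₀.le
  refine exists_tendsto_cauchy hf.integrable (a₀ := γ.param (r / 2)) (b₀ := γ.param (2 * r))
    (β := β) (H := C * (2 ^ |ε - 1| * r ^ (ε - 1)) * (2 ^ |-β| * r ^ (-β)))
    (γ.param_pos (by positivity)) ?_ ?_ hβ hβ1 (by positivity) ?_
  · conv_rhs => rw [← hpar]
    exact γ.strictMono_param (by linarith)
  · conv_lhs => rw [← hpar]
    exact γ.strictMono_param (by linarith)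
  · intro s hs t ht
    have hs' := norm_mem_of_mem_Icc (by positivity) (by positivity) hs
    have ht' := norm_mem_of_mem_Icc (by positivity) (by positivity) ht
    have hs0 : 0 < s := (γ.param_pos (by positivity)).trans_le hs.1
    have ht0 : 0 < t := (γ.param_pos (by positivity)).trans_le ht.1
    have h := (hb s t hs0 ht0 (by linarith) (by linarith)).2
    have hx : 0 < ‖γ.toFun t‖ := γ.norm_pos ht0
    rw [pow_zero, inv_one, mul_one, Real.div_rpow (norm_nonneg _) hx.le, div_eq_mul_inv,
      ← Real.rpow_neg hx.le] at h
    calc _ ≤ _ := h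
      _ ≤ C * (2 ^ |ε - 1| * r ^ (ε - 1)) *
          (‖γ.toFun s - γ.toFun t‖ ^ β * (2 ^ |-β| * r ^ (-β))) := by
        gcongr
        · exact rpow_le_of_mem_annulus two_pos hr ht'.1 ht'.2 _
        · exact rpow_le_of_mem_annulus two_pos hr ht'.1 ht'.2 _
      _ = _ := by ring

/-- In the logarithmic formula the unimodular logarithm is bounded by `π`, the two end point
logarithms by `1`, and the last integral by arc length over `r`. None of these depends on the
distance of `z` from the curve. -/
theorem norm_integral_deriv_div_le {r κ : ℝ} {z : ℂ} (hz : z ∈ γ.supportᶜ) (hr : ‖z‖ = r)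
    (hκ : 1 ≤ κ) (harc : γ.arc (γ.param (2 * r)) - γ.arc (γ.param (r / 2)) ≤ 4 * κ * r) :
    ‖∫ t in γ.param (r / 2)..γ.param (2 * r), (γ.toFun t - z)⁻¹ * deriv γ.toFun t‖ ≤ 10 * κ := by
  have hz0 := γ.ne_zero_of_notMem hz
  have hr0 : 0 < r := by rw [← hr]; exact norm_pos_iff.2 hz0
  have ha : 0 < γ.param (r / 2) := γ.param_pos (by positivity)
  have hs : 0 < γ.param r := γ.param_pos hr0
  have hb : 0 < γ.param (2 * r) := γ.param_pos (by positivity)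
  have has : γ.param (r / 2) ≤ γ.param r := γ.strictMono_param.monotone (by linarith)
  have hsb : γ.param r ≤ γ.param (2 * r) := γ.strictMono_param.monotone (by linarith)
  have hns : ‖γ.toFun (γ.param r)‖ = r := γ.norm_param hr0.le
  have hna : ‖γ.toFun (γ.param (r / 2))‖ = r / 2 := γ.norm_param (by positivity)
  have hnb : ‖γ.toFun (γ.param (2 * r))‖ = 2 * r := γ.norm_param (by positivity)
  rw [γ.integral_deriv_div ha has hsb hz (hr.trans hns.symm)]
  have h1 : ‖log (-(γ.toFun (γ.param r) / z))‖ ≤ 4 := by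
    have hn : ‖-(γ.toFun (γ.param r) / z)‖ = 1 := by
      rw [norm_neg, norm_div, hns, hr, div_self hr0.ne']
    have : log (-(γ.toFun (γ.param r) / z)) = arg (-(γ.toFun (γ.param r) / z)) * I := by
      rw [Complex.log, hn]; simp
    rw [this, norm_mul, norm_I, mul_one, norm_real, Real.norm_eq_abs]
    exact (abs_arg_le_pi _).trans Real.pi_le_four
  have hlog : ∀ u : ℂ, ‖u‖ ≤ 1 / 2 → ‖log (1 - u)‖ ≤ 1 := by
    intro u hu
    have := norm_log_one_add_half_le_self (z := -u) (by rwa [norm_neg])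
    rw [← sub_eq_add_neg, norm_neg] at this
    linarith
  have h2 : ‖log (1 - z / γ.toFun (γ.param (2 * r)))‖ ≤ 1 := by
    apply hlog
    rw [norm_div, hnb, hr, div_le_iff₀ (by positivity)]
    linarith
  have h3 : ‖log (1 - γ.toFun (γ.param (r / 2)) / z)‖ ≤ 1 := by
    apply hlog
    rw [norm_div, hna, hr, div_le_iff₀ (by positivity)]
    linarith
  have h4 : ‖∫ t in γ.param r..γ.param (2 * r), (γ.toFun t)⁻¹ * deriv γ.toFun t‖ ≤ 4 * κ := by
    have h5 : ‖∫ t in γ.param r..γ.param (2 * r), (γ.toFun t)⁻¹ * deriv γ.toFun t‖ ≤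
        ∫ t in γ.param r..γ.param (2 * r), r⁻¹ * ‖deriv γ.toFun t‖ := by
      refine intervalIntegral.norm_integral_le_of_norm_le hsb (Eventually.of_forall fun t ht => ?_)
        ((γ.intervalIntegrable_deriv hs.le hb.le).norm.const_mul _)
      rw [norm_mul, norm_inv]
      gcongr
      exact (norm_mem_of_mem_Icc hr0.le (by positivity) (Ioc_subset_Icc_self ht)).1
    refine h5.trans ?_
    rw [intervalIntegral.integral_const_mul, ← γ.arc_sub hs.le hb.le, inv_mul_le_iff₀ hr0]
    have := γ.arc_le ha.le has
    linarith
  calc _ ≤ 4 + 1 + 1 + 4 * κ :=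
        (norm_add_le _ _).trans (add_le_add ((norm_sub_le _ _).trans
          (add_le_add ((norm_add_le _ _).trans (add_le_add h1 h2)) h3)) h4)
    _ ≤ _ := by linarith

/-- This is the singular part of the Cauchy integral, over the arc of moduli comparable to that of
`z`. The bound is uniform up to the curve: far from it the kernel is at most `4/r`, near it the
value of `f` at the nearest point is split off. -/
theorem GoodDensity.exists_norm_arc_le (hf : γ.GoodDensity f) : ∃ ε : ℝ, 0 < ε ∧ ∀ m : ℕ, ∃ C : ℝ,
    0 ≤ C ∧ ∀ z ∈ γ.supportᶜ, ‖∫ t in γ.param (‖z‖ / 2)..γ.param (2 * ‖z‖),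
      (γ.toFun t - z)⁻¹ * (f (γ.toFun t) * deriv γ.toFun t)‖ ≤
      C * ‖z‖ ^ (ε - 1) * ((1 + ‖z‖) ^ m)⁻¹ := by
  obtain ⟨β, ε, hβ, hβ1, hε, hb⟩ := hf.bound
  obtain ⟨K, A, hK, htame⟩ := γ.exists_arc_le
  refine ⟨ε, hε, fun m => ?_⟩
  -- The chord-arc constant grows like `(1 + r) ^ A`; the extra `A` orders of decay absorb it.
  obtain ⟨C₀, hC₀, hb⟩ := hb (m + A)
  refine ⟨(16 / β + 10) * (K * 2 ^ A * C₀ * 2 ^ |ε - 1| * 2 ^ (m + A)), by positivity,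
    fun z hz => ?_⟩
  obtain ⟨r, hr⟩ : ∃ r, ‖z‖ = r := ⟨_, rfl⟩
  rw [hr]
  have hz0 := γ.ne_zero_of_notMem hz
  have hr0 : 0 < r := by rw [← hr]; exact norm_pos_iff.2 hz0
  set a := γ.param (r / 2) with hadef
  set b := γ.param (2 * r) with hbdef
  have ha : 0 < a := γ.param_pos (by positivity)
  have hb0 : 0 < b := γ.param_pos (by positivity)
  have hab : a ≤ b := γ.strictMono_param.monotone (by linarith)
  have hna : ‖γ.toFun a‖ = r / 2 := γ.norm_param (by positivity)
  have hnb : ‖γ.toFun b‖ = 2 * r := γ.norm_param (by positivity)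
  have hnab : ‖γ.toFun b - γ.toFun a‖ ≤ 5 / 2 * r := by
    refine (norm_sub_le _ _).trans ?_
    rw [hna, hnb]; linarith
  have hmem : ∀ t ∈ Icc a b, r / 2 ≤ ‖γ.toFun t‖ ∧ ‖γ.toFun t‖ ≤ 2 * r := fun t ht =>
    norm_mem_of_mem_Icc (by positivity) (by positivity) ht
  set κ := K * (1 + 2 * r) ^ A with hκdef
  have hκ : 1 ≤ κ := by
    have : (1 : ℝ) ≤ (1 + 2 * r) ^ A := one_le_pow₀ (by linarith)
    nlinarith
  have hchord : ∀ s t, a ≤ s → s ≤ t → t ≤ b →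
      γ.arc t - γ.arc s ≤ κ * ‖γ.toFun t - γ.toFun s‖ := by
    intro s t hs hst ht
    refine (htame s t (ha.le.trans hs) hst).trans ?_
    have := (hmem t ⟨hs.trans hst, ht⟩).2
    rw [hκdef]
    gcongr
  have harc : γ.arc b - γ.arc a ≤ 4 * κ * r := by
    refine (hchord a b le_rfl hab le_rfl).trans ?_
    calc _ ≤ κ * (5 / 2 * r) := by gcongr
      _ ≤ _ := by nlinarith
  set S := C₀ * (2 ^ |ε - 1| * r ^ (ε - 1)) * (2 ^ (m + A) * ((1 + r) ^ (m + A))⁻¹) with hSdef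
  have hS0 : 0 ≤ S := by positivity
  have hS : ∀ t ∈ Icc a b,
      C₀ * ‖γ.toFun t‖ ^ (ε - 1) * ((1 + ‖γ.toFun t‖) ^ (m + A))⁻¹ ≤ S := by
    intro t ht
    obtain ⟨h1, h2⟩ := hmem t ht
    rw [hSdef]
    gcongr
    · exact rpow_le_of_mem_annulus two_pos hr0 h1 h2 _
    · rw [inv_le_comm₀ (by positivity) (by positivity), mul_inv, inv_inv, ← inv_pow, ← mul_pow]
      gcongr
      linarith
  have hfS : ∀ t ∈ Icc a b, ‖f (γ.toFun t)‖ ≤ S := by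
    intro t ht
    have h0 := ha.trans_le ht.1
    exact ((hb t t h0 h0 (by linarith [γ.norm_pos h0]) (by linarith [γ.norm_pos h0])).1).trans
      (hS t ht)
  have hmain : ‖∫ t in a..b, (γ.toFun t - z)⁻¹ * (f (γ.toFun t) * deriv γ.toFun t)‖ ≤
      (16 / β + 10) * (κ * S) := by
    have h16 : 16 ≤ 16 / β := by rw [le_div_iff₀ hβ]; linarith
    -- In the near case the nearest point has modulus between `3r/4` and `5r/4`, so it belongs to
    -- the arc.
    rcases le_or_gt (r / 4) ‖z - γ.toFun (γ.nearest z)‖ with hfar | hnear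
    · have h1 : ‖∫ t in a..b, (γ.toFun t - z)⁻¹ * (f (γ.toFun t) * deriv γ.toFun t)‖ ≤
          ∫ t in a..b, 4 / r * S * ‖deriv γ.toFun t‖ := by
        refine intervalIntegral.norm_integral_le_of_norm_le hab
          (Eventually.of_forall fun t ht => ?_)
          ((γ.intervalIntegrable_deriv ha.le hb0.le).norm.const_mul _)
        have ht0 : 0 < t := ha.trans ht.1
        have h2 := hfS t (Ioc_subset_Icc_self ht)
        have h3 : ‖(γ.toFun t - z)⁻¹‖ ≤ 4 / r := by
          rw [norm_inv, inv_le_comm₀ (norm_pos_iff.2 (γ.sub_ne_zero_of_notMem hz ht0.le))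
            (by positivity), inv_div, norm_sub_rev]
          exact hfar.trans (γ.norm_sub_nearest_le z ht0.le)
        rw [norm_mul, norm_mul, ← mul_assoc]
        gcongr
      rw [intervalIntegral.integral_const_mul, ← γ.arc_sub ha.le hb0.le] at h1
      calc _ ≤ 4 / r * S * (4 * κ * r) := h1.trans (by gcongr)
        _ = 16 * (κ * S) := by field_simp; ring
        _ ≤ _ := by gcongr; linarith
    · have hτ0 := γ.nearest_nonneg z
      have hn1 : r * (3 / 4) ≤ ‖γ.toFun (γ.nearest z)‖ := by
        have := norm_sub_norm_le z (γ.toFun (γ.nearest z))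
        linarith
      have hn2 : ‖γ.toFun (γ.nearest z)‖ ≤ r * (5 / 4) := by
        have := norm_sub_norm_le (γ.toFun (γ.nearest z)) z
        rw [norm_sub_rev] at this
        linarith
      have hτ : γ.nearest z ∈ Icc a b :=
        mem_Icc_of_norm_mem hτ0 (by linarith) (by linarith)
      set τ := γ.nearest z with hτdef
      have hτpos : 0 < τ := ha.trans_le hτ.1
      have hx : 0 < ‖γ.toFun τ‖ := γ.norm_pos hτpos
      have h1 := norm_arc_sub_le hf.integrable (H := S * ‖γ.toFun τ‖ ^ (-β)) ha hτ.1 hτ.2 hβ hβ1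
        hκ (by positivity) hz hτdef hchord (fun t ht => by
          obtain ⟨h2, h3⟩ := hmem t ht
          have h4 := (hb t τ (ha.trans_le ht.1) hτpos (by linarith) (by linarith)).2
          rw [Real.div_rpow (norm_nonneg _) hx.le, div_eq_mul_inv, ← Real.rpow_neg hx.le] at h4
          refine h4.trans ?_
          calc _ ≤ S * (‖γ.toFun t - γ.toFun τ‖ ^ β * ‖γ.toFun τ‖ ^ (-β)) := by
                gcongr
                exact hS τ hτ
            _ = _ := by ring)
      have h2 : ‖γ.toFun τ‖ ^ (-β) * ‖γ.toFun b - γ.toFun a‖ ^ β ≤ 4 := by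
        rw [Real.rpow_neg hx.le, ← div_eq_inv_mul, ← Real.div_rpow (norm_nonneg _) hx.le]
        have h3 : ‖γ.toFun b - γ.toFun a‖ / ‖γ.toFun τ‖ ≤ 4 := by
          rw [div_le_iff₀ hx]; linarith
        calc _ ≤ (4 : ℝ) ^ β := Real.rpow_le_rpow (by positivity) h3 hβ.le
          _ ≤ (4 : ℝ) ^ (1 : ℝ) := Real.rpow_le_rpow_of_exponent_le (by norm_num) hβ1
          _ = 4 := Real.rpow_one 4
      have h3 : 4 * (S * ‖γ.toFun τ‖ ^ (-β)) * κ / β * ‖γ.toFun b - γ.toFun a‖ ^ β ≤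
          16 / β * (κ * S) := by
        calc _ = 4 * κ * S / β * (‖γ.toFun τ‖ ^ (-β) * ‖γ.toFun b - γ.toFun a‖ ^ β) := by ring
          _ ≤ 4 * κ * S / β * 4 := by gcongr
          _ = _ := by ring
      have h4 := norm_integral_deriv_div_le hz hr hκ harc
      have h5 : ‖f (γ.toFun τ) * ∫ t in a..b, (γ.toFun t - z)⁻¹ * deriv γ.toFun t‖ ≤
          10 * (κ * S) := by
        rw [norm_mul]
        calc _ ≤ S * (10 * κ) := by
              gcongr
              exact hfS τ hτ
          _ = _ := by ring
      have h6 := norm_sub_norm_le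
        (∫ t in a..b, (γ.toFun t - z)⁻¹ * (f (γ.toFun t) * deriv γ.toFun t))
        (f (γ.toFun τ) * ∫ t in a..b, (γ.toFun t - z)⁻¹ * deriv γ.toFun t)
      rw [add_mul]
      linarith
  refine hmain.trans ?_
  have hκ2 : κ ≤ K * 2 ^ A * (1 + r) ^ A := by
    rw [hκdef, mul_assoc, ← mul_pow]
    gcongr
    linarith
  calc _ ≤ (16 / β + 10) * (K * 2 ^ A * (1 + r) ^ A * S) := by gcongr
    _ = _ := by
      rw [hSdef, pow_add (1 + r)]
      field_simp

/-- Outside the arc the moduli of `γ(t)` and `z` differ by at least `‖z‖ / 2`. The resulting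
constant dominates the far part independently of `z`. -/
theorem norm_mul_inv_sub_le {z : ℂ} (hz : z ∈ γ.supportᶜ) {t : ℝ}
    (ht : t ∈ Ioi (0 : ℝ) \ Ioc (γ.param (‖z‖ / 2)) (γ.param (2 * ‖z‖))) :
    ‖z * (γ.toFun t - z)⁻¹‖ ≤ 2 := by
  have hz0 : 0 < ‖z‖ := norm_pos_iff.2 (γ.ne_zero_of_notMem hz)
  obtain ⟨ht0, htn⟩ := ht
  rw [mem_Ioi] at ht0
  have h : ‖z‖ / 2 ≤ ‖γ.toFun t - z‖ := by
    rcases le_or_gt t (γ.param (‖z‖ / 2)) with h | h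
    · have h1 := γ.norm_le_norm ht0.le h
      rw [γ.norm_param (by positivity)] at h1
      have h2 := norm_sub_norm_le z (γ.toFun t)
      rw [norm_sub_rev] at h2
      linarith
    · have h1 := γ.norm_le_norm (γ.param_nonneg (R := 2 * ‖z‖) (by positivity))
        (show γ.param (2 * ‖z‖) ≤ t from by
          by_contra hc
          exact htn ⟨h, (not_le.1 hc).le⟩)
      rw [γ.norm_param (by positivity)] at h1
      have h2 := norm_sub_norm_le (γ.toFun t) z
      linarith
  rw [norm_mul, norm_inv, ← div_eq_mul_inv, div_le_iff₀ (by linarith)]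
  linarith

/-- The near arc contributes a multiple of `‖z‖ ^ ε`. The far part tends to `0` by dominated
convergence, as `z / (γ(t) - z)` is bounded by `2` and tends to `0` for each `t`. -/
theorem GoodDensity.tendsto_mul_cauchy (hf : γ.GoodDensity f) :
    Tendsto (fun z => z * γ.cauchy f z) γ.atOrigin (𝓝 0) := by
  obtain ⟨ε, hε, hm⟩ := hf.exists_norm_arc_le
  obtain ⟨C, hC, hm⟩ := hm 0
  have hint := hf.integrable
  have hsupp : γ.supportᶜ ∈ γ.atOrigin := self_mem_nhdsWithin
  have h1 : Tendsto (fun z => z * ∫ t in γ.param (‖z‖ / 2)..γ.param (2 * ‖z‖),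
      (γ.toFun t - z)⁻¹ * (f (γ.toFun t) * deriv γ.toFun t)) γ.atOrigin (𝓝 0) := by
    have h2 : Tendsto (fun z : ℂ => C * ‖z‖ ^ ε) γ.atOrigin (𝓝 0) := by
      have : Continuous fun z : ℂ => C * ‖z‖ ^ ε :=
        continuous_const.mul (continuous_norm.rpow_const fun _ => Or.inr hε.le)
      have := this.tendsto 0
      rw [norm_zero, Real.zero_rpow hε.ne', mul_zero] at this
      exact this.mono_left nhdsWithin_le_nhds
    refine squeeze_zero_norm' ?_ h2
    filter_upwards [hsupp] with z hz
    have hz0 : 0 < ‖z‖ := norm_pos_iff.2 (γ.ne_zero_of_notMem hz)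
    have := hm z hz
    rw [norm_mul]
    calc _ ≤ ‖z‖ * (C * ‖z‖ ^ (ε - 1) * ((1 + ‖z‖) ^ 0)⁻¹) := by gcongr
      _ = _ := by rw [Real.rpow_sub_one hz0.ne']; field_simp
  have h2 : Tendsto (fun z => z * γ.cauchyOff f (γ.param (‖z‖ / 2)) (γ.param (2 * ‖z‖)) z)
      γ.atOrigin (𝓝 0) := by
    have hm2 : ∀ z : ℂ, MeasurableSet
        (Ioi (0 : ℝ) \ Ioc (γ.param (‖z‖ / 2)) (γ.param (2 * ‖z‖))) := fun z =>
      measurableSet_Ioi.diff measurableSet_Ioc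
    have h3 : Tendsto (fun z => ∫ t in Ioi (0 : ℝ),
        (Ioi (0 : ℝ) \ Ioc (γ.param (‖z‖ / 2)) (γ.param (2 * ‖z‖))).indicator
          (fun t => z * (γ.toFun t - z)⁻¹ * (f (γ.toFun t) * deriv γ.toFun t)) t)
        γ.atOrigin (𝓝 (∫ t in Ioi (0 : ℝ), (0 : ℂ))) := by
      have : γ.atOrigin.IsCountablyGenerated := by unfold atOrigin; infer_instance
      refine MeasureTheory.tendsto_integral_filter_of_dominated_convergence
        (fun t => 2 * ‖f (γ.toFun t) * deriv γ.toFun t‖) ?_ ?_ (hint.norm.const_mul 2) ?_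
      · filter_upwards [hsupp] with z hz
        refine MeasureTheory.AEStronglyMeasurable.indicator ?_ (hm2 z)
        have := (integrableOn_cauchy hint hz).aestronglyMeasurable.const_mul z
        simpa only [mul_assoc] using this
      · filter_upwards [hsupp] with z hz
        refine Eventually.of_forall fun t => ?_
        by_cases ht : t ∈ Ioi (0 : ℝ) \ Ioc (γ.param (‖z‖ / 2)) (γ.param (2 * ‖z‖))
        · rw [indicator_of_mem ht, norm_mul]
          gcongr
          exact norm_mul_inv_sub_le hz ht
        · rw [indicator_of_notMem ht, norm_zero]
          positivity
      · refine (MeasureTheory.ae_restrict_iff' measurableSet_Ioi).2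
          (Eventually.of_forall fun t ht => ?_)
        have hne := γ.toFun_ne_zero ht
        have h4 : Tendsto (fun z => z * (γ.toFun t - z)⁻¹ * (f (γ.toFun t) * deriv γ.toFun t))
            γ.atOrigin (𝓝 0) := by
          have : ContinuousAt
              (fun z => z * (γ.toFun t - z)⁻¹ * (f (γ.toFun t) * deriv γ.toFun t)) 0 :=
            (continuousAt_id.mul ((continuousAt_const.sub continuousAt_id).inv₀
              (by simpa using hne))).mul continuousAt_const
          have := this.tendsto
          simp only [zero_mul] at this
          exact this.mono_left nhdsWithin_le_nhds
        refine squeeze_zero_norm (fun z => ?_) (tendsto_zero_iff_norm_tendsto_zero.1 h4)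
        exact norm_indicator_le_norm_self _ _
    rw [MeasureTheory.integral_zero] at h3
    refine h3.congr fun z => ?_
    rw [MeasureTheory.integral_indicator (hm2 z), MeasureTheory.Measure.restrict_restrict (hm2 z),
      inter_eq_self_of_subset_left sdiff_subset, cauchyOff, ← MeasureTheory.integral_const_mul]
    simp only [mul_assoc]
  have h3 := h2.add h1
  rw [add_zero] at h3
  refine h3.congr' ?_
  filter_upwards [hsupp] with z hz
  rw [← mul_add, cauchy_eq_off_add hint (γ.param_nonneg (R := ‖z‖ / 2) (by positivity))
    (γ.strictMono_param.monotone (show ‖z‖ / 2 ≤ 2 * ‖z‖ by linarith [norm_nonneg z])) hz]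

theorem compl_support_mem_atInfty : γ.supportᶜ ∈ γ.atInfty := mem_inf_of_right (mem_principal_self _)

theorem one_le_norm_mem_atInfty : {z : ℂ | 1 ≤ ‖z‖} ∈ γ.atInfty := by
  apply mem_inf_of_left
  have := tendsto_norm_cobounded_atTop (E := ℂ) (eventually_ge_atTop 1)
  exact this

/-- Mere boundedness suffices: applied to the densities `w ^ m * f w`, it controls the remainders of
all orders in `MomentDensity.hasExpansion`. -/
theorem GoodDensity.isBigO_cauchy (hf : γ.GoodDensity f) :
    γ.cauchy f =O[γ.atInfty] (fun _ => (1 : ℂ)) := by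
  obtain ⟨ε, hε, hm⟩ := hf.exists_norm_arc_le
  obtain ⟨m, hεm⟩ := exists_nat_ge (ε - 1)
  obtain ⟨C, hC, hm⟩ := hm m
  have hint := hf.integrable
  refine Asymptotics.IsBigO.of_bound
    (2 * (∫ t in Ioi (0 : ℝ), ‖f (γ.toFun t) * deriv γ.toFun t‖) + C) ?_
  filter_upwards [compl_support_mem_atInfty, one_le_norm_mem_atInfty] with z hz hz1
  have hz0 : 0 < ‖z‖ := by linarith
  rw [norm_one, mul_one, cauchy_eq_off_add hint (γ.param_nonneg (R := ‖z‖ / 2) (by positivity))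
    (γ.strictMono_param.monotone (show ‖z‖ / 2 ≤ 2 * ‖z‖ by linarith)) hz]
  refine (norm_add_le _ _).trans (add_le_add ?_ ?_)
  · rw [← MeasureTheory.integral_const_mul]
    have hbd : MeasureTheory.IntegrableOn
        (fun t => 2 * ‖f (γ.toFun t) * deriv γ.toFun t‖) (Ioi 0) := hint.norm.const_mul 2
    refine le_trans (MeasureTheory.norm_integral_le_of_norm_le (hbd.mono_set sdiff_subset) ?_)
      (MeasureTheory.setIntegral_mono_set hbd (Eventually.of_forall fun t => by positivity)
        (Eventually.of_forall fun t ht => ht.1))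
    refine (MeasureTheory.ae_restrict_iff' (measurableSet_Ioi.diff measurableSet_Ioc)).2
      (Eventually.of_forall fun t ht => ?_)
    rw [norm_mul]
    gcongr
    have h1 := norm_mul_inv_sub_le hz ht
    rw [norm_mul] at h1
    exact (le_mul_of_one_le_left (norm_nonneg _) hz1).trans h1
  · refine (hm z hz).trans ?_
    rw [mul_assoc]
    refine mul_le_of_le_one_right hC ?_
    rw [← div_eq_mul_inv, div_le_one (by positivity)]
    calc ‖z‖ ^ (ε - 1) ≤ ‖z‖ ^ (m : ℝ) := Real.rpow_le_rpow_of_exponent_le hz1 hεm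
      _ = ‖z‖ ^ m := Real.rpow_natCast _ _
      _ ≤ _ := by gcongr; linarith

end LaguerreCurve

theorem rpow_le_five_mul_rpow {x β β' : ℝ} (hx : 0 ≤ x) (hx5 : x ≤ 5) (hβ' : 0 < β')
    (h : β' ≤ β) (hβ : β ≤ 1) : x ^ β ≤ 5 * x ^ β' := by
  rcases le_or_gt x 1 with h1 | h1
  · have h2 : x ^ β ≤ x ^ β' := Real.rpow_le_rpow_of_exponent_ge' hx h1 hβ'.le h
    have h3 : 0 ≤ x ^ β' := Real.rpow_nonneg hx _
    linarith
  · have h2 : x ^ β ≤ 5 := by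
      calc x ^ β ≤ x ^ (1 : ℝ) := Real.rpow_le_rpow_of_exponent_le h1.le hβ
        _ ≤ 5 := by rwa [Real.rpow_one]
    have h3 : 1 ≤ x ^ β' := Real.one_le_rpow h1.le hβ'.le
    linarith

/-! ### Moderate functions on the curve -/

namespace LaguerreCurve

/-- Two parameters whose points on the curve have moduli of comparable size. -/
def Comparable (γ : LaguerreCurve) (s t : ℝ) : Prop :=
  0 < s ∧ 0 < t ∧ ‖γ.toFun s‖ ≤ 4 * ‖γ.toFun t‖ ∧ ‖γ.toFun t‖ ≤ 4 * ‖γ.toFun s‖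

/-- The distance of two points of the curve relative to their modulus. -/
noncomputable def relDist (γ : LaguerreCurve) (s t : ℝ) : ℝ :=
  ‖γ.toFun s - γ.toFun t‖ / ‖γ.toFun t‖

/-- The function `g` and its Hölder quotients are `O(|w|^a (1 + |w|)^B)` on the curve, with
explicit constants. -/
def ModerateWith (γ : LaguerreCurve) (a : ℝ) (B : ℕ) (β C : ℝ) (g : ℂ → ℂ) : Prop :=
  ∀ s t : ℝ, γ.Comparable s t →
    ‖g (γ.toFun t)‖ ≤ C * (‖γ.toFun t‖ ^ a * (1 + ‖γ.toFun t‖) ^ B) ∧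
    ‖g (γ.toFun s) - g (γ.toFun t)‖ ≤ C * (‖γ.toFun t‖ ^ a * (1 + ‖γ.toFun t‖) ^ B) *
      γ.relDist s t ^ β

/-- Functions on the curve of order `a` at the origin and of polynomial growth at infinity, with
corresponding Hölder estimates. -/
def IsModerate (γ : LaguerreCurve) (a : ℝ) (g : ℂ → ℂ) : Prop :=
  ∃ (B : ℕ) (β C : ℝ), 0 < β ∧ β ≤ 1 ∧ 0 ≤ C ∧ γ.ModerateWith a B β C g

variable {γ : LaguerreCurve}

theorem Comparable.refl {t : ℝ} (ht : 0 < t) : γ.Comparable t t := by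
  have := γ.norm_pos ht
  exact ⟨ht, ht, by linarith, by linarith⟩

theorem relDist_nonneg (s t : ℝ) : 0 ≤ γ.relDist s t := by unfold relDist; positivity

/-- The bound `4 + 1` is the origin of the factors `5` below, which are the price of lowering a
Hölder exponent. -/
theorem Comparable.relDist_le {s t : ℝ} (h : γ.Comparable s t) : γ.relDist s t ≤ 5 := by
  unfold relDist
  rw [div_le_iff₀ (γ.norm_pos h.2.1)]
  have := norm_sub_le (γ.toFun s) (γ.toFun t)
  linarith [h.2.2.1]

theorem Comparable.relDist_rpow_le {s t β : ℝ} (h : γ.Comparable s t) (hβ : 0 < β) (hβ1 : β ≤ 1) :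
    γ.relDist s t ^ β ≤ 5 := by
  calc γ.relDist s t ^ β ≤ 5 ^ β := Real.rpow_le_rpow (relDist_nonneg s t) h.relDist_le hβ.le
    _ ≤ 5 ^ (1 : ℝ) := Real.rpow_le_rpow_of_exponent_le (by norm_num) hβ1
    _ = 5 := Real.rpow_one 5

/-- This brings two functions to a common Hölder exponent, and where needed a common weight, before
they are added or multiplied. -/
theorem ModerateWith.weaken {a a' β β' C C' : ℝ} {B B' : ℕ} {g : ℂ → ℂ}
    (h : γ.ModerateWith a B β C g) (hC : 0 ≤ C) (hβ' : 0 < β') (hβ : β' ≤ β) (hβ1 : β ≤ 1)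
    (hw : ∀ t, 0 < t → ‖γ.toFun t‖ ^ a * (1 + ‖γ.toFun t‖) ^ B ≤
      ‖γ.toFun t‖ ^ a' * (1 + ‖γ.toFun t‖) ^ B') (hC' : 5 * C ≤ C') :
    γ.ModerateWith a' B' β' C' g := by
  intro s t hst
  obtain ⟨h1, h2⟩ := h s t hst
  have hw' := hw t hst.2.1
  have hx := rpow_le_five_mul_rpow (relDist_nonneg s t) hst.relDist_le hβ' hβ hβ1
  have hx0 : 0 ≤ γ.relDist s t ^ β' := Real.rpow_nonneg (relDist_nonneg s t) _
  have hx1 : 0 ≤ γ.relDist s t ^ β := Real.rpow_nonneg (relDist_nonneg s t) _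
  have hCC' : C ≤ C' := by linarith
  have hC'0 : 0 ≤ C' := by linarith
  constructor
  · refine h1.trans ?_
    gcongr
  · refine h2.trans ?_
    calc _ ≤ C * (‖γ.toFun t‖ ^ a' * (1 + ‖γ.toFun t‖) ^ B') * (5 * γ.relDist s t ^ β') := by
          gcongr
      _ = 5 * C * (‖γ.toFun t‖ ^ a' * (1 + ‖γ.toFun t‖) ^ B') * γ.relDist s t ^ β' := by ring
      _ ≤ _ := by gcongr

theorem IsModerate.congr {a : ℝ} {f g : ℂ → ℂ} (hf : γ.IsModerate a f)
    (h : ∀ t, 0 < t → g (γ.toFun t) = f (γ.toFun t)) : γ.IsModerate a g := by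
  obtain ⟨B, β, C, h1, h2, h3, h4⟩ := hf
  refine ⟨B, β, C, h1, h2, h3, fun s t hst => ?_⟩
  rw [h s hst.1, h t hst.2.1]
  exact h4 s t hst

/-- The surplus power `‖w‖ ^ (a - a')` is absorbed by the polynomial growth allowed at infinity. -/
theorem IsModerate.mono {a a' : ℝ} {f : ℂ → ℂ} (hf : γ.IsModerate a f) (ha : a' ≤ a) :
    γ.IsModerate a' f := by
  obtain ⟨B, β, C, h1, h2, h3, h4⟩ := hf
  obtain ⟨k, hk⟩ := exists_nat_ge (a - a')
  refine ⟨B + k, β, 5 * C, h1, h2, by positivity, h4.weaken h3 h1 le_rfl h2 (fun t ht => ?_) le_rfl⟩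
  have hx := γ.norm_pos ht
  have h5 : ‖γ.toFun t‖ ^ (a - a') ≤ (1 + ‖γ.toFun t‖) ^ k := by
    calc _ ≤ (1 + ‖γ.toFun t‖) ^ (a - a') := by
          apply Real.rpow_le_rpow hx.le (by linarith) (by linarith)
      _ ≤ (1 + ‖γ.toFun t‖) ^ (k : ℝ) := Real.rpow_le_rpow_of_exponent_le (by linarith) hk
      _ = _ := Real.rpow_natCast _ _
  have h6 : ‖γ.toFun t‖ ^ a = ‖γ.toFun t‖ ^ a' * ‖γ.toFun t‖ ^ (a - a') := by
    rw [← Real.rpow_add hx]; congr 1; ring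
  rw [h6, pow_add]
  calc _ ≤ ‖γ.toFun t‖ ^ a' * (1 + ‖γ.toFun t‖) ^ k * (1 + ‖γ.toFun t‖) ^ B := by gcongr
    _ = _ := by ring

theorem IsModerate.add {a : ℝ} {f g : ℂ → ℂ} (hf : γ.IsModerate a f) (hg : γ.IsModerate a g) :
    γ.IsModerate a (fun w => f w + g w) := by
  obtain ⟨B₁, β₁, C₁, h1, h2, h3, h4⟩ := hf
  obtain ⟨B₂, β₂, C₂, k1, k2, k3, k4⟩ := hg
  have hw : ∀ B t, 0 < t → B ≤ B₁ + B₂ → ‖γ.toFun t‖ ^ a * (1 + ‖γ.toFun t‖) ^ B ≤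
      ‖γ.toFun t‖ ^ a * (1 + ‖γ.toFun t‖) ^ (B₁ + B₂) := by
    intro B t ht hB
    gcongr
    linarith [norm_nonneg (γ.toFun t)]
  have h5 := h4.weaken h3 (lt_min h1 k1) (min_le_left β₁ β₂) h2
    (fun t ht => hw _ t ht (Nat.le_add_right _ _)) le_rfl
  have k5 := k4.weaken k3 (lt_min h1 k1) (min_le_right β₁ β₂) k2
    (fun t ht => hw _ t ht (Nat.le_add_left _ _)) le_rfl
  refine ⟨B₁ + B₂, min β₁ β₂, 5 * C₁ + 5 * C₂, lt_min h1 k1, (min_le_left _ _).trans h2,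
    by positivity, fun s t hst => ⟨?_, ?_⟩⟩
  · refine (norm_add_le _ _).trans ((add_le_add (h5 s t hst).1 (k5 s t hst).1).trans (le_of_eq ?_))
    ring
  · have : f (γ.toFun s) + g (γ.toFun s) - (f (γ.toFun t) + g (γ.toFun t)) =
        (f (γ.toFun s) - f (γ.toFun t)) + (g (γ.toFun s) - g (γ.toFun t)) := by ring
    rw [this]
    refine (norm_add_le _ _).trans ((add_le_add (h5 s t hst).2 (k5 s t hst).2).trans (le_of_eq ?_))
    ring

theorem IsModerate.mul {a b : ℝ} {f g : ℂ → ℂ} (hf : γ.IsModerate a f) (hg : γ.IsModerate b g) :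
    γ.IsModerate (a + b) (fun w => f w * g w) := by
  obtain ⟨B₁, β₁, C₁, h1, h2, h3, h4⟩ := hf
  obtain ⟨B₂, β₂, C₂, k1, k2, k3, k4⟩ := hg
  have h5 := h4.weaken h3 (lt_min h1 k1) (min_le_left β₁ β₂) h2 (fun t ht => le_rfl) le_rfl
  have k5 := k4.weaken k3 (lt_min h1 k1) (min_le_right β₁ β₂) k2 (fun t ht => le_rfl) le_rfl
  have hβ : 0 < min β₁ β₂ := lt_min h1 k1
  have hβ1 : min β₁ β₂ ≤ 1 := (min_le_left _ _).trans h2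
  -- Here `7 = 6 + 1`: at the comparable point `s` the factor `f` is at most `6` times its bound at
  -- `t`, and the second term of the product difference adds one more.
  refine ⟨B₁ + B₂, min β₁ β₂, 7 * (5 * C₁) * (5 * C₂), hβ, hβ1, by positivity,
    fun s t hst => ?_⟩
  obtain ⟨h6, h7⟩ := h5 s t hst
  obtain ⟨k6, k7⟩ := k5 s t hst
  have hx := γ.norm_pos hst.2.1
  set M₁ := ‖γ.toFun t‖ ^ a * (1 + ‖γ.toFun t‖) ^ B₁ with hM₁
  set M₂ := ‖γ.toFun t‖ ^ b * (1 + ‖γ.toFun t‖) ^ B₂ with hM₂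
  have hM : ‖γ.toFun t‖ ^ (a + b) * (1 + ‖γ.toFun t‖) ^ (B₁ + B₂) = M₁ * M₂ := by
    rw [Real.rpow_add hx, pow_add]; ring
  have hM₁0 : 0 ≤ M₁ := by positivity
  have hM₂0 : 0 ≤ M₂ := by positivity
  rw [hM]
  have hx5 := hst.relDist_rpow_le hβ hβ1
  have hx0 : 0 ≤ γ.relDist s t ^ min β₁ β₂ := Real.rpow_nonneg (relDist_nonneg s t) _
  set X := γ.relDist s t ^ min β₁ β₂
  have h8 : ‖f (γ.toFun s)‖ ≤ 6 * (5 * C₁ * M₁) := by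
    have h9 := norm_le_norm_add_norm_sub' (f (γ.toFun s)) (f (γ.toFun t))
    have h10 : 5 * C₁ * M₁ * X ≤ 5 * C₁ * M₁ * 5 := by gcongr
    linarith
  constructor
  · rw [norm_mul]
    calc _ ≤ 5 * C₁ * M₁ * (5 * C₂ * M₂) := by gcongr
      _ ≤ 7 * (5 * C₁ * M₁ * (5 * C₂ * M₂)) := le_mul_of_one_le_left (by positivity) (by norm_num)
      _ = _ := by ring
  · have : f (γ.toFun s) * g (γ.toFun s) - f (γ.toFun t) * g (γ.toFun t) =
        f (γ.toFun s) * (g (γ.toFun s) - g (γ.toFun t)) +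
          (f (γ.toFun s) - f (γ.toFun t)) * g (γ.toFun t) := by ring
    rw [this]
    refine (norm_add_le _ _).trans ?_
    rw [norm_mul, norm_mul]
    calc _ ≤ 6 * (5 * C₁ * M₁) * (5 * C₂ * M₂ * X) + 5 * C₁ * M₁ * X * (5 * C₂ * M₂) := by gcongr
      _ = _ := by ring

theorem isModerate_const (c : ℂ) : γ.IsModerate 0 (fun _ => c) := by
  refine ⟨0, 1, ‖c‖, one_pos, le_rfl, norm_nonneg _, fun s t hst => ⟨by simp, ?_⟩⟩
  have := relDist_nonneg (γ := γ) s t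
  simp only [sub_self, norm_zero]
  positivity

theorem isModerate_id : γ.IsModerate 0 (fun w => w) := by
  refine ⟨1, 1, 1, one_pos, le_rfl, zero_le_one, fun s t hst => ?_⟩
  have hx := γ.norm_pos hst.2.1
  rw [Real.rpow_zero, pow_one, one_mul, one_mul, Real.rpow_one]
  refine ⟨by linarith, ?_⟩
  rw [relDist, mul_div_assoc', le_div_iff₀ hx]
  nlinarith [norm_nonneg (γ.toFun s - γ.toFun t)]

theorem IsModerate.pow {a : ℝ} {f : ℂ → ℂ} (hf : γ.IsModerate a f) (n : ℕ) :
    γ.IsModerate (n * a) (fun w => f w ^ n) := by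
  induction n with
  | zero => simpa using isModerate_const (γ := γ) 1
  | succ n ih =>
    have := ih.mul hf
    simp only [pow_succ]
    convert this using 1
    push_cast; ring

/-- Passing from absolute to relative distance costs `‖γ(t)‖ ^ β`, at most `1 + ‖γ(t)‖`. -/
theorem isModerate_of_holder {h : ℂ → ℂ} {K β : NNReal} {M : ℝ} (hβ : 0 < β) (hβ1 : β ≤ 1)
    (hh : HolderOnWith K β h γ.support) (hM : ∀ z ∈ γ.support, ‖h z‖ ≤ M) : γ.IsModerate 0 h := by
  have hM0 : 0 ≤ M := (norm_nonneg _).trans (hM 0 γ.zero_mem_support)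
  have hβ' : (0 : ℝ) < β := hβ
  have hβ1' : (β : ℝ) ≤ 1 := hβ1
  refine ⟨1, β, M + K, hβ', hβ1', by positivity, fun s t hst => ?_⟩
  have hx := γ.norm_pos hst.2.1
  have hs := γ.toFun_mem_support hst.1.le
  have ht := γ.toFun_mem_support hst.2.1.le
  rw [Real.rpow_zero, pow_one, one_mul]
  constructor
  · refine (hM _ ht).trans ?_
    nlinarith [mul_nonneg hM0 hx.le, mul_nonneg K.2 hx.le, K.2, show (K : ℝ) = K.1 from rfl]
  · have h1 := hh.dist_le hs ht
    rw [dist_eq_norm, dist_eq_norm] at h1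
    have h2 : ‖γ.toFun s - γ.toFun t‖ ^ (β : ℝ) =
        ‖γ.toFun t‖ ^ (β : ℝ) * γ.relDist s t ^ (β : ℝ) := by
      rw [← Real.mul_rpow hx.le (relDist_nonneg s t), relDist, mul_div_cancel₀ _ hx.ne']
    have h3 : ‖γ.toFun t‖ ^ (β : ℝ) ≤ 1 + ‖γ.toFun t‖ := by
      calc _ ≤ (1 + ‖γ.toFun t‖) ^ (β : ℝ) := Real.rpow_le_rpow hx.le (by linarith) hβ'.le
        _ ≤ (1 + ‖γ.toFun t‖) ^ (1 : ℝ) := Real.rpow_le_rpow_of_exponent_le (by linarith) hβ1'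
        _ = _ := Real.rpow_one _
    rw [h2] at h1
    have hX : 0 ≤ γ.relDist s t ^ (β : ℝ) := Real.rpow_nonneg (relDist_nonneg s t) _
    calc _ ≤ _ := h1
      _ ≤ (M + K) * ((1 + ‖γ.toFun t‖) * γ.relDist s t ^ (β : ℝ)) := by
        gcongr
        linarith
      _ = _ := by ring

/-! ### Logarithms along the curve -/

/-- By continuity the increment of `ℓ` is locally smaller than `π`, so it coincides with the
principal logarithm of a quotient, which is differentiable. -/
theorem IsLogAlong.hasDerivAt {ℓ : ℂ → ℂ} (hℓ : γ.IsLogAlong ℓ) {t : ℝ} (ht : 0 < t) :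
    HasDerivAt (fun u => ℓ (γ.toFun u)) (deriv γ.toFun t / γ.toFun t) t := by
  have hcont : ContinuousAt (fun u => ℓ (γ.toFun u)) t := by
    have h1 : ContinuousOn (fun u => ℓ (γ.toFun u)) (Ioi 0) :=
      hℓ.1.comp (γ.continuousOn_toFun.mono Ioi_subset_Ici_self) fun u hu => γ.toFun_mem_diff hu
    exact h1.continuousAt (Ioi_mem_nhds ht)
  have h0 := γ.toFun_ne_zero ht
  have h2 : HasDerivAt (fun u => ℓ (γ.toFun t) + log (γ.toFun u / γ.toFun t))
      (deriv γ.toFun t / γ.toFun t) t := by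
    have h3 := ((γ.hasDerivAt ht).div_const (γ.toFun t)).clog_real
      (by rw [div_self h0]; exact one_mem_slitPlane)
    rw [div_self h0, div_one] at h3
    exact h3.const_add _
  refine h2.congr_of_eventuallyEq ?_
  have h4 : ∀ᶠ u in 𝓝 t, ‖ℓ (γ.toFun u) - ℓ (γ.toFun t)‖ < Real.pi := by
    have := hcont (Metric.ball_mem_nhds _ Real.pi_pos)
    filter_upwards [this] with u hu
    rwa [mem_preimage, mem_ball_iff_norm] at hu
  filter_upwards [h4, Ioi_mem_nhds ht] with u hu hu0
  have h5 := (abs_im_le_norm (ℓ (γ.toFun u) - ℓ (γ.toFun t))).trans_lt hu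
  have h6 : exp (ℓ (γ.toFun u) - ℓ (γ.toFun t)) = γ.toFun u / γ.toFun t := by
    rw [exp_sub, hℓ.2 _ (γ.toFun_mem_diff hu0), hℓ.2 _ (γ.toFun_mem_diff ht)]
  rw [← h6, log_exp (by linarith [(abs_lt.1 h5).1]) (by linarith [(abs_lt.1 h5).2])]
  ring

theorem IsLogAlong.norm_sub_le {ℓ : ℂ → ℂ} (hℓ : γ.IsLogAlong ℓ) {u v : ℝ} (hu : 0 < u)
    (huv : u ≤ v) {B B' : ℝ → ℝ} (hB : ∀ x ∈ Icc u v, HasDerivAt B (B' x) x)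
    (hbound : ∀ x ∈ Icc u v, ‖deriv γ.toFun x‖ / ‖γ.toFun x‖ ≤ B' x) :
    ‖ℓ (γ.toFun v) - ℓ (γ.toFun u)‖ ≤ B v - B u := by
  have hd : ∀ x ∈ Icc u v, HasDerivAt (fun x => ℓ (γ.toFun x) - ℓ (γ.toFun u))
      (deriv γ.toFun x / γ.toFun x) x := fun x hx =>
    (hℓ.hasDerivAt (hu.trans_le hx.1)).sub_const _
  exact image_norm_le_of_norm_deriv_right_le_deriv_boundary' (a := u) (b := v)
    (f := fun x => ℓ (γ.toFun x) - ℓ (γ.toFun u))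
    (fun x hx => (hd x hx).continuousAt.continuousWithinAt)
    (fun x hx => (hd x (Ico_subset_Icc_self hx)).hasDerivWithinAt) (B := fun x => B x - B u)
    (by simp) (fun x hx => ((hB x hx).sub_const _).continuousAt.continuousWithinAt)
    (fun x hx => ((hB x (Ico_subset_Icc_self hx)).sub_const _).hasDerivWithinAt)
    (fun x hx => by rw [norm_div]; exact hbound x (Ico_subset_Icc_self hx)) (right_mem_Icc.2 huv)

theorem IsLogAlong.norm_sub_le_arc {ℓ : ℂ → ℂ} (hℓ : γ.IsLogAlong ℓ) {u v : ℝ} (hu : 0 < u)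
    (huv : u ≤ v) : ‖ℓ (γ.toFun v) - ℓ (γ.toFun u)‖ ≤ (γ.arc v - γ.arc u) / ‖γ.toFun u‖ := by
  rw [sub_div]
  refine hℓ.norm_sub_le hu huv (B := fun x => γ.arc x / ‖γ.toFun u‖)
    (fun x hx => (γ.hasDerivAt_arc (hu.trans_le hx.1)).div_const _) fun x hx => ?_
  gcongr
  · exact γ.norm_pos hu
  · exact γ.norm_le_norm hu.le hx.1

/-- The increment of `ℓ` is at most arc length over modulus, and tameness bounds the arc by the
chord up to a polynomial factor. -/
theorem IsLogAlong.exists_norm_sub_le {ℓ : ℂ → ℂ} (hℓ : γ.IsLogAlong ℓ) :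
    ∃ (L : ℝ) (A : ℕ), 0 ≤ L ∧ ∀ s t, γ.Comparable s t →
      ‖ℓ (γ.toFun s) - ℓ (γ.toFun t)‖ ≤ L * (1 + ‖γ.toFun t‖) ^ A * γ.relDist s t := by
  obtain ⟨K, A, hK, htame⟩ := γ.exists_arc_le
  refine ⟨4 * K * 4 ^ A, A, by positivity, fun s t hst => ?_⟩
  have hx := γ.norm_pos hst.2.1
  have key : ∀ u v, 0 < u → u ≤ v → ‖γ.toFun t‖ ≤ 4 * ‖γ.toFun u‖ →
      ‖γ.toFun v‖ ≤ 4 * ‖γ.toFun t‖ → ‖γ.toFun v - γ.toFun u‖ = ‖γ.toFun s - γ.toFun t‖ →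
      ‖ℓ (γ.toFun v) - ℓ (γ.toFun u)‖ ≤
        4 * K * 4 ^ A * (1 + ‖γ.toFun t‖) ^ A * γ.relDist s t := by
    intro u v hu huv h1 h2 h3
    have hu' := γ.norm_pos hu
    have hpow : (1 + ‖γ.toFun v‖) ^ A ≤ 4 ^ A * (1 + ‖γ.toFun t‖) ^ A := by
      rw [← mul_pow]
      gcongr
      linarith
    calc _ ≤ (γ.arc v - γ.arc u) / ‖γ.toFun u‖ := hℓ.norm_sub_le_arc hu huv
      _ ≤ K * (1 + ‖γ.toFun v‖) ^ A * ‖γ.toFun v - γ.toFun u‖ / (‖γ.toFun t‖ / 4) := by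
        gcongr
        · exact htame u v hu.le huv
        · linarith
      _ ≤ K * (4 ^ A * (1 + ‖γ.toFun t‖) ^ A) * ‖γ.toFun v - γ.toFun u‖ / (‖γ.toFun t‖ / 4) := by
        gcongr
      _ = _ := by rw [h3, relDist]; field_simp
  rcases le_total s t with h | h
  · rw [norm_sub_rev]
    exact key s t hst.1 h hst.2.2.2 (by linarith) (norm_sub_rev _ _)
  · exact key t s hst.2.1 h (by linarith) hst.2.2.1 rfl

/-- The argument may be unbounded because the curve can spiral, so `ℓ` is not controlled by the
logarithm of the modulus alone. Near the origin tameness gives arc length at most `κ` times the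
modulus. Hence `ℓ` is compared with `κ` times the logarithm of the arc length, which is `O(‖w‖ ^
(-η))`. For large moduli it grows at most polynomially. -/
theorem IsLogAlong.isModerate {ℓ : ℂ → ℂ} (hℓ : γ.IsLogAlong ℓ) {η : ℝ} (hη : 0 < η)
    (hη1 : η ≤ 1) : γ.IsModerate (-η) ℓ := by
  obtain ⟨K, A, hK, htame⟩ := γ.exists_arc_le
  obtain ⟨L, A', hL, hdiff⟩ := hℓ.exists_norm_sub_le
  set t₁ := γ.param 1
  have ht₁ : 0 < t₁ := γ.param_pos one_pos
  have hn₁ : ‖γ.toFun t₁‖ = 1 := γ.norm_param zero_le_one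
  set κ := K * 2 ^ A with hκ
  set D := ‖ℓ (γ.toFun t₁)‖
  have harc : ∀ u, 0 < u → u ≤ t₁ → γ.arc u ≤ κ * ‖γ.toFun u‖ := by
    intro u hu hut
    have h1 := htame 0 u le_rfl hu.le
    rw [γ.arc_zero, γ.map_zero, sub_zero, sub_zero] at h1
    refine h1.trans ?_
    have := γ.norm_le_norm hu.le hut
    rw [hκ]
    gcongr
    linarith
  have hpos : ∀ u, 0 < u → 0 < γ.arc u := fun u hu => by
    have := γ.arc_lt le_rfl hu
    rwa [γ.arc_zero] at this
  have hone : ∀ t, 0 < t → 1 ≤ ‖γ.toFun t‖ ^ (-η) * (1 + ‖γ.toFun t‖) := by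
    intro t ht
    have hx := γ.norm_pos ht
    rw [Real.rpow_neg hx.le, ← div_eq_inv_mul, one_le_div (by positivity)]
    calc _ ≤ (1 + ‖γ.toFun t‖) ^ η := Real.rpow_le_rpow hx.le (by linarith) hη.le
      _ ≤ (1 + ‖γ.toFun t‖) ^ (1 : ℝ) := Real.rpow_le_rpow_of_exponent_le (by linarith) hη1
      _ = _ := Real.rpow_one _
  have hsmall : ∀ t, 0 < t → t ≤ t₁ →
      ‖ℓ (γ.toFun t)‖ ≤ (D + κ * (γ.arc t₁ ^ η / η)) * ‖γ.toFun t‖ ^ (-η) := by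
    intro t ht htt
    have hx := γ.norm_pos ht
    have h1 := hℓ.norm_sub_le ht htt (B := fun x => κ * Real.log (γ.arc x))
      (fun x hx => ((γ.hasDerivAt_arc (ht.trans_le hx.1)).log
        (hpos x (ht.trans_le hx.1)).ne').const_mul κ) (fun x hx => by
        have hx0 := ht.trans_le hx.1
        have h2 := harc x hx0 hx.2
        rw [mul_div_assoc', div_le_div_iff₀ (γ.norm_pos hx0) (hpos x hx0)]
        nlinarith [norm_nonneg (deriv γ.toFun x)])
    rw [← mul_sub, ← Real.log_div (hpos _ ht₁).ne' (hpos _ ht).ne'] at h1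
    have h3 : Real.log (γ.arc t₁ / γ.arc t) ≤ γ.arc t₁ ^ η / η * ‖γ.toFun t‖ ^ (-η) := by
      calc Real.log (γ.arc t₁ / γ.arc t) ≤ (γ.arc t₁ / γ.arc t) ^ η / η :=
            Real.log_le_rpow_div (by have := hpos _ ht₁; have := hpos _ ht; positivity) hη
        _ ≤ (γ.arc t₁ / ‖γ.toFun t‖) ^ η / η := by
          have := hpos _ ht₁
          have := γ.norm_le_arc ht.le
          have := div_nonneg (hpos _ ht₁).le (hpos _ ht).le
          gcongr
        _ = _ := by
          rw [Real.div_rpow (hpos _ ht₁).le hx.le, Real.rpow_neg hx.le]; ring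
    have h4 : 1 ≤ ‖γ.toFun t‖ ^ (-η) := by
      refine Real.one_le_rpow_of_pos_of_le_one_of_nonpos hx ?_ (by linarith)
      rw [← hn₁]
      exact γ.norm_le_norm ht.le htt
    have h5 := norm_le_norm_add_norm_sub (ℓ (γ.toFun t₁)) (ℓ (γ.toFun t))
    calc _ ≤ D + κ * (γ.arc t₁ ^ η / η * ‖γ.toFun t‖ ^ (-η)) := by
          refine h5.trans (add_le_add le_rfl (h1.trans ?_))
          gcongr
      _ ≤ D * ‖γ.toFun t‖ ^ (-η) + κ * (γ.arc t₁ ^ η / η * ‖γ.toFun t‖ ^ (-η)) := by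
          gcongr
          exact le_mul_of_one_le_right (norm_nonneg _) h4
      _ = _ := by ring
  have hlarge : ∀ t, t₁ ≤ t → ‖ℓ (γ.toFun t)‖ ≤ (D + 2 * K) * (1 + ‖γ.toFun t‖) ^ (A + 1) := by
    intro t htt
    have h1 := hℓ.norm_sub_le_arc ht₁ htt
    rw [hn₁, div_one] at h1
    have h2 := htame t₁ t ht₁.le htt
    have h3 := γ.norm_le_norm ht₁.le htt
    have h4 : ‖γ.toFun t - γ.toFun t₁‖ ≤ 2 * (1 + ‖γ.toFun t‖) := by
      refine (_root_.norm_sub_le _ _).trans ?_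
      linarith [norm_nonneg (γ.toFun t)]
    have h5 := norm_le_norm_add_norm_sub' (ℓ (γ.toFun t)) (ℓ (γ.toFun t₁))
    have h6 : 1 ≤ (1 + ‖γ.toFun t‖) ^ (A + 1) := one_le_pow₀ (by linarith [norm_nonneg (γ.toFun t)])
    calc _ ≤ D * (1 + ‖γ.toFun t‖) ^ (A + 1) +
          K * (1 + ‖γ.toFun t‖) ^ A * (2 * (1 + ‖γ.toFun t‖)) := by
          refine h5.trans (add_le_add (le_mul_of_one_le_right (norm_nonneg _) h6)
            ((h1.trans h2).trans ?_))
          gcongr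
      _ = _ := by ring
  have hE : 0 ≤ κ * (γ.arc t₁ ^ η / η) := by
    have := hpos _ ht₁
    positivity
  have hD : 0 ≤ D := norm_nonneg _
  refine ⟨A + A' + 2, 1, D + κ * (γ.arc t₁ ^ η / η) + 2 * K + L, one_pos, le_rfl, by positivity,
    fun s t hst => ?_⟩
  have ht := hst.2.1
  have hx := γ.norm_pos ht
  have h1x : 1 ≤ 1 + ‖γ.toFun t‖ := by linarith
  constructor
  · rcases le_total t t₁ with h | h
    · refine (hsmall t ht h).trans ?_
      have : 1 ≤ (1 + ‖γ.toFun t‖) ^ (A + A' + 2) := one_le_pow₀ h1x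
      exact mul_le_mul (by linarith) (le_mul_of_one_le_right (by positivity) this)
        (by positivity) (by positivity)
    · refine (hlarge t h).trans ?_
      have h7 : (1 + ‖γ.toFun t‖) ^ (A + 1) ≤
          ‖γ.toFun t‖ ^ (-η) * (1 + ‖γ.toFun t‖) ^ (A + A' + 2) := by
        calc _ ≤ (‖γ.toFun t‖ ^ (-η) * (1 + ‖γ.toFun t‖)) * (1 + ‖γ.toFun t‖) ^ (A + 1) :=
              le_mul_of_one_le_left (by positivity) (hone t ht)
          _ = ‖γ.toFun t‖ ^ (-η) * (1 + ‖γ.toFun t‖) ^ (A + 2) := by ring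
          _ ≤ _ := by gcongr 2; omega
      exact mul_le_mul (by linarith) h7 (by positivity) (by positivity)
  · rw [Real.rpow_one]
    refine (hdiff s t hst).trans ?_
    have h7 : (1 + ‖γ.toFun t‖) ^ A' ≤
        ‖γ.toFun t‖ ^ (-η) * (1 + ‖γ.toFun t‖) ^ (A + A' + 2) := by
      calc _ ≤ (‖γ.toFun t‖ ^ (-η) * (1 + ‖γ.toFun t‖)) * (1 + ‖γ.toFun t‖) ^ A' :=
            le_mul_of_one_le_left (by positivity) (hone t ht)
        _ = ‖γ.toFun t‖ ^ (-η) * (1 + ‖γ.toFun t‖) ^ (A' + 1) := by ring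
        _ ≤ _ := by gcongr 2; omega
    have h8 := relDist_nonneg (γ := γ) s t
    gcongr
    linarith

theorem IsLogAlong.norm_exp {ℓ : ℂ → ℂ} (hℓ : γ.IsLogAlong ℓ) (α : ℝ) {t : ℝ} (ht : 0 < t) :
    ‖exp (α * ℓ (γ.toFun t))‖ = ‖γ.toFun t‖ ^ α := by
  have h1 : Real.exp (ℓ (γ.toFun t)).re = ‖γ.toFun t‖ := by
    rw [← Complex.norm_exp, hℓ.2 _ (γ.toFun_mem_diff ht)]
  rw [Complex.norm_exp, re_ofReal_mul, ← h1, ← Real.exp_mul, mul_comm]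

/-- The difference is `e^{αℓ(t)} (e^{αΔ} - 1)`, with `Δ` the increment of `ℓ`. For small `αΔ` the
second factor is linear in it. Otherwise `|e^{αΔ}|` is a power of a ratio of comparable moduli,
hence at most `4 ^ |α|`. -/
theorem IsLogAlong.isModerate_exp {ℓ : ℂ → ℂ} (hℓ : γ.IsLogAlong ℓ) (α : ℝ) :
    γ.IsModerate α (fun w => exp (α * ℓ w)) := by
  obtain ⟨L, A, hL, hdiff⟩ := hℓ.exists_norm_sub_le
  have h4 : (1 : ℝ) ≤ 4 ^ |α| := Real.one_le_rpow (by norm_num) (abs_nonneg α)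
  refine ⟨A, 1, 1 + (4 ^ |α| + 1) * |α| * L, one_pos, le_rfl, by positivity, fun s t hst => ?_⟩
  have ht := hst.2.1
  have hx := γ.norm_pos ht
  have h1x : 1 ≤ (1 + ‖γ.toFun t‖) ^ A := one_le_pow₀ (by linarith)
  have hC : 0 ≤ (4 ^ |α| + 1) * |α| * L := by positivity
  constructor
  · rw [hℓ.norm_exp α ht]
    calc ‖γ.toFun t‖ ^ α = 1 * (‖γ.toFun t‖ ^ α * 1) := by ring
      _ ≤ _ := by gcongr; linarith
  · set Δ := ℓ (γ.toFun s) - ℓ (γ.toFun t) with hΔ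
    have h5 : exp (α * ℓ (γ.toFun s)) - exp (α * ℓ (γ.toFun t)) =
        exp (α * ℓ (γ.toFun t)) * (exp (α * Δ) - 1) := by
      rw [mul_sub, ← exp_add, mul_one]
      congr 2
      rw [hΔ]; ring
    have h6 : ‖exp (α * Δ) - 1‖ ≤ (4 ^ |α| + 1) * (|α| * ‖Δ‖) := by
      have h7 : ‖(α : ℂ) * Δ‖ = |α| * ‖Δ‖ := by rw [norm_mul, norm_real, Real.norm_eq_abs]
      rcases le_or_gt (|α| * ‖Δ‖) 1 with h | h
      · have := norm_exp_sub_one_le (x := α * Δ) (by rwa [h7])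
        rw [h7] at this
        refine this.trans ?_
        gcongr
        linarith
      · have h8 : ‖exp (α * Δ)‖ ≤ 4 ^ |α| := by
          have h9 : exp (α * Δ) = exp (α * ℓ (γ.toFun s)) / exp (α * ℓ (γ.toFun t)) := by
            rw [← exp_sub, ← mul_sub]
          rw [h9, norm_div, hℓ.norm_exp α hst.1, hℓ.norm_exp α ht, div_le_iff₀ (by positivity)]
          exact rpow_le_of_mem_annulus (by norm_num) hx (by linarith [hst.2.2.2]) hst.2.2.1 α
        have h9 := _root_.norm_sub_le (exp (α * Δ)) 1
        rw [norm_one] at h9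
        calc _ ≤ ((4 : ℝ) ^ |α| + 1) * 1 := by linarith
          _ ≤ _ := by gcongr
    have h10 := hdiff s t hst
    have h11 := relDist_nonneg (γ := γ) s t
    rw [h5, norm_mul, hℓ.norm_exp α ht, Real.rpow_one]
    calc _ ≤ ‖γ.toFun t‖ ^ α * ((4 ^ |α| + 1) * (|α| *
            (L * (1 + ‖γ.toFun t‖) ^ A * γ.relDist s t))) := by gcongr; exact h6.trans (by gcongr)
      _ = (4 ^ |α| + 1) * |α| * L * (‖γ.toFun t‖ ^ α * (1 + ‖γ.toFun t‖) ^ A) *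
            γ.relDist s t := by ring
      _ ≤ _ := by gcongr; linarith

/-! ### Integrability forces rapid decay -/

theorem exists_arc_eq {t δ : ℝ} (ht : 0 ≤ t) (hδ : 0 ≤ δ) :
    ∃ v, t ≤ v ∧ γ.arc v - γ.arc t = δ := by
  obtain ⟨M, hM, htM⟩ := ((γ.tendsto_infty.eventually_ge_atTop (γ.arc t + δ)).and
    (eventually_ge_atTop t)).exists
  have h1 : γ.arc t + δ ≤ γ.arc M := hM.trans (γ.norm_le_arc (ht.trans htM))
  obtain ⟨v, hv, hveq⟩ := intermediate_value_Icc htM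
    (γ.continuousOn_arc.mono fun x hx => ht.trans hx.1) ⟨by linarith, h1⟩
  exact ⟨v, hv.1, by rw [hveq]; ring⟩

/-- If `‖f‖ = M > 1` at a point of modulus `x ≥ 1`, the Hölder estimate keeps `‖f‖` above `M - 1/2 ≥
M/2` on an arc whose length is a negative power of `x`. The integral of `‖w ^ n f‖` over this arc is
at least a constant times `M`, so `M` is bounded by one absolute moment. -/
theorem IsModerate.exists_bound {a : ℝ} {f : ℂ → ℂ} (hf : γ.IsModerate a f)
    (hint : ∀ n : ℕ, MeasureTheory.IntegrableOn
      (fun t => γ.toFun t ^ n * f (γ.toFun t) * deriv γ.toFun t) (Ioi 0)) :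
    ∃ M : ℝ, 0 ≤ M ∧ ∀ t, 0 < t → 1 ≤ ‖γ.toFun t‖ → ‖f (γ.toFun t)‖ ≤ M := by
  obtain ⟨B, β, C, hβ, hβ1, hC, h⟩ := hf
  obtain ⟨k, hk⟩ := exists_nat_ge a
  set C' := C * 2 ^ B + 1 with hC'
  have hC'1 : 1 ≤ C' := by rw [hC']; linarith [show 0 ≤ C * 2 ^ B by positivity]
  -- The arc has length of order `x ^ (-(k + B)/β)`; this `n` makes `x ^ n` compensate it.
  obtain ⟨n, hn⟩ := exists_nat_ge ((k + B : ℕ) * β⁻¹ : ℝ)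
  set c := (2 * C') ^ (-β⁻¹) with hc
  have hc0 : 0 < c := by positivity
  set J := ∫ t in Ioi (0 : ℝ), ‖γ.toFun t ^ n * f (γ.toFun t) * deriv γ.toFun t‖ with hJ
  have hJ0 : 0 ≤ J := MeasureTheory.integral_nonneg fun _ => norm_nonneg _
  refine ⟨1 + 2 * J / c, by positivity, fun t ht ht1 => ?_⟩
  set x := ‖γ.toFun t‖
  have hx : 0 < x := by linarith
  set M := ‖f (γ.toFun t)‖
  rcases le_or_gt M 1 with hM | hM
  · have : 0 ≤ 2 * J / c := by positivity
    linarith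
  -- the length of the arc on which `f` stays large
  set δ := (2 * C' * x ^ (k + B)) ^ (-β⁻¹) with hδ
  have hbase : 1 ≤ 2 * C' * x ^ (k + B) := by
    have : 1 ≤ x ^ (k + B) := one_le_pow₀ ht1
    nlinarith
  have hδ0 : 0 < δ := by positivity
  have hδ1 : δ ≤ 1 := Real.rpow_le_one_of_one_le_of_nonpos hbase (by
    have : 0 < β⁻¹ := by positivity
    linarith)
  have hδβ : C' * x ^ (k + B) * δ ^ β = 1 / 2 := by
    rw [hδ, ← Real.rpow_mul (by positivity), neg_mul, inv_mul_cancel₀ hβ.ne', Real.rpow_neg_one]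
    field_simp
  have hδn : c ≤ x ^ n * δ := by
    rw [hδ, Real.mul_rpow (by positivity) (by positivity), ← hc]
    have h1 : 1 ≤ x ^ n * (x ^ (k + B)) ^ (-β⁻¹) := by
      rw [← Real.rpow_natCast x (k + B), ← Real.rpow_mul hx.le, ← Real.rpow_natCast x n,
        ← Real.rpow_add hx]
      refine Real.one_le_rpow ht1 ?_
      rw [mul_neg]
      linarith
    calc c = c * 1 := (mul_one c).symm
      _ ≤ c * (x ^ n * (x ^ (k + B)) ^ (-β⁻¹)) := by gcongr
      _ = _ := by ring
  obtain ⟨v, htv, hv⟩ := exists_arc_eq (γ := γ) ht.le hδ0.le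
  have hv0 : 0 < v := ht.trans_le htv
  have hlow : ∀ s ∈ Icc t v, M / 2 ≤ ‖f (γ.toFun s)‖ ∧ x ≤ ‖γ.toFun s‖ := by
    intro s hs
    have hs0 : 0 < s := ht.trans_le hs.1
    have h1 : ‖γ.toFun s - γ.toFun t‖ ≤ δ := by
      have h2 := γ.norm_sub_le_arc ht.le hs.1
      have h3 := γ.arc_le hs0.le hs.2
      linarith
    have h2 : x ≤ ‖γ.toFun s‖ := γ.norm_le_norm ht.le hs.1
    have h3 : ‖γ.toFun s‖ ≤ 4 * x := by
      have := norm_sub_norm_le (γ.toFun s) (γ.toFun t)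
      linarith
    have h4 := (h s t ⟨hs0, ht, h3, by linarith⟩).2
    have h5 : γ.relDist s t ≤ δ := by
      rw [relDist, div_le_iff₀ hx]
      nlinarith
    have h6 : x ^ a * (1 + x) ^ B ≤ 2 ^ B * x ^ (k + B) := by
      have h7 : x ^ a ≤ x ^ k := by
        rw [← Real.rpow_natCast x k]
        exact Real.rpow_le_rpow_of_exponent_le ht1 hk
      calc _ ≤ x ^ k * (2 * x) ^ B := by gcongr; linarith
        _ = _ := by rw [mul_pow, pow_add]; ring
    have h7 : ‖f (γ.toFun s) - f (γ.toFun t)‖ ≤ 1 / 2 := by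
      rw [← hδβ]
      refine h4.trans ?_
      calc _ ≤ C * (2 ^ B * x ^ (k + B)) * δ ^ β := by
            have := relDist_nonneg (γ := γ) s t
            gcongr
        _ = (C * 2 ^ B) * x ^ (k + B) * δ ^ β := by ring
        _ ≤ _ := by gcongr; rw [hC']; linarith
    have h8 := norm_sub_norm_le (f (γ.toFun t)) (f (γ.toFun s))
    rw [norm_sub_rev] at h8
    exact ⟨by linarith, h2⟩
  have hI : ∫ s in t..v, ‖γ.toFun s ^ n * f (γ.toFun s) * deriv γ.toFun s‖ ≤ J := by
    rw [intervalIntegral.integral_of_le htv]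
    exact MeasureTheory.setIntegral_mono_set (hint n).norm
      (Eventually.of_forall fun _ => norm_nonneg _)
      (Eventually.of_forall fun s hs => ht.trans hs.1)
  have hI2 : x ^ n * (M / 2) * δ ≤
      ∫ s in t..v, ‖γ.toFun s ^ n * f (γ.toFun s) * deriv γ.toFun s‖ := by
    rw [← hv, γ.arc_sub ht.le hv0.le, ← intervalIntegral.integral_const_mul]
    refine intervalIntegral.integral_mono_on htv
      ((γ.intervalIntegrable_deriv ht.le hv0.le).norm.const_mul _) ?_ fun s hs => ?_
    · rw [intervalIntegrable_iff_integrableOn_Ioc_of_le htv]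
      exact ((hint n).mono_set fun s hs => ht.trans hs.1).norm
    · obtain ⟨h1, h2⟩ := hlow s hs
      rw [norm_mul, norm_mul, norm_pow]
      gcongr
  have hfin : M * c ≤ 2 * J := by
    have : M / 2 * c ≤ M / 2 * (x ^ n * δ) := by gcongr
    linarith
  rw [← le_div_iff₀ hc0] at hfin
  linarith

theorem IsModerate.exists_pow_bound {a : ℝ} {f : ℂ → ℂ} (hf : γ.IsModerate a f)
    (hint : ∀ n : ℕ, MeasureTheory.IntegrableOn
      (fun t => γ.toFun t ^ n * f (γ.toFun t) * deriv γ.toFun t) (Ioi 0)) (n : ℕ) :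
    ∃ M : ℝ, 0 ≤ M ∧ ∀ t, 0 < t → 1 ≤ ‖γ.toFun t‖ → ‖γ.toFun t‖ ^ n * ‖f (γ.toFun t)‖ ≤ M := by
  obtain ⟨M, hM0, hM⟩ := ((isModerate_id.pow n).mul hf).exists_bound fun m => by
    have := hint (m + n)
    simpa only [pow_add, mul_assoc] using this
  exact ⟨M, hM0, fun t ht h1 => by simpa [norm_mul, norm_pow] using hM t ht h1⟩

theorem IsModerate.exists_decay {ε : ℝ} {f : ℂ → ℂ} (hf : γ.IsModerate (ε - 1) f)
    (hint : ∀ n : ℕ, MeasureTheory.IntegrableOn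
      (fun t => γ.toFun t ^ n * f (γ.toFun t) * deriv γ.toFun t) (Ioi 0)) (n : ℕ) :
    ∃ C : ℝ, 0 ≤ C ∧ ∀ t, 0 < t →
      ‖f (γ.toFun t)‖ ≤ C * ‖γ.toFun t‖ ^ (ε - 1) * ((1 + ‖γ.toFun t‖) ^ n)⁻¹ := by
  -- The additional powers offset the factor `‖w‖ ^ (ε - 1)`, which may tend to `0` at infinity.
  obtain ⟨k, hk⟩ := exists_nat_ge (1 - ε)
  obtain ⟨M, hM0, hM⟩ := hf.exists_pow_bound hint (n + k)
  obtain ⟨B, β, C, hβ, hβ1, hC, h⟩ := hf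
  refine ⟨C * 2 ^ B * 2 ^ n + M * 2 ^ n, by positivity, fun t ht => ?_⟩
  have hx := γ.norm_pos ht
  rw [← div_eq_mul_inv, le_div_iff₀ (by positivity)]
  rcases le_total ‖γ.toFun t‖ 1 with h1 | h1
  · have h2 := (h t t (Comparable.refl ht)).1
    calc _ ≤ C * (‖γ.toFun t‖ ^ (ε - 1) * (1 + ‖γ.toFun t‖) ^ B) * (1 + ‖γ.toFun t‖) ^ n := by
          gcongr
      _ ≤ C * (‖γ.toFun t‖ ^ (ε - 1) * 2 ^ B) * 2 ^ n := by gcongr <;> linarith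
      _ = (C * 2 ^ B * 2 ^ n) * ‖γ.toFun t‖ ^ (ε - 1) := by ring
      _ ≤ _ := by gcongr; linarith [show 0 ≤ M * 2 ^ n by positivity]
  · have h2 := hM t ht h1
    have h3 : 1 ≤ ‖γ.toFun t‖ ^ k * ‖γ.toFun t‖ ^ (ε - 1) := by
      rw [← Real.rpow_natCast, ← Real.rpow_add hx]
      exact Real.one_le_rpow h1 (by linarith)
    calc _ ≤ ‖f (γ.toFun t)‖ * (2 * ‖γ.toFun t‖) ^ n := by gcongr; linarith
      _ = 2 ^ n * (‖γ.toFun t‖ ^ n * ‖f (γ.toFun t)‖) * 1 := by rw [mul_pow]; ring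
      _ ≤ 2 ^ n * (‖γ.toFun t‖ ^ n * ‖f (γ.toFun t)‖) *
            (‖γ.toFun t‖ ^ k * ‖γ.toFun t‖ ^ (ε - 1)) := by gcongr
      _ = 2 ^ n * (‖γ.toFun t‖ ^ (n + k) * ‖f (γ.toFun t)‖) * ‖γ.toFun t‖ ^ (ε - 1) := by
          rw [pow_add]; ring
      _ ≤ 2 ^ n * M * ‖γ.toFun t‖ ^ (ε - 1) := by gcongr
      _ ≤ _ := by gcongr; linarith [show 0 ≤ C * 2 ^ B * 2 ^ n by positivity]

/-- The Hölder quotients must decay too. The difference is bounded both by a rapidly decreasing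
quantity and by a Hölder term growing like a power `B`. The geometric mean of the two bounds
decreases rapidly, with half the Hölder exponent. -/
theorem IsModerate.goodDensity {ε : ℝ} {f : ℂ → ℂ} (hε : 0 < ε) (hf : γ.IsModerate (ε - 1) f)
    (hint : ∀ n : ℕ, MeasureTheory.IntegrableOn
      (fun t => γ.toFun t ^ n * f (γ.toFun t) * deriv γ.toFun t) (Ioi 0)) : γ.GoodDensity f := by
  have hdecay := hf.exists_decay hint
  obtain ⟨B, β, C, hβ, hβ1, hC, h⟩ := hf
  refine ⟨by simpa using hint 0, β / 2, ε, by positivity, by linarith, hε, fun n => ?_⟩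
  obtain ⟨C₁, hC₁, h₁⟩ := hdecay n
  -- In the geometric mean the `B` orders cancel the growth of the Hölder term and the square root
  -- of the remaining `2 * n` orders leaves `n`.
  obtain ⟨C₂, hC₂, h₂⟩ := hdecay (2 * n + B)
  set C₃ := C₂ * (4 ^ |ε - 1| * 4 ^ (2 * n + B) + 1) with hC₃
  have hC₃0 : 0 ≤ C₃ := by positivity
  refine ⟨C₁ + √(C₃ * C), by positivity, fun s t hs ht hst hts => ⟨?_, ?_⟩⟩
  · refine (h₁ t ht).trans ?_
    gcongr
    linarith [Real.sqrt_nonneg (C₃ * C)]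
  · have hx := γ.norm_pos ht
    have hy := γ.norm_pos hs
    have hX := relDist_nonneg (γ := γ) s t
    set E := ‖γ.toFun t‖ ^ (ε - 1) with hE
    set q := 1 + ‖γ.toFun t‖ with hq
    have hq0 : 0 < q := by positivity
    have hE0 : 0 ≤ E := by positivity
    have k1 := (h s t ⟨hs, ht, hst, hts⟩).2
    have k2 : ‖f (γ.toFun s) - f (γ.toFun t)‖ ≤ C₃ * E * (q ^ (2 * n + B))⁻¹ := by
      have k3 : ‖f (γ.toFun s)‖ ≤ C₂ * (4 ^ |ε - 1| * E) * (4 ^ (2 * n + B) *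
          (q ^ (2 * n + B))⁻¹) := by
        refine (h₂ s hs).trans ?_
        gcongr
        · exact rpow_le_of_mem_annulus (by norm_num) hx (by linarith) hst _
        · rw [inv_le_comm₀ (by positivity) (by positivity), mul_inv, inv_inv, ← inv_pow, ← mul_pow]
          gcongr
          rw [hq]
          linarith
      have k4 := h₂ t ht
      calc _ ≤ _ := (norm_sub_le _ _).trans (add_le_add k3 k4)
        _ = _ := by rw [hC₃]; ring
    have hmain : ‖f (γ.toFun s) - f (γ.toFun t)‖ ≤
        √(C₃ * C) * E * (q ^ n)⁻¹ * γ.relDist s t ^ (β / 2) := by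
      rw [← pow_le_pow_iff_left₀ (norm_nonneg _) (by positivity) two_ne_zero]
      have k5 : (γ.relDist s t ^ (β / 2)) ^ 2 = γ.relDist s t ^ β := by
        rw [← Real.rpow_mul_natCast hX]; congr 1; push_cast; ring
      rw [mul_pow, k5, mul_pow, mul_pow, Real.sq_sqrt (by positivity), sq]
      calc _ ≤ (C₃ * E * (q ^ (2 * n + B))⁻¹) * (C * (E * q ^ B) * γ.relDist s t ^ β) := by
            gcongr
        _ = _ := by
            rw [pow_add, pow_mul]
            field_simp
            ring_nf
    refine hmain.trans ?_
    rw [← relDist]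
    gcongr
    linarith

/-! ### Laguerre type entries -/

theorem exists_isModerate_term {ℓ h : ℂ → ℂ} (hℓ : γ.IsLogAlong ℓ) (hh : γ.IsModerate 0 h)
    {α : ℝ} (hα : -1 < α) (p : ℕ) :
    ∃ ε : ℝ, 0 < ε ∧ γ.IsModerate (ε - 1) (fun w => h w * exp (α * ℓ w) * ℓ w ^ p) := by
  -- The `p` logarithms together lose at most half of the margin `α + 1`.
  set η := min 1 ((α + 1) / (2 * (p + 1))) with hη
  have hα1 : 0 < α + 1 := by linarith
  have hη0 : 0 < η := lt_min one_pos (by positivity)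
  have hη2 : η * p ≤ (α + 1) / 2 := by
    have h1 : η ≤ (α + 1) / (2 * (p + 1)) := min_le_right _ _
    rw [le_div_iff₀ (by positivity)] at h1
    nlinarith
  refine ⟨(α + 1) / 2, by positivity, ?_⟩
  refine ((hh.mul (hℓ.isModerate_exp α)).mul
    ((hℓ.isModerate hη0 (min_le_left _ _)).pow p)).mono ?_
  linarith

theorem exists_isModerate_sum {ι : Type*} (S : Finset ι) {f : ι → ℂ → ℂ}
    (hf : ∀ i ∈ S, ∃ ε : ℝ, 0 < ε ∧ γ.IsModerate (ε - 1) (f i)) :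
    ∃ ε : ℝ, 0 < ε ∧ γ.IsModerate (ε - 1) (fun w => ∑ i ∈ S, f i w) := by
  classical
  induction S using Finset.induction_on with
  | empty => exact ⟨1, one_pos, by simpa using isModerate_const (γ := γ) 0⟩
  | insert i S hi ih =>
    obtain ⟨ε₁, h1, h2⟩ := hf i (Finset.mem_insert_self i S)
    obtain ⟨ε₂, k1, k2⟩ := ih fun j hj => hf j (Finset.mem_insert_of_mem hj)
    refine ⟨min ε₁ ε₂, lt_min h1 k1, ?_⟩
    simp only [Finset.sum_insert hi]
    exact (h2.mono (sub_le_sub_right (min_le_left _ _) _)).add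
      (k2.mono (sub_le_sub_right (min_le_right _ _) _))

end LaguerreCurve

theorem IsLaguerreType.exists_isModerate {N : ℕ} {γ : LaguerreCurve}
    {W : ℂ → Matrix (Fin N) (Fin N) ℂ} (hW : IsLaguerreType γ W) (j k : Fin N) :
    ∃ ε : ℝ, 0 < ε ∧ γ.IsModerate (ε - 1) (fun w => W w j k) := by
  obtain ⟨ℓ, hℓ, hW⟩ := hW
  obtain ⟨M, h, α, p, hα, hholder, hbd, -, heq⟩ := hW j k
  obtain ⟨ε, hε, hmod⟩ := LaguerreCurve.exists_isModerate_sum (γ := γ) Finset.univ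
    (f := fun m w => h m w * exp (α m * ℓ w) * ℓ w ^ p m) (fun m _ => by
      obtain ⟨K, β, hβ, hβ1, hh⟩ := hholder m
      obtain ⟨B, hB⟩ := hbd m
      exact LaguerreCurve.exists_isModerate_term hℓ
        (LaguerreCurve.isModerate_of_holder hβ hβ1 hh hB) (hα m) (p m))
  exact ⟨ε, hε, hmod.congr fun t ht => heq _ (γ.toFun_mem_diff ht)⟩

/-! ### Pairings of matrix polynomials in terms of moments -/

variable {N : ℕ}

theorem evalAt_eq_sum {P : (Matrix (Fin N) (Fin N) ℂ)[X]} {n : ℕ} (hP : P.natDegree ≤ n) (z : ℂ) :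
    evalAt P z = ∑ j ∈ Finset.range (n + 1), z ^ j • P.coeff j := by
  rw [evalAt, eval_eq_sum_range' (Nat.lt_succ_of_le hP)]
  refine Finset.sum_congr rfl fun j _ => ?_
  rw [← map_pow, ← Matrix.scalar_commute _ (fun r => Commute.all _ r), Matrix.scalar_apply,
    ← Matrix.smul_eq_diagonal_mul]

theorem weightMoment_apply (γ : LaguerreCurve) (W : ℂ → Matrix (Fin N) (Fin N) ℂ) (n : ℕ)
    (a b : Fin N) : weightMoment γ W n a b = (2 * Real.pi * I)⁻¹ *
      ∫ t in Ioi (0 : ℝ), γ.toFun t ^ n * W (γ.toFun t) a b * deriv γ.toFun t := rfl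

theorem left_pairing_eq_sum {γ : LaguerreCurve} {W : ℂ → Matrix (Fin N) (Fin N) ℂ}
    (hreg : IsRegularWeight γ W) {P : (Matrix (Fin N) (Fin N) ℂ)[X]} {n : ℕ}
    (hP : P.natDegree ≤ n) (k : ℕ) :
    (2 * Real.pi * I)⁻¹ • γ.integral (fun z => z ^ k • (evalAt P z * W z)) =
      ∑ j ∈ Finset.range (n + 1), P.coeff j * weightMoment γ W (j + k) := by
  ext a b
  simp only [Matrix.smul_apply, LaguerreCurve.integral, Matrix.of_apply, Matrix.sum_apply,
    Matrix.mul_apply, weightMoment_apply, smul_eq_mul]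
  have h1 : ∀ t, γ.toFun t ^ k * (∑ c, evalAt P (γ.toFun t) a c * W (γ.toFun t) c b)
      * deriv γ.toFun t = ∑ j ∈ Finset.range (n + 1), ∑ c, P.coeff j a c *
        (γ.toFun t ^ (j + k) * W (γ.toFun t) c b * deriv γ.toFun t) := by
    intro t
    rw [evalAt_eq_sum hP, Finset.sum_comm, Finset.mul_sum, Finset.sum_mul]
    refine Finset.sum_congr rfl fun c _ => ?_
    rw [Matrix.sum_apply, Finset.sum_mul, Finset.mul_sum, Finset.sum_mul]
    refine Finset.sum_congr rfl fun j _ => ?_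
    rw [Matrix.smul_apply, smul_eq_mul, pow_add]
    ring
  simp only [h1]
  rw [MeasureTheory.integral_finsetSum _ fun j _ => MeasureTheory.integrable_finsetSum _ fun c _ =>
    (hreg.integrable (j + k) c b).const_mul _, Finset.mul_sum]
  refine Finset.sum_congr rfl fun j _ => ?_
  rw [MeasureTheory.integral_finsetSum _ fun c _ =>
    (hreg.integrable (j + k) c b).const_mul _, Finset.mul_sum]
  refine Finset.sum_congr rfl fun c _ => ?_
  rw [MeasureTheory.integral_const_mul]
  ring

theorem right_pairing_eq_sum {γ : LaguerreCurve} {W : ℂ → Matrix (Fin N) (Fin N) ℂ}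
    (hreg : IsRegularWeight γ W) {P : (Matrix (Fin N) (Fin N) ℂ)[X]} {n : ℕ}
    (hP : P.natDegree ≤ n) (k : ℕ) :
    (2 * Real.pi * I)⁻¹ • γ.integral (fun z => z ^ k • (W z * evalAt P z)) =
      ∑ j ∈ Finset.range (n + 1), weightMoment γ W (k + j) * P.coeff j := by
  ext a b
  simp only [Matrix.smul_apply, LaguerreCurve.integral, Matrix.of_apply, Matrix.sum_apply,
    Matrix.mul_apply, weightMoment_apply, smul_eq_mul]
  have h1 : ∀ t, γ.toFun t ^ k * (∑ c, W (γ.toFun t) a c * evalAt P (γ.toFun t) c b)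
      * deriv γ.toFun t = ∑ j ∈ Finset.range (n + 1), ∑ c, P.coeff j c b *
        (γ.toFun t ^ (k + j) * W (γ.toFun t) a c * deriv γ.toFun t) := by
    intro t
    rw [evalAt_eq_sum hP, Finset.sum_comm, Finset.mul_sum, Finset.sum_mul]
    refine Finset.sum_congr rfl fun c _ => ?_
    rw [Matrix.sum_apply, Finset.mul_sum, Finset.mul_sum, Finset.sum_mul]
    refine Finset.sum_congr rfl fun j _ => ?_
    rw [Matrix.smul_apply, smul_eq_mul, pow_add]
    ring
  simp only [h1]
  rw [MeasureTheory.integral_finsetSum _ fun j _ => MeasureTheory.integrable_finsetSum _ fun c _ =>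
    (hreg.integrable (k + j) a c).const_mul _, Finset.mul_sum]
  refine Finset.sum_congr rfl fun j _ => ?_
  rw [MeasureTheory.integral_finsetSum _ fun c _ =>
    (hreg.integrable (k + j) a c).const_mul _, Finset.mul_sum]
  refine Finset.sum_congr rfl fun c _ => ?_
  rw [MeasureTheory.integral_const_mul]
  ring

/-! ### Block rows and block columns -/

/-- The first `n + 1` members of a sequence of matrices as a block row. -/
def blockRow (n : ℕ) (p : ℕ → Matrix (Fin N) (Fin N) ℂ) :
    Matrix (Fin N) (Fin (n + 1) × Fin N) ℂ := Matrix.of fun a x => p x.1 a x.2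

/-- The first `n + 1` members of a sequence of matrices as a block column. -/
def blockCol (n : ℕ) (p : ℕ → Matrix (Fin N) (Fin N) ℂ) :
    Matrix (Fin (n + 1) × Fin N) (Fin N) ℂ := Matrix.of fun x b => p x.1 x.2 b

/-- The sequence of matrices with the single nonzero member `X` at position `n`. -/
def singleSeq (n : ℕ) (X : Matrix (Fin N) (Fin N) ℂ) : ℕ → Matrix (Fin N) (Fin N) ℂ :=
  fun k => if n = k then X else 0

/-- The block row `[0 ⋯ 0 I]`. -/
abbrev lastRow (N n : ℕ) : Matrix (Fin N) (Fin (n + 1) × Fin N) ℂ := blockRow n (singleSeq n 1)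

/-- The block column `[0 ⋯ 0 I]ᵀ`. -/
abbrev lastCol (N n : ℕ) : Matrix (Fin (n + 1) × Fin N) (Fin N) ℂ := blockCol n (singleSeq n 1)

theorem blockRow_injOn {n : ℕ} {p q : ℕ → Matrix (Fin N) (Fin N) ℂ}
    (h : blockRow n p = blockRow n q) {k : ℕ} (hk : k ≤ n) : p k = q k := by
  ext a b
  have := congrFun (congrFun h a) (⟨k, Nat.lt_succ_of_le hk⟩, b)
  simpa [blockRow] using this

theorem blockCol_injOn {n : ℕ} {p q : ℕ → Matrix (Fin N) (Fin N) ℂ}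
    (h : blockCol n p = blockCol n q) {k : ℕ} (hk : k ≤ n) : p k = q k := by
  ext a b
  have := congrFun (congrFun h (⟨k, Nat.lt_succ_of_le hk⟩, a)) b
  simpa [blockCol] using this

theorem blockRow_congr {n : ℕ} {p q : ℕ → Matrix (Fin N) (Fin N) ℂ} (h : ∀ k ≤ n, p k = q k) :
    blockRow n p = blockRow n q := by
  ext a x
  simp [blockRow, h x.1 (Nat.le_of_lt_succ x.1.2)]

theorem blockCol_congr {n : ℕ} {p q : ℕ → Matrix (Fin N) (Fin N) ℂ} (h : ∀ k ≤ n, p k = q k) :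
    blockCol n p = blockCol n q := by
  ext x b
  simp [blockCol, h x.1 (Nat.le_of_lt_succ x.1.2)]

theorem blockRow_mul_hankel (γ : LaguerreCurve) (W : ℂ → Matrix (Fin N) (Fin N) ℂ) (n : ℕ)
    (p : ℕ → Matrix (Fin N) (Fin N) ℂ) : blockRow n p * blockHankel γ W n =
      blockRow n fun k => ∑ j ∈ Finset.range (n + 1), p j * weightMoment γ W (j + k) := by
  ext a x
  simp only [Matrix.mul_apply, blockRow, blockHankel, Matrix.of_apply, Fintype.sum_prod_type,
    Matrix.sum_apply, Finset.sum_range]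

theorem hankel_mul_blockCol (γ : LaguerreCurve) (W : ℂ → Matrix (Fin N) (Fin N) ℂ) (n : ℕ)
    (p : ℕ → Matrix (Fin N) (Fin N) ℂ) : blockHankel γ W n * blockCol n p =
      blockCol n fun k => ∑ j ∈ Finset.range (n + 1), weightMoment γ W (k + j) * p j := by
  ext x b
  simp only [Matrix.mul_apply, blockCol, blockHankel, Matrix.of_apply, Fintype.sum_prod_type,
    Matrix.sum_apply, Finset.sum_range]

theorem blockRow_mul_blockCol (n : ℕ) (p q : ℕ → Matrix (Fin N) (Fin N) ℂ) :
    blockRow n p * blockCol n q = ∑ j ∈ Finset.range (n + 1), p j * q j := by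
  ext a b
  simp only [Matrix.mul_apply, blockCol, blockRow, Matrix.of_apply, Fintype.sum_prod_type,
    Matrix.sum_apply, Finset.sum_range]

theorem blockRow_mul_single (n : ℕ) (p : ℕ → Matrix (Fin N) (Fin N) ℂ) :
    blockRow n p * lastCol N n = p n := by
  rw [blockRow_mul_blockCol, Finset.sum_eq_single_of_mem n (Finset.self_mem_range_succ n)]
  · simp [singleSeq]
  · intro j _ hj
    simp [singleSeq, hj.symm]

theorem single_mul_blockCol (n : ℕ) (p : ℕ → Matrix (Fin N) (Fin N) ℂ) :
    lastRow N n * blockCol n p = p n := by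
  rw [blockRow_mul_blockCol, Finset.sum_eq_single_of_mem n (Finset.self_mem_range_succ n)]
  · simp [singleSeq]
  · intro j _ hj
    simp [singleSeq, hj.symm]

theorem mul_blockRow (n : ℕ) (X : Matrix (Fin N) (Fin N) ℂ) (p : ℕ → Matrix (Fin N) (Fin N) ℂ) :
    X * blockRow n p = blockRow n fun k => X * p k := by
  ext a x
  simp [Matrix.mul_apply, blockRow]

theorem blockCol_mul (n : ℕ) (X : Matrix (Fin N) (Fin N) ℂ) (p : ℕ → Matrix (Fin N) (Fin N) ℂ) :
    blockCol n p * X = blockCol n fun k => p k * X := by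
  ext x b
  simp [Matrix.mul_apply, blockCol]

theorem blockRow_singleSeq (n : ℕ) (X : Matrix (Fin N) (Fin N) ℂ) :
    blockRow n (singleSeq n X) = X * lastRow N n := by
  rw [mul_blockRow]
  congr 1; ext k : 1
  by_cases h : n = k <;> simp [singleSeq, h]

theorem blockCol_singleSeq (n : ℕ) (X : Matrix (Fin N) (Fin N) ℂ) :
    blockCol n (singleSeq n X) = lastCol N n * X := by
  rw [blockCol_mul]
  congr 1; ext k : 1
  by_cases h : n = k <;> simp [singleSeq, h]

theorem exists_blockRow_eq {n : ℕ} (M : Matrix (Fin N) (Fin (n + 1) × Fin N) ℂ) :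
    ∃ p : ℕ → Matrix (Fin N) (Fin N) ℂ, (∀ k, n < k → p k = 0) ∧ blockRow n p = M := by
  refine ⟨fun k => if h : k < n + 1 then Matrix.of fun a b => M a (⟨k, h⟩, b) else 0,
    fun k hk => dif_neg (by omega), ?_⟩
  ext a x
  simp [blockRow, Nat.le_of_lt_succ x.1.2]

theorem exists_blockCol_eq {n : ℕ} (M : Matrix (Fin (n + 1) × Fin N) (Fin N) ℂ) :
    ∃ p : ℕ → Matrix (Fin N) (Fin N) ℂ, (∀ k, n < k → p k = 0) ∧ blockCol n p = M := by
  refine ⟨fun k => if h : k < n + 1 then Matrix.of fun a b => M (⟨k, h⟩, a) b else 0,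
    fun k hk => dif_neg (by omega), ?_⟩
  ext x b
  simp [blockCol, Nat.le_of_lt_succ x.1.2]

/-- The last diagonal block of the inverse of the block Hankel matrix. -/
noncomputable def hankelCorner (γ : LaguerreCurve) (W : ℂ → Matrix (Fin N) (Fin N) ℂ) (n : ℕ) :
    Matrix (Fin N) (Fin N) ℂ :=
  lastRow N n * (blockHankel γ W n)⁻¹ * lastCol N n

/-- If `v` annihilates the corner, the row `u = [0 ⋯ 0 v] H⁻¹` has vanishing last block. As `u H =
[0 ⋯ 0 v]`, the truncated row is annihilated by the Hankel matrix one size smaller and so vanishes.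
Thus `u = 0` and `v = 0`. For `n = 0` the last block is all of `u`. -/
theorem isUnit_det_hankelCorner {γ : LaguerreCurve} {W : ℂ → Matrix (Fin N) (Fin N) ℂ}
    (hreg : IsRegularWeight γ W) (n : ℕ) : IsUnit (hankelCorner γ W n).det := by
  rw [isUnit_iff_ne_zero]
  intro hdet
  obtain ⟨v, hv, hv0⟩ := Matrix.exists_vecMul_eq_zero_iff.2 hdet
  apply hv
  have hunit : IsUnit (blockHankel γ W n).det := isUnit_iff_ne_zero.2 (hreg.det_ne_zero n)
  set u : Fin (n + 1) × Fin N → ℂ :=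
    Matrix.vecMul (Matrix.vecMul v (lastRow N n)) (blockHankel γ W n)⁻¹ with hu
  have hulast : ∀ x : Fin (n + 1) × Fin N, (x.1 : ℕ) = n → u x = 0 := by
    intro x hx
    have h1 : Matrix.vecMul u (lastCol N n) = 0 := by
      rw [hu, Matrix.vecMul_vecMul, Matrix.vecMul_vecMul, ← Matrix.mul_assoc]
      exact hv0
    have h2 := congrFun h1 x.2
    rw [Pi.zero_apply] at h2
    rw [← h2, Matrix.vecMul, dotProduct, Finset.sum_eq_single x]
    · simp [blockCol, singleSeq, hx]
    · intro y _ hy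
      by_cases h3 : n = y.1
      · have h4 : y.1 = x.1 := Fin.ext (h3.symm.trans hx.symm)
        have h5 : y.2 ≠ x.2 := fun h5 => hy (Prod.ext h4 h5)
        simp [blockCol, singleSeq, h3, Matrix.one_apply_ne h5]
      · simp [blockCol, singleSeq, h3]
    · simp
  have huH : Matrix.vecMul u (blockHankel γ W n) =
      Matrix.vecMul v (lastRow N n) := by
    rw [hu, Matrix.vecMul_vecMul, Matrix.nonsing_inv_mul _ hunit, Matrix.vecMul_one]
  have hu0 : u = 0 := by
    cases n with
    | zero =>
      funext x
      exact hulast x (by omega)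
    | succ n =>
      set u' : Fin (n + 1) × Fin N → ℂ := fun x => u (x.1.castSucc, x.2) with hu'
      have h1 : Matrix.vecMul u' (blockHankel γ W n) = 0 := by
        funext x
        have h2 := congrFun huH (x.1.castSucc, x.2)
        have h3 : Matrix.vecMul v (lastRow N (n + 1))
            (x.1.castSucc, x.2) = 0 := by
          rw [Matrix.vecMul, dotProduct]
          refine Finset.sum_eq_zero fun a _ => ?_
          have : n + 1 ≠ (x.1 : ℕ) := by omega
          simp [blockRow, singleSeq, this]
        rw [h3, Matrix.vecMul, dotProduct, Fintype.sum_prod_type, Fin.sum_univ_castSucc] at h2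
        have h4 : ∑ c, u (Fin.last (n + 1), c) *
            blockHankel γ W (n + 1) (Fin.last (n + 1), c) (x.1.castSucc, x.2) = 0 :=
          Finset.sum_eq_zero fun c _ => by rw [hulast (Fin.last (n + 1), c) (by simp), zero_mul]
        rw [h4, add_zero] at h2
        rw [Matrix.vecMul, dotProduct, Fintype.sum_prod_type, Pi.zero_apply, ← h2]
        rfl
      have h2 : u' = 0 := by
        by_contra h
        exact hreg.det_ne_zero n (Matrix.exists_vecMul_eq_zero_iff.1 ⟨u', h, h1⟩)
      funext x
      rcases Fin.eq_castSucc_or_eq_last x.1 with ⟨j, hj⟩ | hj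
      · have := congrFun h2 (j, x.2)
        simp only [hu', ← hj] at this
        exact this
      · exact hulast x (by rw [hj]; rfl)
  rw [hu0, Matrix.zero_vecMul] at huH
  funext b
  have h1 := congrFun huH.symm (Fin.last n, b)
  rw [Matrix.vecMul, dotProduct, Finset.sum_eq_single b] at h1
  · simpa [blockRow, singleSeq] using h1
  · intro a _ hab
    simp [blockRow, singleSeq, Matrix.one_apply_ne hab]
  · simp

/-- Orthogonality reads `p H = C⁻¹ [0 ⋯ 0 I]`. Solving for `p` and reading off its last block, which
is `I`, gives `C`. The right system leads to the same corner, so one `C` serves both. -/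
theorem isBiorthogonalSystem_iff {γ : LaguerreCurve} {W : ℂ → Matrix (Fin N) (Fin N) ℂ}
    (hreg : IsRegularWeight γ W) {PL PR : ℕ → (Matrix (Fin N) (Fin N) ℂ)[X]}
    {C : ℕ → Matrix (Fin N) (Fin N) ℂ} : IsBiorthogonalSystem γ W PL PR C ↔
      ∀ n, (PL n).natDegree ≤ n ∧ (PR n).natDegree ≤ n ∧ C n = hankelCorner γ W n ∧
        blockRow n (PL n).coeff = (hankelCorner γ W n)⁻¹ *
          (lastRow N n * (blockHankel γ W n)⁻¹) ∧
        blockCol n (PR n).coeff = (blockHankel γ W n)⁻¹ * lastCol N n *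
          (hankelCorner γ W n)⁻¹ := by
  have hH : ∀ n, IsUnit (blockHankel γ W n).det := fun n =>
    isUnit_iff_ne_zero.2 (hreg.det_ne_zero n)
  have hG := isUnit_det_hankelCorner hreg
  constructor
  · intro h n
    have hl : blockRow n (PL n).coeff * blockHankel γ W n =
        (C n)⁻¹ * lastRow N n := by
      rw [blockRow_mul_hankel, ← blockRow_singleSeq]
      refine blockRow_congr fun k hk => ?_
      rw [← left_pairing_eq_sum hreg (h.monic_left n).1, h.orthogonal_left n k hk]
      rfl
    have hr : blockHankel γ W n * blockCol n (PR n).coeff =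
        lastCol N n * (C n)⁻¹ := by
      rw [hankel_mul_blockCol, ← blockCol_singleSeq]
      refine blockCol_congr fun k hk => ?_
      rw [← right_pairing_eq_sum hreg (h.monic_right n).1, h.orthogonal_right n k hk]
      rfl
    have hl' : blockRow n (PL n).coeff =
        (C n)⁻¹ * (lastRow N n * (blockHankel γ W n)⁻¹) := by
      rw [← Matrix.mul_assoc, ← hl, Matrix.mul_nonsing_inv_cancel_right _ _ (hH n)]
    have hr' : blockCol n (PR n).coeff =
        (blockHankel γ W n)⁻¹ * lastCol N n * (C n)⁻¹ := by
      rw [Matrix.mul_assoc, ← hr, Matrix.nonsing_inv_mul_cancel_left _ _ (hH n)]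
    have hC : C n = hankelCorner γ W n := by
      have h1 : (C n)⁻¹ * hankelCorner γ W n = 1 := by
        rw [hankelCorner, ← Matrix.mul_assoc, ← hl', blockRow_mul_single, (h.monic_left n).2]
      calc C n = C n * ((C n)⁻¹ * hankelCorner γ W n) := by rw [h1, Matrix.mul_one]
        _ = _ := Matrix.mul_nonsing_inv_cancel_left _ _ (h.nonsingular n)
    rw [hC] at hl' hr'
    exact ⟨(h.monic_left n).1, (h.monic_right n).1, hC, hl', hr'⟩
  · intro h
    refine ⟨fun n => ⟨(h n).1, ?_⟩, fun n => ⟨(h n).2.1, ?_⟩, fun n => ?_, fun n k hk => ?_,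
      fun n k hk => ?_⟩
    · rw [← blockRow_mul_single n (PL n).coeff, (h n).2.2.2.1, Matrix.mul_assoc]
      exact Matrix.nonsing_inv_mul _ (hG n)
    · rw [← single_mul_blockCol n (PR n).coeff, (h n).2.2.2.2, ← Matrix.mul_assoc,
        ← Matrix.mul_assoc]
      exact Matrix.mul_nonsing_inv _ (hG n)
    · rw [(h n).2.2.1]; exact hG n
    · rw [left_pairing_eq_sum hreg (h n).1]
      refine blockRow_injOn (p := fun k => ∑ j ∈ Finset.range (n + 1),
        (PL n).coeff j * weightMoment γ W (j + k)) (q := singleSeq n (C n)⁻¹) ?_ hk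
      rw [← blockRow_mul_hankel, blockRow_singleSeq, (h n).2.2.2.1, (h n).2.2.1, Matrix.mul_assoc,
        Matrix.nonsing_inv_mul_cancel_right _ _ (hH n)]
    · rw [right_pairing_eq_sum hreg (h n).2.1]
      refine blockCol_injOn (p := fun k => ∑ j ∈ Finset.range (n + 1),
        weightMoment γ W (k + j) * (PR n).coeff j) (q := singleSeq n (C n)⁻¹) ?_ hk
      rw [← hankel_mul_blockCol, blockCol_singleSeq, (h n).2.2.2.2, (h n).2.2.1,
        ← Matrix.mul_assoc, Matrix.mul_nonsing_inv_cancel_left _ _ (hH n)]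

theorem exists_natDegree_le_coeff_eq {n : ℕ} (p : ℕ → Matrix (Fin N) (Fin N) ℂ)
    (hp : ∀ k, n < k → p k = 0) :
    ∃ P : (Matrix (Fin N) (Fin N) ℂ)[X], P.natDegree ≤ n ∧ P.coeff = p := by
  have hc : ∀ k, (∑ j ∈ Finset.range (n + 1), monomial j (p j)).coeff k = p k := by
    intro k
    rw [finsetSum_coeff]
    simp only [coeff_monomial]
    rw [Finset.sum_ite_eq' (Finset.range (n + 1)) k p]
    split_ifs with h
    · rfl
    · exact (hp k (by simpa using h)).symm
  refine ⟨∑ j ∈ Finset.range (n + 1), monomial j (p j), ?_, funext hc⟩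
  rw [natDegree_le_iff_coeff_eq_zero]
  intro k hk
  rw [hc, hp k hk]

theorem existsUnique_biorthogonalSystem {γ : LaguerreCurve} {W : ℂ → Matrix (Fin N) (Fin N) ℂ}
    (hreg : IsRegularWeight γ W) :
    ∃! S : (ℕ → (Matrix (Fin N) (Fin N) ℂ)[X]) × (ℕ → (Matrix (Fin N) (Fin N) ℂ)[X]) ×
        (ℕ → Matrix (Fin N) (Fin N) ℂ), IsBiorthogonalSystem γ W S.1 S.2.1 S.2.2 := by
  have hL : ∀ n, ∃ P : (Matrix (Fin N) (Fin N) ℂ)[X], P.natDegree ≤ n ∧ blockRow n P.coeff =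
      (hankelCorner γ W n)⁻¹ * (lastRow N n * (blockHankel γ W n)⁻¹) := by
    intro n
    obtain ⟨p, hp, hpM⟩ := exists_blockRow_eq ((hankelCorner γ W n)⁻¹ *
      (lastRow N n * (blockHankel γ W n)⁻¹))
    obtain ⟨P, hP, rfl⟩ := exists_natDegree_le_coeff_eq p hp
    exact ⟨P, hP, hpM⟩
  have hR : ∀ n, ∃ P : (Matrix (Fin N) (Fin N) ℂ)[X], P.natDegree ≤ n ∧ blockCol n P.coeff =
      (blockHankel γ W n)⁻¹ * lastCol N n * (hankelCorner γ W n)⁻¹ := by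
    intro n
    obtain ⟨p, hp, hpM⟩ := exists_blockCol_eq ((blockHankel γ W n)⁻¹ *
      lastCol N n * (hankelCorner γ W n)⁻¹)
    obtain ⟨P, hP, rfl⟩ := exists_natDegree_le_coeff_eq p hp
    exact ⟨P, hP, hpM⟩
  choose PL hPL1 hPL2 using hL
  choose PR hPR1 hPR2 using hR
  refine ⟨(PL, PR, hankelCorner γ W), (isBiorthogonalSystem_iff hreg).2 fun n =>
    ⟨hPL1 n, hPR1 n, rfl, hPL2 n, hPR2 n⟩, ?_⟩
  rintro ⟨PL', PR', C'⟩ h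
  rw [isBiorthogonalSystem_iff hreg] at h
  have h1 : PL' = PL := by
    funext n
    obtain ⟨hd, -, -, hrow, -⟩ := h n
    ext k : 1
    rcases le_or_gt k n with hk | hk
    · exact blockRow_injOn (hrow.trans (hPL2 n).symm) hk
    · rw [coeff_eq_zero_of_natDegree_lt (hd.trans_lt hk),
        coeff_eq_zero_of_natDegree_lt ((hPL1 n).trans_lt hk)]
  have h2 : PR' = PR := by
    funext n
    obtain ⟨-, hd, -, -, hcol⟩ := h n
    ext k : 1
    rcases le_or_gt k n with hk | hk
    · exact blockCol_injOn (hcol.trans (hPR2 n).symm) hk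
    · rw [coeff_eq_zero_of_natDegree_lt (hd.trans_lt hk),
        coeff_eq_zero_of_natDegree_lt ((hPR1 n).trans_lt hk)]
  have h3 : C' = hankelCorner γ W := funext fun n => (h n).2.2.1
  rw [h1, h2, h3]

namespace LaguerreCurve

variable {γ : LaguerreCurve}

/-! ### Asymptotic expansions at infinity -/

/-- `f(z) ~ ∑ c_j z^{-j}` as `z → ∞` in `ℂ \ γ`, in the sense of Poincaré. -/
def HasExpansion (γ : LaguerreCurve) (f : ℂ → ℂ) (c : ℕ → ℂ) : Prop :=
  ∀ m : ℕ, (fun z => f z - ∑ j ∈ Finset.range (m + 1), (z ^ j)⁻¹ * c j)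
    =O[γ.atInfty] fun z => (z ^ (m + 1))⁻¹

theorem HasExpansion.congr {f g : ℂ → ℂ} {c : ℕ → ℂ} (hf : γ.HasExpansion f c)
    (h : ∀ z ∈ γ.supportᶜ, g z = f z) : γ.HasExpansion g c := by
  refine fun m => (hf m).congr' ?_ EventuallyEq.rfl
  filter_upwards [compl_support_mem_atInfty] with z hz
  rw [h z hz]

theorem HasExpansion.add {f g : ℂ → ℂ} {c d : ℕ → ℂ} (hf : γ.HasExpansion f c)
    (hg : γ.HasExpansion g d) : γ.HasExpansion (fun z => f z + g z) (fun j => c j + d j) := by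
  refine fun m => ((hf m).add (hg m)).congr_left fun z => ?_
  simp only [mul_add, Finset.sum_add_distrib]
  ring

theorem HasExpansion.const_mul {f : ℂ → ℂ} {c : ℕ → ℂ} (hf : γ.HasExpansion f c) (a : ℂ) :
    γ.HasExpansion (fun z => a * f z) (fun j => a * c j) := by
  refine fun m => ((hf m).const_mul_left a).congr_left fun z => ?_
  rw [mul_sub, Finset.mul_sum]
  simp only [mul_left_comm]

theorem hasExpansion_zero : γ.HasExpansion (fun _ => 0) (fun _ => 0) := fun m => by
  simpa using Asymptotics.isBigO_zero _ _

theorem HasExpansion.sum {ι : Type*} (S : Finset ι) {f : ι → ℂ → ℂ} {c : ι → ℕ → ℂ}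
    (h : ∀ i ∈ S, γ.HasExpansion (f i) (c i)) :
    γ.HasExpansion (fun z => ∑ i ∈ S, f i z) (fun j => ∑ i ∈ S, c i j) := by
  classical
  induction S using Finset.induction_on with
  | empty => simpa using hasExpansion_zero
  | insert i S hi ih =>
    simp only [Finset.sum_insert hi]
    exact (h i (Finset.mem_insert_self i S)).add
      (ih fun k hk => h k (Finset.mem_insert_of_mem hk))

theorem hasExpansion_inv_pow (k : ℕ) :
    γ.HasExpansion (fun z => (z ^ k)⁻¹) (fun j => if j = k then 1 else 0) := by
  intro m
  simp only [mul_ite, mul_one, mul_zero, Finset.sum_ite_eq', Finset.mem_range]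
  split_ifs with h
  · simpa using Asymptotics.isBigO_zero _ _
  · refine Asymptotics.IsBigO.of_bound 1 ?_
    filter_upwards [one_le_norm_mem_atInfty] with z hz
    rw [sub_zero, norm_inv, norm_inv, norm_pow, norm_pow, one_mul]
    exact inv_anti₀ (by have : 0 < ‖z‖ := one_pos.trans_le hz
                        positivity) (pow_le_pow_right₀ hz (by omega))

theorem hasExpansion_const (a : ℂ) : γ.HasExpansion (fun _ => a) (fun j => if j = 0 then a else 0) := by
  have := (hasExpansion_inv_pow (γ := γ) 0).const_mul a
  simpa using this

theorem tendsto_inv_atInfty : Tendsto (fun z : ℂ => z⁻¹) γ.atInfty (𝓝 0) :=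
  tendsto_inv₀_cobounded.mono_left inf_le_left

/-! ### Densities with moments of all orders -/

/-- All products of `f` with powers are good densities. -/
def MomentDensity (γ : LaguerreCurve) (f : ℂ → ℂ) : Prop :=
  ∀ m : ℕ, γ.GoodDensity fun w => w ^ m * f w

/-- The moment `∫_γ w^n f(w) dw`. -/
noncomputable def moment (γ : LaguerreCurve) (f : ℂ → ℂ) (n : ℕ) : ℂ :=
  ∫ t in Ioi (0 : ℝ), γ.toFun t ^ n * f (γ.toFun t) * deriv γ.toFun t

variable {f : ℂ → ℂ}

theorem MomentDensity.goodDensity (hf : γ.MomentDensity f) : γ.GoodDensity f := by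
  simpa using hf 0

theorem MomentDensity.pow_mul (hf : γ.MomentDensity f) (n : ℕ) :
    γ.MomentDensity fun w => w ^ n * f w := fun m => by
  simpa only [pow_add, mul_assoc] using hf (m + n)

/-- The identity behind this is `z / (w - z) = w / (w - z) - 1`. -/
theorem MomentDensity.mul_cauchy_pow (hf : γ.MomentDensity f) (m : ℕ) {z : ℂ}
    (hz : z ∈ γ.supportᶜ) : z * γ.cauchy (fun w => w ^ m * f w) z =
      γ.cauchy (fun w => w ^ (m + 1) * f w) z - γ.moment f m := by
  have h1 := integrableOn_cauchy (f := fun w => w ^ (m + 1) * f w) (hf (m + 1)).integrable hz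
  rw [cauchy, cauchy, moment, ← MeasureTheory.integral_const_mul]
  refine Eq.trans ?_ (MeasureTheory.integral_sub h1 (hf m).integrable)
  refine MeasureTheory.setIntegral_congr_fun measurableSet_Ioi fun t ht => ?_
  have h : γ.toFun t - z ≠ 0 := fun h =>
    hz (sub_eq_zero.1 h ▸ γ.toFun_mem_support (le_of_lt ht))
  field_simp
  ring

theorem MomentDensity.pow_mul_cauchy (hf : γ.MomentDensity f) {n : ℕ}
    (h0 : ∀ k < n, γ.moment f k = 0) {z : ℂ} (hz : z ∈ γ.supportᶜ) :
    z ^ n * γ.cauchy f z = γ.cauchy (fun w => w ^ n * f w) z := by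
  induction n with
  | zero => simp
  | succ n ih =>
    rw [pow_succ', mul_assoc, ih fun k hk => h0 k (hk.trans n.lt_succ_self),
      hf.mul_cauchy_pow n hz, h0 n n.lt_succ_self, sub_zero]

theorem MomentDensity.cauchy_eq (hf : γ.MomentDensity f) (m : ℕ) {z : ℂ} (hz : z ∈ γ.supportᶜ) :
    γ.cauchy f z = (z ^ m)⁻¹ * γ.cauchy (fun w => w ^ m * f w) z -
      ∑ j ∈ Finset.range m, (z ^ (j + 1))⁻¹ * γ.moment f j := by
  have hz0 : z ≠ 0 := γ.ne_zero_of_notMem hz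
  induction m with
  | zero => simp
  | succ m ih =>
    rw [Finset.sum_range_succ, eq_add_of_sub_eq (hf.mul_cauchy_pow m hz).symm]
    rw [ih]
    field_simp
    ring

/-- After `m + 1` iterations the remainder is `z ^ (-(m + 1))` times a bounded Cauchy integral minus
a moment. The coefficients are the negative moments, shifted by one place. -/
theorem MomentDensity.hasExpansion (hf : γ.MomentDensity f) :
    ∃ c : ℕ → ℂ, c 0 = 0 ∧ γ.HasExpansion (γ.cauchy f) c := by
  refine ⟨fun j => if j = 0 then 0 else -γ.moment f (j - 1), if_pos rfl, fun m => ?_⟩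
  have h1 : (fun z => γ.cauchy (fun w => w ^ (m + 1) * f w) z - γ.moment f m)
      =O[γ.atInfty] fun _ => (1 : ℂ) :=
    (hf (m + 1)).isBigO_cauchy.sub (Asymptotics.isBigO_const_const _ one_ne_zero _)
  have h2 := (Asymptotics.isBigO_refl (fun z : ℂ => (z ^ (m + 1))⁻¹) γ.atInfty).mul h1
  simp only [mul_one] at h2
  refine h2.congr' ?_ EventuallyEq.rfl
  filter_upwards [compl_support_mem_atInfty] with z hz
  rw [Finset.sum_range_succ', hf.cauchy_eq (m + 1) hz, Finset.sum_range_succ]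
  simp only [Nat.add_eq_zero_iff, one_ne_zero, and_false, if_false, if_true, mul_zero, add_zero,
    Nat.add_sub_cancel, mul_neg, Finset.sum_neg_distrib]
  ring

end LaguerreCurve

/-! ### Expansions of polynomials and second kind functions -/

open LaguerreCurve

variable {γ : LaguerreCurve}

/-- The entries of `W` are moderate and all moments exist. -/
structure IsGoodWeight (γ : LaguerreCurve) (W : ℂ → Matrix (Fin N) (Fin N) ℂ) : Prop where
  integrable : ∀ (n : ℕ) (i j : Fin N), MeasureTheory.IntegrableOn
    (fun t : ℝ => γ.toFun t ^ n * W (γ.toFun t) i j * deriv γ.toFun t) (Ioi 0)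
  moderate : ∀ i j : Fin N, ∃ ε : ℝ, 0 < ε ∧ γ.IsModerate (ε - 1) (fun w => W w i j)

theorem evalAt_apply (P : (Matrix (Fin N) (Fin N) ℂ)[X]) (z : ℂ) (a b : Fin N) :
    evalAt P z a b = ∑ j ∈ Finset.range (P.natDegree + 1), z ^ j * P.coeff j a b := by
  rw [evalAt_eq_sum le_rfl, Matrix.sum_apply]
  rfl

theorem IsGoodWeight.momentDensity {W : ℂ → Matrix (Fin N) (Fin N) ℂ} (hW : IsGoodWeight γ W)
    (P : (Matrix (Fin N) (Fin N) ℂ)[X]) (a b : Fin N) :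
    γ.MomentDensity fun w => (evalAt P w * W w) a b := by
  intro m
  have h : ∀ w, w ^ m * (evalAt P w * W w) a b = ∑ c : Fin N,
      ∑ j ∈ Finset.range (P.natDegree + 1), P.coeff j a c * (w ^ (m + j) * W w c b) := by
    intro w
    rw [Matrix.mul_apply, Finset.mul_sum]
    refine Finset.sum_congr rfl fun c _ => ?_
    rw [evalAt_apply, Finset.sum_mul, Finset.mul_sum]
    refine Finset.sum_congr rfl fun j _ => ?_
    ring
  simp only [h]
  obtain ⟨ε, hε, hmod⟩ := exists_isModerate_sum (γ := γ) Finset.univ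
    (f := fun (c : Fin N) w => ∑ j ∈ Finset.range (P.natDegree + 1),
      P.coeff j a c * (w ^ (m + j) * W w c b)) fun c _ =>
    exists_isModerate_sum _ fun j _ => by
      obtain ⟨ε, hε, h1⟩ := hW.moderate c b
      refine ⟨ε, hε, ?_⟩
      have := (isModerate_const (γ := γ) (P.coeff j a c)).mul
        ((isModerate_id.pow (m + j)).mul h1)
      convert this using 1
      ring
  refine hmod.goodDensity hε fun n => ?_
  have h2 : ∀ t, γ.toFun t ^ n * (∑ c : Fin N, ∑ j ∈ Finset.range (P.natDegree + 1),
      P.coeff j a c * (γ.toFun t ^ (m + j) * W (γ.toFun t) c b)) * deriv γ.toFun t =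
      ∑ c : Fin N, ∑ j ∈ Finset.range (P.natDegree + 1), P.coeff j a c *
        (γ.toFun t ^ (n + (m + j)) * W (γ.toFun t) c b * deriv γ.toFun t) := by
    intro t
    simp only [Finset.mul_sum, Finset.sum_mul]
    refine Finset.sum_congr rfl fun c _ => Finset.sum_congr rfl fun j _ => ?_
    rw [pow_add _ n]
    ring
  simp only [h2]
  exact MeasureTheory.integrable_finsetSum _ fun c _ => MeasureTheory.integrable_finsetSum _
    fun j _ => (hW.integrable _ c b).const_mul _

theorem secondKindL_apply (W : ℂ → Matrix (Fin N) (Fin N) ℂ) (P : (Matrix (Fin N) (Fin N) ℂ)[X])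
    (z : ℂ) (a b : Fin N) : secondKindL γ W P z a b =
      (2 * Real.pi * I)⁻¹ * γ.cauchy (fun w => (evalAt P w * W w) a b) z := by
  simp only [secondKindL, LaguerreCurve.integral, LaguerreCurve.cauchy, Matrix.smul_apply,
    Matrix.of_apply, smul_eq_mul, mul_assoc]

theorem pairing_apply (W : ℂ → Matrix (Fin N) (Fin N) ℂ) (P : (Matrix (Fin N) (Fin N) ℂ)[X])
    (k : ℕ) (a b : Fin N) :
    ((2 * Real.pi * I)⁻¹ • γ.integral (fun z => z ^ k • (evalAt P z * W z))) a b =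
      (2 * Real.pi * I)⁻¹ * γ.moment (fun w => (evalAt P w * W w) a b) k := by
  simp only [LaguerreCurve.integral, LaguerreCurve.moment, Matrix.smul_apply, Matrix.of_apply,
    smul_eq_mul]

theorem two_pi_I_inv_ne_zero : (2 * Real.pi * I : ℂ)⁻¹ ≠ 0 :=
  inv_ne_zero two_pi_I_ne_zero

/-- The case `n = m` serves the upper left block, `n < m` the lower left one, where the constant
term has to vanish. -/
theorem hasExpansion_evalAt {P : (Matrix (Fin N) (Fin N) ℂ)[X]} {n m : ℕ} (hP : P.natDegree ≤ n)
    (hnm : n ≤ m) (a b : Fin N) : ∃ c : ℕ → ℂ, c 0 = (if n = m then P.coeff n a b else 0) ∧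
      γ.HasExpansion (fun z => (z ^ m)⁻¹ * evalAt P z a b) c := by
  refine ⟨_, ?_, (HasExpansion.sum (Finset.range (n + 1)) fun i _ =>
    (hasExpansion_inv_pow (γ := γ) (m - i)).const_mul (P.coeff i a b)).congr fun z hz => ?_⟩
  · simp only [mul_ite, mul_one, mul_zero]
    rw [Finset.sum_eq_single_of_mem n (Finset.self_mem_range_succ n)]
    · congr 1
      exact propext (by omega)
    · intro j hj hjn
      have := Finset.mem_range.1 hj
      rw [if_neg (by omega)]
  · have hz0 : z ≠ 0 := γ.ne_zero_of_notMem hz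
    rw [evalAt_eq_sum hP, Matrix.sum_apply, Finset.mul_sum]
    refine Finset.sum_congr rfl fun i hi => ?_
    have hi' : i ≤ m := by have := Finset.mem_range.1 hi; omega
    rw [Matrix.smul_apply, smul_eq_mul, ← mul_assoc, mul_comm]
    congr 1
    refine eq_inv_of_mul_eq_one_left ?_
    rw [mul_assoc, ← pow_add,
      Nat.add_sub_cancel' hi', inv_mul_cancel₀ (pow_ne_zero _ hz0)]

theorem IsGoodWeight.hasExpansion_secondKindL {W : ℂ → Matrix (Fin N) (Fin N) ℂ}
    (hW : IsGoodWeight γ W) {P : (Matrix (Fin N) (Fin N) ℂ)[X]} {n : ℕ}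
    (h0 : ∀ k < n, (2 * Real.pi * I)⁻¹ • γ.integral (fun z => z ^ k • (evalAt P z * W z)) = 0)
    (a b : Fin N) :
    ∃ c : ℕ → ℂ, c 0 = 0 ∧ γ.HasExpansion (fun z => z ^ n * secondKindL γ W P z a b) c := by
  have hf := hW.momentDensity P a b
  have hm : ∀ k < n, γ.moment (fun w => (evalAt P w * W w) a b) k = 0 := by
    intro k hk
    have := pairing_apply (γ := γ) W P k a b
    rw [h0 k hk] at this
    exact (mul_eq_zero.1 this.symm).resolve_left two_pi_I_inv_ne_zero
  obtain ⟨c, hc0, hc⟩ := (hf.pow_mul n).hasExpansion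
  refine ⟨_, ?_, (hc.const_mul (2 * Real.pi * I)⁻¹).congr fun z hz => ?_⟩
  · simp [hc0]
  · rw [secondKindL_apply, ← hf.pow_mul_cauchy hm hz]
    ring

/-- The first pairing that need not vanish survives as the constant term, which normalises the lower
right block. -/
theorem IsGoodWeight.hasExpansion_secondKindL_succ {W : ℂ → Matrix (Fin N) (Fin N) ℂ}
    (hW : IsGoodWeight γ W) {P : (Matrix (Fin N) (Fin N) ℂ)[X]} {n : ℕ}
    {X : Matrix (Fin N) (Fin N) ℂ} (h0 : ∀ k ≤ n, (2 * Real.pi * I)⁻¹ •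
      γ.integral (fun z => z ^ k • (evalAt P z * W z)) = if n = k then X else 0) (a b : Fin N) :
    ∃ c : ℕ → ℂ, c 0 = -X a b ∧
      γ.HasExpansion (fun z => z ^ (n + 1) * secondKindL γ W P z a b) c := by
  have hf := hW.momentDensity P a b
  have hm : ∀ k < n, γ.moment (fun w => (evalAt P w * W w) a b) k = 0 := by
    intro k hk
    have := pairing_apply (γ := γ) W P k a b
    rw [h0 k hk.le, if_neg hk.ne'] at this
    exact (mul_eq_zero.1 this.symm).resolve_left two_pi_I_inv_ne_zero
  have hX : X a b = (2 * Real.pi * I)⁻¹ * γ.moment (fun w => (evalAt P w * W w) a b) n := by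
    rw [← pairing_apply, h0 n le_rfl, if_pos rfl]
  obtain ⟨c, hc0, hc⟩ := (hf.pow_mul (n + 1)).hasExpansion
  refine ⟨_, ?_, ((hc.const_mul (2 * Real.pi * I)⁻¹).add
    (hasExpansion_const (-X a b))).congr fun z hz => ?_⟩
  · simp [hc0]
  · rw [secondKindL_apply, hX, pow_succ', mul_left_comm, mul_assoc z, hf.pow_mul_cauchy hm hz,
      hf.mul_cauchy_pow n hz]
    ring

theorem tendsto_matrix_apply {α ι κ : Type*} {l : Filter α} {M : α → Matrix ι κ ℂ} {A : Matrix ι κ ℂ}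
    (h : Tendsto M l (𝓝 A)) (a : ι) (b : κ) : Tendsto (fun x => M x a b) l (𝓝 (A a b)) :=
  tendsto_pi_nhds.1 (tendsto_pi_nhds.1 h a) b

theorem tendsto_matrix {α ι κ : Type*} {l : Filter α} {M : α → Matrix ι κ ℂ} {A : Matrix ι κ ℂ}
    (h : ∀ a b, Tendsto (fun x => M x a b) l (𝓝 (A a b))) : Tendsto M l (𝓝 A) :=
  tendsto_pi_nhds.2 fun a => tendsto_pi_nhds.2 fun b => h a b

theorem tendsto_fromBlocks {α : Type*} {l : Filter α} {A B C D : α → Matrix (Fin N) (Fin N) ℂ}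
    {a b c d : Matrix (Fin N) (Fin N) ℂ} (hA : Tendsto A l (𝓝 a)) (hB : Tendsto B l (𝓝 b))
    (hC : Tendsto C l (𝓝 c)) (hD : Tendsto D l (𝓝 d)) :
    Tendsto (fun x => Matrix.fromBlocks (A x) (B x) (C x) (D x)) l
      (𝓝 (Matrix.fromBlocks a b c d)) := by
  refine tendsto_matrix fun i j => ?_
  rcases i with i | i <;> rcases j with j | j
  · exact tendsto_matrix_apply hA i j
  · exact tendsto_matrix_apply hB i j
  · exact tendsto_matrix_apply hC i j
  · exact tendsto_matrix_apply hD i j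

theorem mul_powDiag_inl (n : ℕ) (z : ℂ) (M : Matrix (Fin N ⊕ Fin N) (Fin N ⊕ Fin N) ℂ)
    (a : Fin N ⊕ Fin N) (j : Fin N) :
    (M * powDiag N n z) a (Sum.inl j) = z ^ n * M a (Sum.inl j) := by
  simp [powDiag, Matrix.mul_apply, Matrix.one_apply, mul_comm]

theorem mul_powDiag_inr (n : ℕ) (z : ℂ) (M : Matrix (Fin N ⊕ Fin N) (Fin N ⊕ Fin N) ℂ)
    (a : Fin N ⊕ Fin N) (j : Fin N) :
    (M * powDiag N n z) a (Sum.inr j) = (z ^ n)⁻¹ * M a (Sum.inr j) := by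
  simp [powDiag, Matrix.mul_apply, Matrix.one_apply, mul_comm]

theorem powDiag_transpose (n : ℕ) (z : ℂ) : (powDiag N n z).transpose = powDiag N n z := by
  simp [powDiag, Matrix.fromBlocks_transpose, Matrix.transpose_smul]

theorem det_powDiag (n : ℕ) {z : ℂ} (hz : z ≠ 0) : (powDiag N n z).det = 1 := by
  rw [powDiag, Matrix.det_fromBlocks_zero₂₁, Matrix.det_smul, Matrix.det_smul, Matrix.det_one,
    mul_one, mul_one, ← mul_pow, mul_inv_cancel₀ (pow_ne_zero _ hz), one_pow]

theorem exists_hasUnitExpansion {Y : ℂ → Matrix (Fin N ⊕ Fin N) (Fin N ⊕ Fin N) ℂ} {n : ℕ}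
    (h1 : ∀ (a : Fin N ⊕ Fin N) (j : Fin N), ∃ c : ℕ → ℂ,
      c 0 = (1 : Matrix (Fin N ⊕ Fin N) (Fin N ⊕ Fin N) ℂ) a (Sum.inl j) ∧
        γ.HasExpansion (fun z => (z ^ n)⁻¹ * Y z a (Sum.inl j)) c)
    (h2 : ∀ (a : Fin N ⊕ Fin N) (j : Fin N), ∃ c : ℕ → ℂ,
      c 0 = (1 : Matrix (Fin N ⊕ Fin N) (Fin N ⊕ Fin N) ℂ) a (Sum.inr j) ∧
        γ.HasExpansion (fun z => z ^ n * Y z a (Sum.inr j)) c) :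
    ∃ F : ℂ → Matrix (Fin N ⊕ Fin N) (Fin N ⊕ Fin N) ℂ,
      HasUnitExpansion γ F ∧ ∀ z ∈ γ.supportᶜ, Y z = F z * powDiag N n z := by
  choose c hc0 hc using h1
  choose d hd0 hd using h2
  have key : ∀ {f : ℂ → ℂ} {e : ℕ → ℂ}, γ.HasExpansion f e → ∀ m : ℕ,
      (fun z => f z - (e 0 + ∑ j ∈ Finset.Icc 1 m, (z ^ j)⁻¹ * e j))
        =O[γ.atInfty] fun z => (z ^ (m + 1))⁻¹ := by
    intro f e h m
    refine (h m).congr_left fun z => ?_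
    rw [Finset.range_eq_Ico, Finset.sum_eq_sum_Ico_succ_bot (Nat.succ_pos m), pow_zero, inv_one,
      one_mul]
    rfl
  refine ⟨fun z => Matrix.of fun a => Sum.elim (fun j => (z ^ n)⁻¹ * Y z a (Sum.inl j))
    fun j => z ^ n * Y z a (Sum.inr j), ⟨fun k => Matrix.of fun a =>
      Sum.elim (fun j => c a j k) fun j => d a j k, fun m a b => ?_⟩, fun z hz => ?_⟩
  · rcases b with j | j
    · refine (key (hc a j) m).congr_left fun z => ?_
      simp [Matrix.sum_apply, hc0]
    · refine (key (hd a j) m).congr_left fun z => ?_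
      simp [Matrix.sum_apply, hd0]
  · have hz0 : z ^ n ≠ 0 := pow_ne_zero _ (γ.ne_zero_of_notMem hz)
    ext a b
    rcases b with j | j
    · rw [mul_powDiag_inl]
      simp [hz0]
    · rw [mul_powDiag_inr]
      simp [hz0]

theorem HasUnitExpansion.tendsto {F : ℂ → Matrix (Fin N ⊕ Fin N) (Fin N ⊕ Fin N) ℂ}
    (hF : HasUnitExpansion γ F) : Tendsto F γ.atInfty (𝓝 1) := by
  obtain ⟨Yc, h⟩ := hF
  refine tendsto_matrix fun a b => ?_
  have h1 := (h 0 a b).trans_tendsto (by simpa using tendsto_inv_atInfty (γ := γ))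
  simpa using h1.add_const ((1 : Matrix (Fin N ⊕ Fin N) (Fin N ⊕ Fin N) ℂ) a b)

/-! ### Solutions are built from pairs of blocks -/

/-- `[A B]` satisfies the conditions on a block row of a solution of the left Riemann–Hilbert problem
away from infinity. -/
structure IsBlockPair (γ : LaguerreCurve) (W A B : ℂ → Matrix (Fin N) (Fin N) ℂ) : Prop where
  holomorphic_left : ∀ a b, DifferentiableOn ℂ (fun z => A z a b) γ.supportᶜ
  holomorphic_right : ∀ a b, DifferentiableOn ℂ (fun z => B z a b) γ.supportᶜ
  jump : ∀ t : ℝ, 0 < t → ∃ a b : Matrix (Fin N) (Fin N) ℂ,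
    Tendsto A (γ.leftNhds t) (𝓝 a) ∧ Tendsto A (γ.rightNhds t) (𝓝 a) ∧
    Tendsto B (γ.leftNhds t) (𝓝 (a * W (γ.toFun t) + b)) ∧ Tendsto B (γ.rightNhds t) (𝓝 b)
  bounded : ∀ a b, (fun z => A z a b) =O[γ.atOrigin] fun _ => (1 : ℂ)
  small : ∀ a b, Tendsto (fun z => z * B z a b) γ.atOrigin (𝓝 0)

theorem isBlockPair_zero_one (W : ℂ → Matrix (Fin N) (Fin N) ℂ) :
    IsBlockPair γ W (fun _ => 0) (fun _ => 1) where
  holomorphic_left _ _ := differentiableOn_const _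
  holomorphic_right _ _ := differentiableOn_const _
  jump t _ := ⟨0, 1, tendsto_const_nhds, tendsto_const_nhds, by
    rw [Matrix.zero_mul, zero_add]; exact tendsto_const_nhds, tendsto_const_nhds⟩
  bounded _ _ := Asymptotics.isBigO_zero _ _
  small a b := by
    have : Tendsto (fun z : ℂ => z * (1 : Matrix (Fin N) (Fin N) ℂ) a b) (𝓝 0) (𝓝 (0 * _)) :=
      tendsto_id.mul_const _
    rw [zero_mul] at this
    exact this.mono_left nhdsWithin_le_nhds

theorem IsBlockPair.const_mul {W A B : ℂ → Matrix (Fin N) (Fin N) ℂ} (h : IsBlockPair γ W A B)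
    (X : Matrix (Fin N) (Fin N) ℂ) : IsBlockPair γ W (fun z => X * A z) (fun z => X * B z) where
  holomorphic_left a b := by
    simp only [Matrix.mul_apply]
    exact DifferentiableOn.fun_sum fun c _ => (h.holomorphic_left c b).const_mul _
  holomorphic_right a b := by
    simp only [Matrix.mul_apply]
    exact DifferentiableOn.fun_sum fun c _ => (h.holomorphic_right c b).const_mul _
  jump t ht := by
    obtain ⟨a, b, h1, h2, h3, h4⟩ := h.jump t ht
    refine ⟨X * a, X * b, h1.const_mul X, h2.const_mul X, ?_, h4.const_mul X⟩
    rw [Matrix.mul_assoc, ← Matrix.mul_add]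
    exact h3.const_mul X
  bounded a b := by
    simp only [Matrix.mul_apply]
    exact Asymptotics.IsBigO.fun_sum fun c _ => (h.bounded c b).const_mul_left _
  small a b := by
    have : Tendsto (fun z => ∑ c, X a c * (z * B z c b)) γ.atOrigin (𝓝 (∑ c, X a c * 0)) :=
      tendsto_finsetSum _ fun c _ => (h.small c b).const_mul _
    simp only [mul_zero, Finset.sum_const_zero] at this
    refine this.congr fun z => ?_
    rw [Matrix.mul_apply, Finset.mul_sum]
    exact Finset.sum_congr rfl fun c _ => mul_left_comm _ _ _

theorem differentiable_evalAt (P : (Matrix (Fin N) (Fin N) ℂ)[X]) (a b : Fin N) :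
    Differentiable ℂ fun z => evalAt P z a b := by
  simp only [evalAt_apply]
  fun_prop

theorem continuous_evalAt (P : (Matrix (Fin N) (Fin N) ℂ)[X]) : Continuous (evalAt P) :=
  continuous_matrix fun a b => (differentiable_evalAt P a b).continuous

/-- Plemelj's limits `c ± πi f`, divided by `2πi`, differ by exactly `f`. -/
theorem IsGoodWeight.exists_tendsto_secondKindL {W : ℂ → Matrix (Fin N) (Fin N) ℂ}
    (hW : IsGoodWeight γ W) (P : (Matrix (Fin N) (Fin N) ℂ)[X]) {t : ℝ} (ht : 0 < t) :
    ∃ b : Matrix (Fin N) (Fin N) ℂ, Tendsto (secondKindL γ W P) (γ.leftNhds t)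
      (𝓝 (evalAt P (γ.toFun t) * W (γ.toFun t) + b)) ∧
      Tendsto (secondKindL γ W P) (γ.rightNhds t) (𝓝 b) := by
  have h := fun a b => (hW.momentDensity P a b).goodDensity.exists_tendsto ht
  choose c hl hr using h
  refine ⟨Matrix.of fun a b => (2 * Real.pi * I)⁻¹ *
    (c a b - Real.pi * I * (evalAt P (γ.toFun t) * W (γ.toFun t)) a b),
    tendsto_matrix fun a b => ?_, tendsto_matrix fun a b => ?_⟩
  · simp only [secondKindL_apply]
    rw [show (evalAt P (γ.toFun t) * W (γ.toFun t) + Matrix.of fun a b => (2 * Real.pi * I)⁻¹ *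
      (c a b - Real.pi * I * (evalAt P (γ.toFun t) * W (γ.toFun t)) a b)) a b =
      (2 * Real.pi * I)⁻¹ *
        (c a b + Real.pi * I * (evalAt P (γ.toFun t) * W (γ.toFun t)) a b) from ?_]
    · exact (hl a b).const_mul _
    · have hpi : (Real.pi : ℂ) ≠ 0 := by exact_mod_cast Real.pi_ne_zero
      rw [Matrix.add_apply, Matrix.of_apply]
      generalize (evalAt P (γ.toFun t) * W (γ.toFun t)) a b = x
      field_simp [I_ne_zero]
      ring
  · simp only [secondKindL_apply]
    exact (hr a b).const_mul _

theorem IsGoodWeight.isBlockPair {W : ℂ → Matrix (Fin N) (Fin N) ℂ} (hW : IsGoodWeight γ W)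
    (P : (Matrix (Fin N) (Fin N) ℂ)[X]) : IsBlockPair γ W (evalAt P) (secondKindL γ W P) where
  holomorphic_left a b := (differentiable_evalAt P a b).differentiableOn
  holomorphic_right a b := by
    simp only [secondKindL_apply]
    have h := (hW.momentDensity P a b).goodDensity.integrable
    exact (differentiableOn_cauchy (f := fun w => (evalAt P w * W w) a b) h).const_mul _
  jump t ht := by
    have he : ∀ l ≤ 𝓝 (γ.toFun t), Tendsto (evalAt P) l (𝓝 (evalAt P (γ.toFun t))) :=
      fun l hl => ((continuous_evalAt P).tendsto _).mono_left hl
    obtain ⟨b, hb⟩ := hW.exists_tendsto_secondKindL P ht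
    exact ⟨_, b, he _ (leftNhds_le _ ht), he _ (rightNhds_le _ ht), hb⟩
  bounded a b := ((((differentiable_evalAt P a b).continuous.tendsto 0).mono_left
    nhdsWithin_le_nhds).isBigO_one ℂ)
  small a b := by
    have := (hW.momentDensity P a b).goodDensity.tendsto_mul_cauchy.const_mul (2 * Real.pi * I)⁻¹
    rw [mul_zero] at this
    refine this.congr fun z => ?_
    rw [secondKindL_apply]
    ring

theorem isSolutionRHL_fromBlocks {W A B C D : ℂ → Matrix (Fin N) (Fin N) ℂ} {n : ℕ}
    (h1 : IsBlockPair γ W A B) (h2 : IsBlockPair γ W C D)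
    (hinf : ∃ F : ℂ → Matrix (Fin N ⊕ Fin N) (Fin N ⊕ Fin N) ℂ, HasUnitExpansion γ F ∧
      ∀ z ∈ γ.supportᶜ, Matrix.fromBlocks (A z) (B z) (C z) (D z) = F z * powDiag N n z) :
    IsSolutionRHL γ W n fun z => Matrix.fromBlocks (A z) (B z) (C z) (D z) where
  holomorphic a b := by
    rcases a with a | a <;> rcases b with b | b
    exacts [h1.holomorphic_left a b, h1.holomorphic_right a b, h2.holomorphic_left a b,
      h2.holomorphic_right a b]
  infinity := hinf
  jump t ht := by
    obtain ⟨a, b, k1, k2, k3, k4⟩ := h1.jump t ht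
    obtain ⟨c, d, l1, l2, l3, l4⟩ := h2.jump t ht
    refine ⟨_, _, tendsto_fromBlocks k1 k3 l1 l3, tendsto_fromBlocks k2 k4 l2 l4, ?_⟩
    simp [Matrix.fromBlocks_multiply]
  origin_bounded a j := by
    rcases a with a | a
    exacts [h1.bounded a j, h2.bounded a j]
  origin_small a j := by
    rcases a with a | a
    exacts [h1.small a j, h2.small a j]

/-- The left half of a biorthogonal system. -/
structure IsLeftOrthogonal (γ : LaguerreCurve) (W : ℂ → Matrix (Fin N) (Fin N) ℂ)
    (P : ℕ → (Matrix (Fin N) (Fin N) ℂ)[X]) (C : ℕ → Matrix (Fin N) (Fin N) ℂ) : Prop where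
  natDegree_le : ∀ n, (P n).natDegree ≤ n
  coeff_self : ∀ n, (P n).coeff n = 1
  nonsingular : ∀ n, IsUnit (C n).det
  orthogonal : ∀ n, ∀ k ≤ n,
    (2 * Real.pi * I)⁻¹ • γ.integral (fun z => z ^ k • (evalAt (P n) z * W z))
      = if n = k then (C n)⁻¹ else 0

theorem IsGoodWeight.isSolutionRHL_YL {W : ℂ → Matrix (Fin N) (Fin N) ℂ} (hW : IsGoodWeight γ W)
    {P : ℕ → (Matrix (Fin N) (Fin N) ℂ)[X]} {C : ℕ → Matrix (Fin N) (Fin N) ℂ}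
    (h : IsLeftOrthogonal γ W P C) (n : ℕ) : IsSolutionRHL γ W n (YL γ W P C n) := by
  have hQ : ∀ n i j, ∃ c : ℕ → ℂ, c 0 = 0 ∧
      γ.HasExpansion (fun z => z ^ n * secondKindL γ W (P n) z i j) c := fun n =>
    hW.hasExpansion_secondKindL fun k hk => by rw [h.orthogonal n k hk.le, if_neg hk.ne']
  have hP : ∀ n i j, ∃ c : ℕ → ℂ, c 0 = (1 : Matrix (Fin N) (Fin N) ℂ) i j ∧
      γ.HasExpansion (fun z => (z ^ n)⁻¹ * evalAt (P n) z i j) c := fun n i j => by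
    simpa [h.coeff_self] using hasExpansion_evalAt (γ := γ) (h.natDegree_le n) le_rfl i j
  cases n with
  | zero =>
    refine isSolutionRHL_fromBlocks (hW.isBlockPair (P 0)) (isBlockPair_zero_one W)
      (exists_hasUnitExpansion ?_ ?_)
    · rintro (i | i) j
      · simpa [Matrix.one_apply] using hP 0 i j
      · exact ⟨fun _ => 0, by simp, by simpa using hasExpansion_zero⟩
    · rintro (i | i) j
      · simpa using hQ 0 i j
      · refine ⟨_, ?_, (hasExpansion_const ((1 : Matrix (Fin N) (Fin N) ℂ) i j)).congr
          fun z _ => ?_⟩ <;> simp [Matrix.one_apply]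
  | succ n =>
    have h2 := (hW.isBlockPair (P n)).const_mul (-C n)
    simp only [neg_mul] at h2
    refine isSolutionRHL_fromBlocks (hW.isBlockPair (P (n + 1))) h2
      (exists_hasUnitExpansion ?_ ?_)
    · rintro (i | i) j
      · simpa [Matrix.one_apply] using hP (n + 1) i j
      · have h3 := hasExpansion_evalAt (γ := γ) (h.natDegree_le n) n.le_succ
        choose c hc0 hc using h3
        refine ⟨_, ?_, (HasExpansion.sum Finset.univ fun k _ =>
          (hc k j).const_mul (-C n i k)).congr fun z _ => ?_⟩
        · simp [hc0]
        · simp only [Matrix.fromBlocks_apply₂₁, Matrix.neg_apply, Matrix.mul_apply, neg_mul,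
            Finset.sum_neg_distrib, mul_neg, Finset.mul_sum, mul_left_comm]
    · rintro (i | i) j
      · simpa using hQ (n + 1) i j
      · have h3 := hW.hasExpansion_secondKindL_succ (h.orthogonal n)
        choose c hc0 hc using h3
        refine ⟨_, ?_, (HasExpansion.sum Finset.univ fun k _ =>
          (hc k j).const_mul (-C n i k)).congr fun z _ => ?_⟩
        -- The constant term is `(-C n) * (-(C n)⁻¹) = 1`, which accounts for the factor `-C n` in
        -- the second block row.
        · simp only [hc0, neg_mul_neg]
          rw [← Matrix.mul_apply, Matrix.mul_nonsing_inv _ (h.nonsingular n)]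
          simp [Matrix.one_apply]
        · simp only [Matrix.fromBlocks_apply₂₂, Matrix.neg_apply, Matrix.mul_apply, neg_mul,
            Finset.sum_neg_distrib, mul_neg, Finset.mul_sum, mul_left_comm]

/-! ### Uniqueness -/

/-- The matrix `[0 I; -I 0]`. -/
def symplecticUnit (N : ℕ) : Matrix (Fin N ⊕ Fin N) (Fin N ⊕ Fin N) ℂ :=
  Matrix.fromBlocks 0 1 (-1) 0

theorem symplecticUnit_mul_self : symplecticUnit N * symplecticUnit N = -1 := by
  rw [symplecticUnit, Matrix.fromBlocks_multiply, ← Matrix.fromBlocks_one, Matrix.fromBlocks_neg]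
  simp

/-- For a left solution `A` and a right solution `B`, every product here pairs a bounded factor with
a small one at the origin, and a factor of order `z ^ n` with one of order `z ^ (-n)` at infinity.
-/
theorem mul_symplecticUnit_mul_apply (A B : Matrix (Fin N ⊕ Fin N) (Fin N ⊕ Fin N) ℂ)
    (a b : Fin N ⊕ Fin N) : (A * symplecticUnit N * B) a b =
      ∑ j, (A a (Sum.inl j) * B (Sum.inr j) b - A a (Sum.inr j) * B (Sum.inl j) b) := by
  rw [Matrix.mul_apply, Fintype.sum_sum_type, Finset.sum_sub_distrib]
  have h1 : ∀ j, (A * symplecticUnit N) a (Sum.inl j) = -A a (Sum.inr j) := fun j => by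
    simp [symplecticUnit, Matrix.mul_apply, Matrix.one_apply]
  have h2 : ∀ j, (A * symplecticUnit N) a (Sum.inr j) = A a (Sum.inl j) := fun j => by
    simp [symplecticUnit, Matrix.mul_apply, Matrix.one_apply]
  simp only [h1, h2, neg_mul, Finset.sum_neg_distrib]
  ring

/-- Through this equivalence the right problem needs no analysis of its own. -/
theorem isSolutionRHR_iff {W : ℂ → Matrix (Fin N) (Fin N) ℂ} {n : ℕ}
    {Y : ℂ → Matrix (Fin N ⊕ Fin N) (Fin N ⊕ Fin N) ℂ} : IsSolutionRHR γ W n Y ↔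
      IsSolutionRHL γ (fun z => (W z).transpose) n (fun z => (Y z).transpose) := by
  have hexp : ∀ {F : ℂ → Matrix (Fin N ⊕ Fin N) (Fin N ⊕ Fin N) ℂ}, HasUnitExpansion γ F →
      HasUnitExpansion γ fun z => (F z).transpose := by
    rintro F ⟨Yc, h⟩
    refine ⟨fun j => (Yc j).transpose, fun m a b => (h m b a).congr_left fun z => ?_⟩
    simp [Matrix.sum_apply, Matrix.one_apply, eq_comm]
  have htr : ∀ {l : Filter ℂ} {M : ℂ → Matrix (Fin N ⊕ Fin N) (Fin N ⊕ Fin N) ℂ}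
      {A : Matrix (Fin N ⊕ Fin N) (Fin N ⊕ Fin N) ℂ}, Tendsto M l (𝓝 A) →
      Tendsto (fun z => (M z).transpose) l (𝓝 A.transpose) := fun h =>
    tendsto_matrix fun a b => tendsto_matrix_apply h b a
  constructor
  · intro h
    refine ⟨fun a b => h.holomorphic b a, ?_, fun t ht => ?_, fun a j => h.origin_bounded j a,
      fun a j => h.origin_small j a⟩
    · obtain ⟨F, hF, hYF⟩ := h.infinity
      exact ⟨_, hexp hF, fun z hz => by rw [hYF z hz, Matrix.transpose_mul, powDiag_transpose]⟩
    · obtain ⟨Yp, Ym, h1, h2, h3⟩ := h.jump t ht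
      refine ⟨_, _, htr h1, htr h2, ?_⟩
      rw [h3, Matrix.transpose_mul, Matrix.fromBlocks_transpose]
      simp
  · intro h
    refine ⟨fun a b => h.holomorphic b a, ?_, fun t ht => ?_, fun j b => h.origin_bounded b j,
      fun j b => h.origin_small b j⟩
    · obtain ⟨F, hF, hYF⟩ := h.infinity
      refine ⟨_, hexp hF, fun z hz => ?_⟩
      rw [← powDiag_transpose, ← Matrix.transpose_mul, ← hYF z hz, Matrix.transpose_transpose]
    · obtain ⟨Yp, Ym, h1, h2, h3⟩ := h.jump t ht
      refine ⟨Yp.transpose, Ym.transpose, by simpa using htr h1, by simpa using htr h2, ?_⟩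
      rw [h3, Matrix.transpose_mul, Matrix.fromBlocks_transpose]
      simp

section Limits

variable {W : ℂ → Matrix (Fin N) (Fin N) ℂ} {n : ℕ}
  {Y Z : ℂ → Matrix (Fin N ⊕ Fin N) (Fin N ⊕ Fin N) ℂ}

theorem IsSolutionRHL.tendsto_inl (h : IsSolutionRHL γ W n Y) (a : Fin N ⊕ Fin N) (j : Fin N) :
    Tendsto (fun z => (z ^ n)⁻¹ * Y z a (Sum.inl j)) γ.atInfty
      (𝓝 ((1 : Matrix (Fin N ⊕ Fin N) (Fin N ⊕ Fin N) ℂ) a (Sum.inl j))) := by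
  obtain ⟨F, hF, hYF⟩ := h.infinity
  refine (tendsto_matrix_apply hF.tendsto a (Sum.inl j)).congr' ?_
  filter_upwards [compl_support_mem_atInfty] with z hz
  rw [hYF z hz, mul_powDiag_inl, inv_mul_cancel_left₀ (pow_ne_zero _ (γ.ne_zero_of_notMem hz))]

theorem IsSolutionRHL.tendsto_inr (h : IsSolutionRHL γ W n Y) (a : Fin N ⊕ Fin N) (j : Fin N) :
    Tendsto (fun z => z ^ n * Y z a (Sum.inr j)) γ.atInfty
      (𝓝 ((1 : Matrix (Fin N ⊕ Fin N) (Fin N ⊕ Fin N) ℂ) a (Sum.inr j))) := by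
  obtain ⟨F, hF, hYF⟩ := h.infinity
  refine (tendsto_matrix_apply hF.tendsto a (Sum.inr j)).congr' ?_
  filter_upwards [compl_support_mem_atInfty] with z hz
  rw [hYF z hz, mul_powDiag_inr, mul_inv_cancel_left₀ (pow_ne_zero _ (γ.ne_zero_of_notMem hz))]

theorem IsSolutionRHR.tendsto_inl (h : IsSolutionRHR γ W n Z) (j : Fin N) (b : Fin N ⊕ Fin N) :
    Tendsto (fun z => (z ^ n)⁻¹ * Z z (Sum.inl j) b) γ.atInfty
      (𝓝 ((1 : Matrix (Fin N ⊕ Fin N) (Fin N ⊕ Fin N) ℂ) (Sum.inl j) b)) := by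
  rw [← Matrix.transpose_one]
  exact (isSolutionRHR_iff.1 h).tendsto_inl b j

theorem IsSolutionRHR.tendsto_inr (h : IsSolutionRHR γ W n Z) (j : Fin N) (b : Fin N ⊕ Fin N) :
    Tendsto (fun z => z ^ n * Z z (Sum.inr j) b) γ.atInfty
      (𝓝 ((1 : Matrix (Fin N ⊕ Fin N) (Fin N ⊕ Fin N) ℂ) (Sum.inr j) b)) := by
  rw [← Matrix.transpose_one]
  exact (isSolutionRHR_iff.1 h).tendsto_inr b j

theorem tendsto_mul_mul_of_isBigO_one {l : Filter ℂ} {f g : ℂ → ℂ}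
    (hf : f =O[l] fun _ => (1 : ℂ)) (hg : Tendsto (fun z => z * g z) l (𝓝 0)) :
    Tendsto (fun z => z * (f z * g z)) l (𝓝 0) := by
  have h := hf.mul (Asymptotics.isBigO_refl (fun z => z * g z) l)
  simp only [one_mul] at h
  refine (h.trans_tendsto hg).congr fun z => mul_left_comm _ _ _

theorem IsSolutionRHL.mul_symplecticUnit_mul (hY : IsSolutionRHL γ W n Y)
    (hZ : IsSolutionRHR γ W n Z) {z : ℂ} (hz : z ∈ γ.supportᶜ) :
    Y z * symplecticUnit N * Z z = symplecticUnit N := by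
  ext a b
  refine NoJump.eq_of_tendsto (γ := γ) (g := fun z => (Y z * symplecticUnit N * Z z) a b)
    ⟨?_, fun t ht => ?_⟩ ?_ ?_ hz
  · simp only [mul_symplecticUnit_mul_apply]
    exact DifferentiableOn.fun_sum fun j _ => ((hY.holomorphic _ _).mul (hZ.holomorphic _ _)).sub
      ((hY.holomorphic _ _).mul (hZ.holomorphic _ _))
  · obtain ⟨Yp, Ym, h1, h2, h3⟩ := hY.jump t ht
    obtain ⟨Zp, Zm, k1, k2, k3⟩ := hZ.jump t ht
    -- The two jump matrices leave the symplectic unit invariant; this is what cancels the jump of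
    -- the product.
    have hT : Matrix.fromBlocks 1 (W (γ.toFun t)) 0 1 * symplecticUnit N *
        Matrix.fromBlocks 1 0 (W (γ.toFun t)) 1 = symplecticUnit N := by
      simp [symplecticUnit, Matrix.fromBlocks_multiply]
    have hpm : Yp * symplecticUnit N * Zp = Ym * symplecticUnit N * Zm := by
      rw [h3, k3]
      conv_rhs => rw [← hT]
      simp only [Matrix.mul_assoc]
    refine ⟨(Ym * symplecticUnit N * Zm) a b, ?_, tendsto_matrix_apply
      ((h2.mul_const _).mul k2) a b⟩
    rw [← hpm]
    exact tendsto_matrix_apply ((h1.mul_const _).mul k1) a b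
  · simp only [mul_symplecticUnit_mul_apply, Finset.mul_sum, mul_sub]
    have : Tendsto (fun z => ∑ j : Fin N, (z * (Y z a (Sum.inl j) * Z z (Sum.inr j) b) -
        z * (Z z (Sum.inl j) b * Y z a (Sum.inr j)))) γ.atOrigin (𝓝 (∑ _j : Fin N, (0 - 0))) :=
      tendsto_finsetSum _ fun j _ =>
        (tendsto_mul_mul_of_isBigO_one (hY.origin_bounded a j) (hZ.origin_small j b)).sub
        (tendsto_mul_mul_of_isBigO_one (hZ.origin_bounded j b) (hY.origin_small a j))
    simp only [sub_zero, Finset.sum_const_zero] at this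
    refine this.congr fun z => Finset.sum_congr rfl fun j _ => ?_
    ring
  · have h : (symplecticUnit N) a b = ((1 : Matrix (Fin N ⊕ Fin N) (Fin N ⊕ Fin N) ℂ) *
      symplecticUnit N * (1 : Matrix (Fin N ⊕ Fin N) (Fin N ⊕ Fin N) ℂ)) a b := by simp
    rw [h, mul_symplecticUnit_mul_apply]
    refine Tendsto.congr' ?_ (tendsto_finsetSum Finset.univ fun j _ =>
      ((hY.tendsto_inl a j).mul (hZ.tendsto_inr j b)).sub
        ((hY.tendsto_inr a j).mul (hZ.tendsto_inl j b)))
    filter_upwards [compl_support_mem_atInfty] with z hz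
    have hz0 : z ^ n ≠ 0 := pow_ne_zero _ (γ.ne_zero_of_notMem hz)
    rw [mul_symplecticUnit_mul_apply]
    refine Finset.sum_congr rfl fun j _ => ?_
    field_simp

theorem IsSolutionRHL.mul_eq_one (hY : IsSolutionRHL γ W n Y)
    (hZ : IsSolutionRHR γ W n Z) {z : ℂ} (hz : z ∈ γ.supportᶜ) :
    Y z * (symplecticUnit N * Z z * -symplecticUnit N) = 1 := by
  rw [← Matrix.mul_assoc, ← Matrix.mul_assoc, hY.mul_symplecticUnit_mul hZ hz, Matrix.mul_neg,
    symplecticUnit_mul_self, neg_neg]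

/-- The inverse found in `mul_eq_one` depends on the right solution only. -/
theorem IsSolutionRHL.eq (hZ : IsSolutionRHR γ W n Z) {Y' : ℂ → Matrix (Fin N ⊕ Fin N) (Fin N ⊕ Fin N) ℂ}
    (hY : IsSolutionRHL γ W n Y) (hY' : IsSolutionRHL γ W n Y') {z : ℂ} (hz : z ∈ γ.supportᶜ) :
    Y z = Y' z :=
  (Matrix.inv_eq_left_inv (hY.mul_eq_one hZ hz)).symm.trans
    (Matrix.inv_eq_left_inv (hY'.mul_eq_one hZ hz))

end Limits

/-! ### The determinant -/

theorem det_isBigO_one {ι : Type*} [Fintype ι] [DecidableEq ι] {l : Filter ℂ} {V : ℂ → Matrix ι ι ℂ}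
    (h : ∀ a b, (fun z => V z a b) =O[l] fun _ => (1 : ℂ)) :
    (fun z => (V z).det) =O[l] fun _ => (1 : ℂ) := by
  simp only [Matrix.det_apply]
  refine Asymptotics.IsBigO.fun_sum fun σ _ => ?_
  have h1 : (fun z => ∏ i, V z (σ i) i) =O[l] fun _ => ∏ _i : ι, (1 : ℂ) :=
    Asymptotics.IsBigO.finsetProd fun i _ => h (σ i) i
  simp only [Finset.prod_const_one] at h1
  simp only [Units.smul_def, zsmul_eq_mul]
  exact h1.const_mul_left _

theorem differentiableOn_det {ι : Type*} [Fintype ι] [DecidableEq ι] {s : Set ℂ}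
    {V : ℂ → Matrix ι ι ℂ} (h : ∀ a b, DifferentiableOn ℂ (fun z => V z a b) s) :
    DifferentiableOn ℂ (fun z => (V z).det) s := by
  simp only [Matrix.det_apply, Units.smul_def, zsmul_eq_mul]
  exact DifferentiableOn.fun_sum fun σ _ =>
    (DifferentiableOn.fun_finsetProd fun i _ => h (σ i) i).const_mul _

theorem tendsto_det {ι α : Type*} [Fintype ι] [DecidableEq ι] {l : Filter α}
    {V : α → Matrix ι ι ℂ} {A : Matrix ι ι ℂ} (h : Tendsto V l (𝓝 A)) :
    Tendsto (fun z => (V z).det) l (𝓝 A.det) :=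
  ((continuous_id.matrix_det (R := ℂ)).tendsto A).comp h

theorem tendsto_mul_zero_of_isBigO_one {f : ℂ → ℂ} (h : f =O[γ.atOrigin] fun _ => (1 : ℂ)) :
    Tendsto (fun z => z * f z) γ.atOrigin (𝓝 0) := by
  have h1 := (Asymptotics.isBigO_refl (fun z : ℂ => z) γ.atOrigin).mul h
  simp only [mul_one] at h1
  exact h1.trans_tendsto (tendsto_id.mono_left nhdsWithin_le_nhds)

theorem IsSolutionRHL.det_eq_one {W : ℂ → Matrix (Fin N) (Fin N) ℂ} (hW : IsGoodWeight γ W) {n : ℕ}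
    {Y : ℂ → Matrix (Fin N ⊕ Fin N) (Fin N ⊕ Fin N) ℂ} (hY : IsSolutionRHL γ W n Y) {z : ℂ}
    (hz : z ∈ γ.supportᶜ) : (Y z).det = 1 := by
  -- The constant polynomial `1` yields a block pair `[I q]` with the jump of `W` itself, and `[I
  -- -q; 0 I]` undoes the jump of `Y`.
  obtain ⟨q, hq⟩ : ∃ q : ℂ → Matrix (Fin N) (Fin N) ℂ, IsBlockPair γ W (fun _ => 1) q := by
    refine ⟨secondKindL γ W 1, ?_⟩
    have h := hW.isBlockPair 1
    have h1 : evalAt (1 : (Matrix (Fin N) (Fin N) ℂ)[X]) = fun _ => 1 := by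
      funext z
      simp [evalAt]
    rwa [h1] at h
  set U : ℂ → Matrix (Fin N ⊕ Fin N) (Fin N ⊕ Fin N) ℂ := fun z =>
    Matrix.fromBlocks 1 (-q z) 0 1 with hU
  set V : ℂ → Matrix (Fin N ⊕ Fin N) (Fin N ⊕ Fin N) ℂ := fun z => Y z * U z with hV
  have hVl : ∀ z a j, V z a (Sum.inl j) = Y z a (Sum.inl j) := fun z a j => by
    simp [hV, hU, Matrix.mul_apply, Matrix.one_apply]
  have hVr : ∀ z a j, V z a (Sum.inr j) = Y z a (Sum.inr j) -
      ∑ k, Y z a (Sum.inl k) * q z k j := fun z a j => by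
    simp [hV, hU, Matrix.mul_apply, Matrix.one_apply]
    ring
  have hdetV : ∀ z, (V z).det = (Y z).det := fun z => by
    simp [hV, hU, Matrix.det_mul]
  have hVd : ∀ a b, DifferentiableOn ℂ (fun z => V z a b) γ.supportᶜ := by
    rintro a (j | j)
    · simp only [hVl]; exact hY.holomorphic _ _
    · simp only [hVr]
      exact (hY.holomorphic _ _).sub (DifferentiableOn.fun_sum fun k _ =>
        (hY.holomorphic _ _).mul (hq.holomorphic_right k j))
  have hVjump : ∀ t, 0 < t → ∃ A, Tendsto V (γ.leftNhds t) (𝓝 A) ∧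
      Tendsto V (γ.rightNhds t) (𝓝 A) := by
    intro t ht
    obtain ⟨Yp, Ym, h1, h2, h3⟩ := hY.jump t ht
    obtain ⟨a, b, k0, -, k1, k2⟩ := hq.jump t ht
    have ha : a = 1 := (tendsto_nhds_unique k0 tendsto_const_nhds)
    rw [ha, one_mul] at k1
    have hUl : Tendsto U (γ.leftNhds t)
        (𝓝 (Matrix.fromBlocks 1 (-(W (γ.toFun t) + b)) 0 1)) :=
      tendsto_fromBlocks tendsto_const_nhds k1.neg tendsto_const_nhds tendsto_const_nhds
    have hUr : Tendsto U (γ.rightNhds t) (𝓝 (Matrix.fromBlocks 1 (-b) 0 1)) :=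
      tendsto_fromBlocks tendsto_const_nhds k2.neg tendsto_const_nhds tendsto_const_nhds
    refine ⟨_, ?_, h2.mul hUr⟩
    convert h1.mul hUl using 2
    rw [h3, Matrix.mul_assoc, Matrix.fromBlocks_multiply]
    congr 1
    simp
  have hVsmall : ∀ a b, Tendsto (fun z => z * V z a b) γ.atOrigin (𝓝 0) := by
    rintro a (j | j)
    · simp only [hVl]
      exact tendsto_mul_zero_of_isBigO_one (hY.origin_bounded a j)
    · have : Tendsto (fun z => z * Y z a (Sum.inr j) -
          ∑ k, z * (Y z a (Sum.inl k) * q z k j)) γ.atOrigin (𝓝 (0 - ∑ _k : Fin N, 0)) :=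
        (hY.origin_small a j).sub (tendsto_finsetSum _ fun k _ =>
          tendsto_mul_mul_of_isBigO_one (hY.origin_bounded a k) (hq.small k j))
      simp only [Finset.sum_const_zero, sub_zero] at this
      refine this.congr fun z => ?_
      rw [hVr, mul_sub, Finset.mul_sum]
  have hVno : ∀ a b, γ.NoJump fun z => V z a b := fun a b => ⟨hVd a b, fun t ht => by
    obtain ⟨A, h1, h2⟩ := hVjump t ht
    exact ⟨A a b, tendsto_matrix_apply h1 a b, tendsto_matrix_apply h2 a b⟩⟩
  rw [← hdetV]
  -- Without jump, entries that are `o(1/z)` at the origin are bounded there, hence so is the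
  -- determinant.
  refine NoJump.eq_of_tendsto (γ := γ) (g := fun z => (V z).det)
    ⟨differentiableOn_det hVd, fun t ht => ?_⟩ (tendsto_mul_zero_of_isBigO_one
      (det_isBigO_one fun a b => (hVno a b).isBigO_one (hVsmall a b))) ?_ hz
  · obtain ⟨A, h1, h2⟩ := hVjump t ht
    exact ⟨_, tendsto_det h1, tendsto_det h2⟩
  · obtain ⟨F, hF, hYF⟩ := hY.infinity
    have h1 := tendsto_det hF.tendsto
    rw [Matrix.det_one] at h1
    refine h1.congr' ?_
    filter_upwards [compl_support_mem_atInfty] with z hz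
    rw [hdetV, hYF z hz, Matrix.det_mul, det_powDiag n (γ.ne_zero_of_notMem hz), mul_one]

theorem hasDetOne_of_forall {Y : ℂ → Matrix (Fin N ⊕ Fin N) (Fin N ⊕ Fin N) ℂ}
    (h : ∀ z ∈ γ.supportᶜ, (Y z).det = 1) : HasDetOne γ Y := by
  refine ⟨h, fun t ht A hA => ?_⟩
  rcases hA with hA | hA
  · refine tendsto_nhds_unique (tendsto_det hA) (tendsto_const_nhds.congr' ?_)
    filter_upwards [compl_support_mem_leftNhds γ ht] with z hz using (h z hz).symm
  · refine tendsto_nhds_unique (tendsto_det hA) (tendsto_const_nhds.congr' ?_)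
    filter_upwards [compl_support_mem_rightNhds γ ht] with z hz using (h z hz).symm

/-! ### Transposition -/

theorem IsGoodWeight.transpose {W : ℂ → Matrix (Fin N) (Fin N) ℂ} (hW : IsGoodWeight γ W) :
    IsGoodWeight γ fun z => (W z).transpose :=
  ⟨fun n i j => hW.integrable n j i, fun i j => hW.moderate j i⟩

theorem IsBiorthogonalSystem.isLeftOrthogonal {W : ℂ → Matrix (Fin N) (Fin N) ℂ}
    {PL PR : ℕ → (Matrix (Fin N) (Fin N) ℂ)[X]} {C : ℕ → Matrix (Fin N) (Fin N) ℂ}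
    (h : IsBiorthogonalSystem γ W PL PR C) : IsLeftOrthogonal γ W PL C :=
  ⟨fun n => (h.monic_left n).1, fun n => (h.monic_left n).2, h.nonsingular, h.orthogonal_left⟩

/-- Transposing the coefficients of the right polynomials gives left orthogonal polynomials for the
transposed weight. -/
theorem IsBiorthogonalSystem.exists_transpose {W : ℂ → Matrix (Fin N) (Fin N) ℂ}
    {PL PR : ℕ → (Matrix (Fin N) (Fin N) ℂ)[X]} {C : ℕ → Matrix (Fin N) (Fin N) ℂ}
    (h : IsBiorthogonalSystem γ W PL PR C) : ∃ P : ℕ → (Matrix (Fin N) (Fin N) ℂ)[X],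
      IsLeftOrthogonal γ (fun z => (W z).transpose) P (fun n => (C n).transpose) ∧
      ∀ n z, YR γ W PR C n z =
        (YL γ (fun z => (W z).transpose) P (fun n => (C n).transpose) n z).transpose := by
  have hP : ∀ n, ∃ P : (Matrix (Fin N) (Fin N) ℂ)[X], P.natDegree ≤ n ∧
      P.coeff = fun k => ((PR n).coeff k).transpose := fun n =>
    exists_natDegree_le_coeff_eq _ fun k hk => by
      rw [coeff_eq_zero_of_natDegree_lt ((h.monic_right n).1.trans_lt hk), Matrix.transpose_zero]
  choose P hP1 hP2 using hP
  have heval : ∀ n z, evalAt (P n) z = (evalAt (PR n) z).transpose := fun n z => by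
    rw [evalAt_eq_sum (hP1 n), evalAt_eq_sum (h.monic_right n).1, Matrix.transpose_sum]
    simp only [Matrix.transpose_smul, hP2]
  have hint : ∀ (s : ℂ → ℂ) (n : ℕ),
      γ.integral (fun w => s w • (evalAt (P n) w * (W w).transpose)) =
        (γ.integral fun w => s w • (W w * evalAt (PR n) w)).transpose := fun s n => by
    simp only [heval, ← Matrix.transpose_mul, ← Matrix.transpose_smul]
    rfl
  have hQ : ∀ n z, secondKindL γ (fun z => (W z).transpose) (P n) z =
      (secondKindR γ W (PR n) z).transpose := fun n z => by
    rw [secondKindL, secondKindR, hint fun w => (w - z)⁻¹, Matrix.transpose_smul]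
  refine ⟨P, ⟨hP1, fun n => ?_, fun n => ?_, fun n k hk => ?_⟩, fun n z => ?_⟩
  · simp [hP2, (h.monic_right n).2]
  · rw [Matrix.det_transpose]
    exact h.nonsingular n
  · rw [hint fun w => w ^ k, ← Matrix.transpose_smul, h.orthogonal_right n k hk,
      ← Matrix.transpose_nonsing_inv]
    split_ifs <;> simp
  · cases n <;>
      simp [YR, YL, Matrix.fromBlocks_transpose, heval, hQ]

theorem IsRegularWeight.isGoodWeight {W : ℂ → Matrix (Fin N) (Fin N) ℂ} (hreg : IsRegularWeight γ W)
    (hW : IsLaguerreType γ W) : IsGoodWeight γ W :=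
  ⟨hreg.integrable, hW.exists_isModerate⟩

theorem mainTheorem1 {N : ℕ} (γ : LaguerreCurve) (W : ℂ → Matrix (Fin N) (Fin N) ℂ)
    (hreg : IsRegularWeight γ W) (hW : IsLaguerreType γ W) :
    (∃! S : (ℕ → (Matrix (Fin N) (Fin N) ℂ)[X]) × (ℕ → (Matrix (Fin N) (Fin N) ℂ)[X]) ×
        (ℕ → Matrix (Fin N) (Fin N) ℂ), IsBiorthogonalSystem γ W S.1 S.2.1 S.2.2) ∧
    ∀ (PL PR : ℕ → (Matrix (Fin N) (Fin N) ℂ)[X]) (C : ℕ → Matrix (Fin N) (Fin N) ℂ),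
      IsBiorthogonalSystem γ W PL PR C → ∀ n : ℕ,
        (IsSolutionRHL γ W n (YL γ W PL C n) ∧
          ∀ Y, IsSolutionRHL γ W n Y → ∀ z ∈ γ.supportᶜ, Y z = YL γ W PL C n z) ∧
        (IsSolutionRHR γ W n (YR γ W PR C n) ∧
          ∀ Y, IsSolutionRHR γ W n Y → ∀ z ∈ γ.supportᶜ, Y z = YR γ W PR C n z) ∧
        HasDetOne γ (YL γ W PL C n) ∧ HasDetOne γ (YR γ W PR C n) := by
  refine ⟨existsUnique_biorthogonalSystem hreg, fun PL PR C h n => ?_⟩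
  have hgood := hreg.isGoodWeight hW
  have hL := hgood.isSolutionRHL_YL h.isLeftOrthogonal n
  obtain ⟨P, hP, hYR⟩ := h.exists_transpose
  have hRt := hgood.transpose.isSolutionRHL_YL hP n
  have hR : IsSolutionRHR γ W n (YR γ W PR C n) := by
    rw [isSolutionRHR_iff]
    simp only [hYR, Matrix.transpose_transpose]
    exact hRt
  -- Uniqueness on the right becomes uniqueness on the left for the transposed weight. That argument
  -- needs a right solution for the transposed weight, and the transpose of `YL` is one.
  have hLt : IsSolutionRHR γ (fun z => (W z).transpose) n
      (fun z => (YL γ W PL C n z).transpose) := by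
    simpa only [isSolutionRHR_iff, Matrix.transpose_transpose] using hL
  refine ⟨⟨hL, fun Y hY z hz => IsSolutionRHL.eq hR hY hL hz⟩, ⟨hR, fun Y hY z hz => ?_⟩,
    hasDetOne_of_forall fun z hz => hL.det_eq_one hgood hz, hasDetOne_of_forall fun z hz => ?_⟩
  · rw [hYR, ← IsSolutionRHL.eq hLt (isSolutionRHR_iff.1 hY) hRt hz, Matrix.transpose_transpose]
  · rw [hYR, Matrix.det_transpose]
    exact hRt.det_eq_one hgood.transpose hz
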